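/- All graphs are finite and simple. A \emph{drawing} of a graph places its vertices at distinct points of the plane and represents every edge by a simple arc between its end vertices that passes through no other vertex, such that any two edges have finitely many common points and every common point of two edges that is not a vertex is a proper (transversal) crossing; two edges may cross more than once, and edges with a common end vertex may cross. A drawing is \emph{planar} if no two edges cross, and \emph{quasiplanar} if no three edges pairwise cross; a graph is planar if it has a planar drawing. Graphs $G_1,\dots,G_k$ with shared vertex set $V$ \emph{admit a QuaSEFE} if there are quasiplanar drawings $\Gamma_1,\dots,\Gamma_k$ of $G_1,\dots,G_k$, respectively, such that each vertex of $V$ has the same position in every $\Gamma_i$ and each edge shared by two graphs $G_i$ and $G_j$ is drawn as the same curve in $\Gamma_i$ and $\Gamma_j$. Let $G_1=(V,E_1)$, $G_2=(V,E_2)$, $G_3=(V,E_3)$ be planar graphs with shared vertex set $V$, and let $H$ be the graph formed by the edges in $E_1\cap E_2\cap E_3$. If $H$ is acyclic and has maximum degree at most $2$, then $\langle G_1,G_2,G_3\rangle$ admits a QuaSEFE. -/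

import Mathlib

/-- The Euclidean plane. -/
abbrev Plane : Type := EuclideanSpace ℝ (Fin 2)

/-- `S` is a simple (Jordan) arc with endpoints `a` and `b`. -/
def IsSimpleArc (a b : Plane) (S : Set Plane) : Prop :=
  ∃ γ : Path a b, Function.Injective γ ∧ Set.range γ = S

/-- The point sets `S` and `T` cross properly at `p`: some local homeomorphism of the plane around
`p` straightens `S` to one coordinate axis and `T` to the other one. -/
def CrossProperlyAt (S T : Set Plane) (p : Plane) : Prop :=
  ∃ φ : OpenPartialHomeomorph Plane Plane, p ∈ φ.source ∧ φ p = 0 ∧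
    ∀ q ∈ φ.source, (q ∈ S ↔ φ q 0 = 0) ∧ (q ∈ T ↔ φ q 1 = 0)

/-- A (topological, not necessarily simple) drawing of a graph in the plane: vertices are distinct
points, every edge is a simple arc between its two end vertices that passes through no other
vertex, two edges have only finitely many common points, and every common point of two edges that
is not a vertex is a proper crossing. Two edges may cross several times, and adjacent edges may
cross. -/
structure GraphDrawing {V : Type*} (G : SimpleGraph V) where
  /-- the position of each vertex -/
  pos : V → Plane
  /-- the curve that represents each edge -/
  curve : G.edgeSet → Set Plane
  pos_injective : Function.Injective pos
  curve_isSimpleArc : ∀ (u v : V) (h : G.Adj u v), IsSimpleArc (pos u) (pos v) (curve ⟨s(u, v), h⟩)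
  mem_of_pos_mem_curve : ∀ (e : G.edgeSet) (w : V), pos w ∈ curve e → w ∈ (e : Sym2 V)
  finite_inter : ∀ e f : G.edgeSet, e ≠ f → (curve e ∩ curve f).Finite
  crossProperlyAt : ∀ e f : G.edgeSet, e ≠ f → ∀ p ∈ curve e ∩ curve f, p ∉ Set.range pos →
    CrossProperlyAt (curve e) (curve f) p

namespace GraphDrawing

variable {V : Type*} {G : SimpleGraph V}

/-- Two distinct edges cross in the drawing: they have a common point other than a vertex. -/
def Cross (Γ : GraphDrawing G) (e f : G.edgeSet) : Prop :=
  e ≠ f ∧ ∃ p ∈ Γ.curve e ∩ Γ.curve f, p ∉ Set.range Γ.pos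

/-- A drawing is planar if no two edges cross. -/
def IsPlanar (Γ : GraphDrawing G) : Prop :=
  ∀ e f : G.edgeSet, ¬ Γ.Cross e f

/-- A drawing is quasiplanar if no three edges pairwise cross. -/
def IsQuasiplanar (Γ : GraphDrawing G) : Prop :=
  ∀ e f g : G.edgeSet, ¬ (Γ.Cross e f ∧ Γ.Cross e g ∧ Γ.Cross f g)

end GraphDrawing

/-- A graph is planar if it has a planar drawing. -/
def IsPlanarGraph {V : Type*} (G : SimpleGraph V) : Prop :=
  ∃ Γ : GraphDrawing G, Γ.IsPlanar

/-- The graphs `G i` on the common vertex set `V` admit a QuaSEFE: they have quasiplanar drawings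
in which each vertex has the same position in all drawings, and each edge shared by two of the
graphs is drawn as the same curve in both drawings. -/
def AdmitsQuaSEFE {V ι : Type*} (G : ι → SimpleGraph V) : Prop :=
  ∃ Γ : (i : ι) → GraphDrawing (G i),
    (∀ i, (Γ i).IsQuasiplanar) ∧
    (∀ i j, ∀ v : V, (Γ i).pos v = (Γ j).pos v) ∧
    ∀ i j, ∀ (e : Sym2 V) (hi : e ∈ (G i).edgeSet) (hj : e ∈ (G j).edgeSet),
      (Γ i).curve ⟨e, hi⟩ = (Γ j).curve ⟨e, hj⟩

/-! A drawing whose edges fall into two classes without crossings inside either class is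
quasiplanar: among three edges, two lie in the same class. It therefore suffices to find three sets
of edges `𝒜₁`, `𝒜₂`, `𝒜₃` with `𝒜ᵢ` contained in the planar graph `Gᵢ`, such that each `Gᵢ` is
covered by two of them, and to draw all three on the same vertices, each without internal crossings,
so that they agree on common edges.

The graph `H` is a disjoint union of paths, so its edges split into two matchings
(`SimpleGraph.IsAcyclic.exists_edge_colouring`). All of `H` goes into `𝒜₂`, one matching also into
`𝒜₁`, the other also into `𝒜₃`. The edges outside `H` are distributed so that these matchings are
the only overlaps: `𝒜₁` meets `𝒜₂` in one, `𝒜₃` meets `𝒜₂` in the other, and `𝒜₁` and `𝒜₃` are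
disjoint.

Draw `𝒜₂` first. The other two classes must then be drawn with prescribed vertices and prescribed
curves on a matching. This is possible because disjoint arcs realizing a matching have no
topological invariants: each arc can be contracted to a tiny segment at one of its ends, and tiny
segments can be carried anywhere. Hence a homeomorphism of the plane takes the matching edges of any
plane drawing to the prescribed curves (`exists_homeomorph_matching`).

Finite intersections and proper crossings between classes come from polygonal edges in general
position. Each edge that is not prescribed is replaced by a shortest polygonal route inside a tube
of its own, with nodes in a dense set in general position to everything drawn before
(`IsPlaneSystem.redraw`, `IsGenericPoly.crossProperlyAt`). -/

open Set Filter Topology Metric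
open scoped NNReal

/-! ### Moving points by homeomorphisms -/

section Push

variable {E : Type*} [NormedAddCommGroup E] [NormedSpace ℝ E] [CompleteSpace E]

/-- The map `x ↦ x + φ x • w` is a homeomorphism if `φ` is Lipschitz and `w` is short. -/
theorem exists_homeomorph_add_smul (φ : E → ℝ) (K : ℝ) (hφ : ∀ x y, |φ x - φ y| ≤ K * ‖x - y‖)
    (w : E) (hw : K * ‖w‖ < 1) : ∃ h : E ≃ₜ E, ∀ x, h x = x + φ x • w := by
  by_cases hK : 0 ≤ K
  -- The map differs from the identity by a contraction, so the quantitative inverse function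
  -- theorem applies globally.
  · have hA : ApproximatesLinearOn (fun x => x + φ x • w)
        ((ContinuousLinearEquiv.refl ℝ E : E ≃L[ℝ] E) : E →L[ℝ] E) univ
        (K * ‖w‖).toNNReal := by
      intro x _ y _
      have h1 : (x + φ x • w - (y + φ y • w) -
          ((ContinuousLinearEquiv.refl ℝ E : E ≃L[ℝ] E) : E →L[ℝ] E) (x - y))
          = (φ x - φ y) • w := by
        simp only [ContinuousLinearEquiv.coe_refl, ContinuousLinearMap.id_apply, sub_smul]
        abel
      rw [h1, norm_smul, Real.norm_eq_abs, Real.coe_toNNReal _ (by positivity)]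
      calc |φ x - φ y| * ‖w‖ ≤ (K * ‖x - y‖) * ‖w‖ := by gcongr; exact hφ x y
        _ = K * ‖w‖ * ‖x - y‖ := by ring
    by_cases hs : Subsingleton E
    · exact ⟨hA.toHomeomorph _ (Or.inl hs), fun x => rfl⟩
    · refine ⟨hA.toHomeomorph _ (Or.inr ?_), fun x => rfl⟩
      have : Nontrivial E := not_subsingleton_iff_nontrivial.1 hs
      have h2 : ‖(((ContinuousLinearEquiv.refl ℝ E : E ≃L[ℝ] E).symm : E ≃L[ℝ] E) : E →L[ℝ] E)‖₊
          = 1 := by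
        simp
      rw [h2, inv_one, ← NNReal.coe_lt_coe, Real.coe_toNNReal _ (by positivity)]
      simpa using hw
  -- A negative `K` forces `E` to be trivial.
  · refine ⟨Homeomorph.refl E, fun x => ?_⟩
    have hx : x = 0 := by
      by_contra hne
      have h0 := hφ x 0
      have h1 : K * ‖x - 0‖ < 0 := by
        apply mul_neg_of_neg_of_pos (not_le.1 hK)
        simpa using hne
      exact absurd (abs_nonneg (φ x - φ 0)) (by linarith)
    have hw0 : w = 0 := by
      by_contra hne
      have h0 := hφ w 0
      have h1 : K * ‖w - 0‖ < 0 := by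
        apply mul_neg_of_neg_of_pos (not_le.1 hK)
        simpa using hne
      exact absurd (abs_nonneg (φ w - φ 0)) (by linarith)
    simp [hw0]

/-- In a connected open set, any point can be pushed to any other by a homeomorphism that has
compact support and is a translation near the first point. -/
theorem exists_homeomorph_push [ProperSpace E] {U : Set E} (hU : IsOpen U) (hc : IsPreconnected U)
    {a b : E} (ha : a ∈ U) (hb : b ∈ U) :
    ∃ h : E ≃ₜ E, (∃ C ⊆ U, IsCompact C ∧ ∀ x ∉ C, h x = x) ∧
      ∀ᶠ z in 𝓝 a, h z = z + (b - a) := by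
  -- The relation is symmetric and transitive, so on a connected set only pushes to nearby points
  -- need a construction.
  refine hc.induction₂ (fun a b => ∃ h : E ≃ₜ E, (∃ C ⊆ U, IsCompact C ∧ ∀ x ∉ C, h x = x) ∧
      ∀ᶠ z in 𝓝 a, h z = z + (b - a)) ?_ ?_ ?_ ha hb
  · intro x hx
    obtain ⟨ε, hε, hball⟩ := Metric.nhds_basis_closedBall.mem_iff.1 (hU.mem_nhds hx)
    have : ∀ᶠ y in 𝓝[U] x, y ∈ ball x (ε / 2) :=
      nhdsWithin_le_nhds (ball_mem_nhds _ (by positivity))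
    filter_upwards [this] with y hy
    rw [mem_ball, dist_eq_norm] at hy
    -- The cutoff is `1` up to radius `ε / 2`, which gives the translation near `x`, and `0` from
    -- radius `ε` on. Its slope is `2 / ε`, so displacements shorter than `ε / 2` are admissible.
    obtain ⟨h, hh⟩ := exists_homeomorph_add_smul
      (fun z => max 0 (min 1 (2 - 2 / ε * ‖z - x‖))) (2 / ε) (fun z z' => by
        have h1 : |2 - 2 / ε * ‖z - x‖ - (2 - 2 / ε * ‖z' - x‖)| ≤ 2 / ε * ‖z - z'‖ := by
          have h2 : 2 - 2 / ε * ‖z - x‖ - (2 - 2 / ε * ‖z' - x‖)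
            = (2 / ε) * (‖z' - x‖ - ‖z - x‖) := by ring
          rw [h2, abs_mul, abs_of_pos (by positivity : 0 < 2 / ε)]
          gcongr
          have := abs_norm_sub_norm_le (z' - x) (z - x)
          rwa [sub_sub_sub_cancel_right, norm_sub_rev z' z] at this
        refine le_trans ?_ h1
        calc _ ≤ |min 1 (2 - 2 / ε * ‖z - x‖) - min 1 (2 - 2 / ε * ‖z' - x‖)| := by
                have := abs_max_sub_max_le_max 0 (min 1 (2 - 2 / ε * ‖z - x‖)) 0
                  (min 1 (2 - 2 / ε * ‖z' - x‖))
                simpa using this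
          _ ≤ _ := by
                have := abs_min_sub_min_le_max 1 (2 - 2 / ε * ‖z - x‖) 1
                  (2 - 2 / ε * ‖z' - x‖)
                simpa using this) (y - x) (by
        rw [div_mul_eq_mul_div, div_lt_one hε]; linarith)
    refine ⟨h, ⟨closedBall x ε, hball, isCompact_closedBall _ _, fun z hz => ?_⟩, ?_⟩
    · rw [mem_closedBall, dist_eq_norm, not_le] at hz
      have h3 : 2 - 2 / ε * ‖z - x‖ ≤ 0 := by
        rw [div_mul_eq_mul_div, sub_nonpos, le_div_iff₀ hε]; linarith
      rw [hh, max_eq_left (le_trans (min_le_right _ _) h3)]; simp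
    · filter_upwards [ball_mem_nhds x (by positivity : 0 < ε / 2)] with z hz
      rw [mem_ball, dist_eq_norm] at hz
      have h3 : 1 ≤ 2 - 2 / ε * ‖z - x‖ := by
        have : 2 / ε * ‖z - x‖ ≤ 1 := by
          rw [div_mul_eq_mul_div, div_le_one hε]; linarith
        linarith
      rw [hh, min_eq_left h3]; simp
  · rintro x y z - - - ⟨h, ⟨C, hCU, hC, hs⟩, ht⟩ ⟨h', ⟨C', hCU', hC', hs'⟩, ht'⟩
    refine ⟨h.trans h', ⟨C ∪ C', union_subset hCU hCU', hC.union hC', fun x hx => ?_⟩, ?_⟩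
    · simp only [mem_union, not_or] at hx
      rw [Homeomorph.trans_apply, hs _ hx.1, hs' _ hx.2]
    · have h1 : Tendsto h (𝓝 x) (𝓝 y) := by
        have := h.continuous.tendsto x
        rwa [ht.self_of_nhds, add_sub_cancel] at this
      filter_upwards [ht, h1.eventually ht'] with p hp hp'
      rw [Homeomorph.trans_apply, hp', hp]; abel
  · rintro x y - - ⟨h, ⟨C, hCU, hC, hs⟩, ht⟩
    refine ⟨h.symm, ⟨C, hCU, hC, fun x hx => ?_⟩, ?_⟩
    · rw [Homeomorph.symm_apply_eq, hs _ hx]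
    · have h1 : Tendsto (fun z => z + (x - y)) (𝓝 y) (𝓝 x) := by
        have : Continuous (fun z => z + (x - y)) := by fun_prop
        have := this.tendsto y
        simpa using this
      filter_upwards [h1.eventually ht] with p hp
      rw [Homeomorph.symm_apply_eq, hp]; abel

end Push

theorem plane_rank : 1 < Module.rank ℝ Plane := by
  rw [← Module.finrank_eq_rank, finrank_euclideanSpace]; simp

/-- Finitely many distinct points can be moved to distinct new places, disjoint from the old
ones, by a homeomorphism of the plane that is a translation near each of them. -/
theorem exists_homeomorph_move_of_disjoint {V : Type*} [Finite V] (y z : V → Plane)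
    (hy : Function.Injective y) (hz : Function.Injective z) (hyz : ∀ v w, y v ≠ z w) :
    ∃ K : Plane ≃ₜ Plane, ∀ v, ∀ᶠ p in 𝓝 (y v), K p = p + (z v - y v) := by
  classical
  have := Fintype.ofFinite V
  suffices H : ∀ S : Finset V, ∃ K : Plane ≃ₜ Plane,
      ∀ v, ∀ᶠ p in 𝓝 (y v), K p = p + ((if v ∈ S then z v else y v) - y v) by
    simpa using H Finset.univ
  intro S
  induction S using Finset.induction_on with
  | empty => exact ⟨Homeomorph.refl _, fun v => by simp⟩
  | insert a S ha ih =>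
    obtain ⟨K, hK⟩ := ih
    -- The point `y a` is pushed within the complement of all other old and new places. The support
    -- is compact there, so the push is the identity near every bad point and does not spoil the
    -- translations already obtained.
    set bad : Set Plane := y '' {a}ᶜ ∪ z '' {a}ᶜ with hbad
    have hfin : bad.Finite := (toFinite _).union (toFinite _)
    obtain ⟨h, ⟨C, hC, hCc, hs⟩, ht⟩ := exists_homeomorph_push (U := badᶜ) (a := y a) (b := z a)
      hfin.isClosed.isOpen_compl
      (hfin.countable.isConnected_compl_of_one_lt_rank plane_rank).isPreconnected
      (by
        rintro (⟨v, hv, hv'⟩ | ⟨v, hv, hv'⟩)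
        · exact hv (hy hv')
        · exact hyz _ _ hv'.symm)
      (by
        rintro (⟨v, hv, hv'⟩ | ⟨v, hv, hv'⟩)
        · exact hyz _ _ hv'
        · exact hv (hz hv'))
    have hnear : ∀ p ∈ bad, ∀ᶠ q in 𝓝 p, h q = q := by
      intro p hp
      filter_upwards [hCc.isClosed.isOpen_compl.mem_nhds (fun hpC => hC hpC hp)] with q hq
      exact hs q hq
    refine ⟨K.trans h, fun v => ?_⟩
    have hKt : Tendsto K (𝓝 (y v)) (𝓝 (if v ∈ S then z v else y v)) := by
      have := K.continuous.tendsto (y v)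
      rwa [(hK v).self_of_nhds, add_sub_cancel] at this
    by_cases hva : v = a
    · subst hva
      simp only [ha, if_false, Finset.mem_insert, true_or, if_true] at hKt ⊢
      filter_upwards [hK v, hKt.eventually ht] with p hp hp'
      rw [Homeomorph.trans_apply, hp', hp]; simp [ha]
    · have hb : (if v ∈ S then z v else y v) ∈ bad := by
        split_ifs
        · exact Or.inr ⟨v, hva, rfl⟩
        · exact Or.inl ⟨v, hva, rfl⟩
      filter_upwards [hK v, hKt.eventually (hnear _ hb)] with p hp hp'
      rw [Homeomorph.trans_apply, hp', hp]; simp [Finset.mem_insert, hva]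

/-- Finitely many distinct points can be moved to prescribed distinct places by a homeomorphism of
the plane that is a translation near each of them. -/
theorem exists_homeomorph_move {V : Type*} [Finite V] (y x : V → Plane)
    (hy : Function.Injective y) (hx : Function.Injective x) :
    ∃ K : Plane ≃ₜ Plane, ∀ v, ∀ᶠ p in 𝓝 (y v), K p = p + (x v - y v) := by
  -- Old and new places may overlap, so both families are moved to a third one disjoint from them.
  have hinf : (range y ∪ range x)ᶜ.Infinite :=
    ((finite_range y).union (finite_range x)).infinite_compl
  have := hinf.to_subtype
  obtain ⟨n, ⟨e⟩⟩ := Finite.exists_equiv_fin V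
  let z : V → Plane := fun v => (Infinite.natEmbedding ↥((range y ∪ range x)ᶜ) (e v) : Plane)
  have hz : Function.Injective z := by
    intro v w h
    have h1 := (Infinite.natEmbedding _).injective (Subtype.ext h)
    exact e.injective (Fin.ext h1)
  have hzn : ∀ w, z w ∉ range y ∪ range x := fun w => (Infinite.natEmbedding ↥((range y ∪ range x)ᶜ) (e w)).2
  obtain ⟨K, hK⟩ := exists_homeomorph_move_of_disjoint y z hy hz
    (fun v w h => hzn w (Or.inl ⟨v, h⟩))
  obtain ⟨L, hL⟩ := exists_homeomorph_move_of_disjoint x z hx hz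
    (fun v w h => hzn w (Or.inr ⟨v, h⟩))
  refine ⟨K.trans L.symm, fun v => ?_⟩
  have h1 : Tendsto (fun p => p + (x v - y v)) (𝓝 (y v)) (𝓝 (x v)) := by
    have : Continuous (fun p => p + (x v - y v)) := by fun_prop
    simpa using this.tendsto (y v)
  filter_upwards [hK v, h1.eventually (hL v)] with p hp hp'
  rw [Homeomorph.trans_apply, Homeomorph.symm_apply_eq, hp', hp]; abel

/-! ### Shrinking and turning straight segments -/

theorem image_homeomorph_trans {X : Type*} [TopologicalSpace X] (h h' : X ≃ₜ X) (s : Set X) :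
    h.trans h' '' s = h' '' (h '' s) :=
  image_comp h' h s

theorem segment_add_smul {E : Type*} [AddCommGroup E] [Module ℝ E] (u d : E) {a : ℝ} (ha : 0 < a) :
    segment ℝ u (u + a • d) = (fun s : ℝ => u + s • d) '' Icc 0 a := by
  rw [segment_eq_image']
  ext x
  simp only [mem_image, mem_Icc, add_sub_cancel_left]
  constructor
  · rintro ⟨θ, ⟨h0, h1⟩, rfl⟩
    exact ⟨θ * a, ⟨by positivity, by nlinarith⟩, by rw [smul_smul]⟩
  · rintro ⟨s, ⟨h0, h1⟩, rfl⟩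
    exact ⟨s / a, ⟨by positivity, (div_le_one ha).2 h1⟩,
      by rw [smul_smul, div_mul_cancel₀ _ ha.ne']⟩

section Shrink

variable {E : Type*} [NormedAddCommGroup E] [NormedSpace ℝ E] [CompleteSpace E]

/-- A straight segment can be shrunk towards its first end point along itself. -/
theorem exists_homeomorph_shrink_segment {W : Set E} (hW : IsOpen W) {u v : E}
    (hWs : ∀ t ∈ Ioc (0 : ℝ) 1, u + t • (v - u) ∈ W) (hu : u ∉ W) {t : ℝ} (ht : t ∈ Ioc (0 : ℝ) 1) :
    ∃ h : E ≃ₜ E, (∀ x ∉ W, h x = x) ∧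
      h '' segment ℝ u v = segment ℝ u (u + t • (v - u)) ∧ h v = u + t • (v - u) := by
  -- The statement is made symmetric in two parameters of the half-open interval, so that
  -- connectedness reduces it to nearby parameters.
  have key : ∃ h : E ≃ₜ E, (∀ x ∉ W, h x = x) ∧
      h '' segment ℝ u (u + (1 : ℝ) • (v - u)) = segment ℝ u (u + t • (v - u)) ∧
      h (u + (1 : ℝ) • (v - u)) = u + t • (v - u) := by
    refine (isPreconnected_Ioc (a := (0 : ℝ)) (b := 1)).induction₂
      (fun a b => ∃ h : E ≃ₜ E, (∀ x ∉ W, h x = x) ∧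
      h '' segment ℝ u (u + a • (v - u)) = segment ℝ u (u + b • (v - u)) ∧
      h (u + a • (v - u)) = u + b • (v - u)) ?_ ?_ ?_ (right_mem_Ioc.2 one_pos) ht
    · intro a ha
      obtain ⟨ε, hε, hball⟩ := Metric.isOpen_iff.1 hW _ (hWs a ha)
      have hcont : Tendsto (fun b => 1 * ‖((b - a) / ε) • (v - u)‖) (𝓝[Ioc (0 : ℝ) 1] a) (𝓝 0) := by
        refine tendsto_nhdsWithin_of_tendsto_nhds ?_
        have : Continuous (fun b : ℝ => 1 * ‖((b - a) / ε) • (v - u)‖) := by fun_prop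
        simpa using this.tendsto a
      filter_upwards [hcont.eventually (gt_mem_nhds one_pos), self_mem_nhdsWithin] with b hb hbI
      -- A tent of height `ε` at the moving end point. Displacement by `φ` times `((b - a) / ε) • (v
      -- - u)` takes this point exactly from parameter `a` to parameter `b`.
      set φ : E → ℝ := fun x => max 0 (ε - ‖x - (u + a • (v - u))‖) with hφ
      have hlip : ∀ x y, |φ x - φ y| ≤ 1 * ‖x - y‖ := by
        intro x y
        have h1 := abs_max_sub_max_le_max 0 (ε - ‖x - (u + a • (v - u))‖) 0
          (ε - ‖y - (u + a • (v - u))‖)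
        have h2 := abs_norm_sub_norm_le (y - (u + a • (v - u))) (x - (u + a • (v - u)))
        rw [sub_sub_sub_cancel_right, norm_sub_rev y x] at h2
        rw [sub_sub_sub_cancel_left] at h1
        rw [one_mul]
        refine h1.trans (max_le (by simp) h2)
      obtain ⟨h, hh⟩ := exists_homeomorph_add_smul φ 1 hlip _ hb
      have hout : ∀ x ∉ W, φ x = 0 := by
        intro x hx
        refine max_eq_left ?_
        have : x ∉ ball (u + a • (v - u)) ε := fun hx' => hx (hball hx')
        rw [mem_ball, dist_eq_norm, not_lt] at this
        linarith
      -- The action on the line through `u` and `v`, in the parameter `s`. It is increasing, fixes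
      -- `0` and sends `a` to `b`, so it maps `[0, a]` onto `[0, b]`.
      set g : ℝ → ℝ := fun s => s + φ (u + s • (v - u)) * ((b - a) / ε) with hg
      have hhg : ∀ s, h (u + s • (v - u)) = u + g s • (v - u) := by
        intro s; rw [hh, hg]; simp only [add_smul, smul_smul]; abel
      have hga : g a = b := by
        simp only [hg, hφ, sub_self, norm_zero, sub_zero, max_eq_right hε.le]
        field_simp
        ring
      have hg0 : g 0 = 0 := by simp [hg, hout u hu]
      have hgc : Continuous g := by simp only [hg, hφ]; fun_prop
      have hgm : StrictMono g := by
        intro s s' hss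
        have h1 := hlip (u + s • (v - u)) (u + s' • (v - u))
        have h2 : u + s • (v - u) - (u + s' • (v - u)) = (s - s') • (v - u) := by
          rw [sub_smul]; abel
        rw [h2, norm_smul, one_mul, Real.norm_eq_abs, abs_sub_comm s s',
          abs_of_pos (sub_pos.2 hss)] at h1
        rw [one_mul, norm_smul, Real.norm_eq_abs] at hb
        have h3 : |(φ (u + s • (v - u)) - φ (u + s' • (v - u))) * ((b - a) / ε)| < s' - s := by
          rw [abs_mul]
          calc _ ≤ ((s' - s) * ‖v - u‖) * |(b - a) / ε| := by gcongr
            _ = (s' - s) * (|(b - a) / ε| * ‖v - u‖) := by ring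
            _ < (s' - s) * 1 := by gcongr
            _ = _ := mul_one _
        have h4 := (abs_lt.1 h3).2
        simp only [hg]
        nlinarith
      have himg : g '' Icc 0 a = Icc 0 b := by
        apply Subset.antisymm
        · rintro _ ⟨s, hs, rfl⟩
          exact ⟨hg0 ▸ hgm.monotone hs.1, hga ▸ hgm.monotone hs.2⟩
        · have := intermediate_value_Icc ha.1.le hgc.continuousOn
          rwa [hg0, hga] at this
      refine ⟨h, fun x hx => by rw [hh, hout x hx]; simp, ?_, by rw [hhg, hga]⟩
      rw [segment_add_smul _ _ ha.1, segment_add_smul _ _ hbI.1, image_image, ← himg, image_image]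
      simp only [hhg]
    · rintro a b c - - - ⟨h, h1, h2, h3⟩ ⟨h', h1', h2', h3'⟩
      refine ⟨h.trans h', fun x hx => ?_, ?_, ?_⟩
      · rw [Homeomorph.trans_apply, h1 x hx, h1' x hx]
      · rw [image_homeomorph_trans, h2, h2']
      · rw [Homeomorph.trans_apply, h3, h3']
    · rintro a b - - ⟨h, h1, h2, h3⟩
      refine ⟨h.symm, fun x hx => ?_, ?_, ?_⟩
      · rw [Homeomorph.symm_apply_eq, h1 x hx]
      · rw [← h2, ← image_comp]; simp
      · rw [Homeomorph.symm_apply_eq, h3]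
  simpa using key

end Shrink

/-- Polar coordinates: the set is a continuous image of an interval times the unit circle. -/
theorem isPreconnected_ball_diff_center (u : Plane) (r : ℝ) :
    IsPreconnected (ball u r \ {u}) := by
  have h1 : ball u r \ {u} =
      (fun p : ℝ × Plane => u + p.1 • p.2) '' (Ioo 0 r ×ˢ sphere (0 : Plane) 1) := by
    ext x
    simp only [Set.mem_sdiff, mem_ball, dist_eq_norm, mem_singleton_iff, mem_image, mem_prod, mem_Ioo,
      mem_sphere, sub_zero, Prod.exists]
    constructor
    · rintro ⟨h1, h2⟩
      have h3 : 0 < ‖x - u‖ := norm_pos_iff.2 (sub_ne_zero.2 h2)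
      refine ⟨‖x - u‖, ‖x - u‖⁻¹ • (x - u), ⟨⟨h3, h1⟩, ?_⟩, ?_⟩
      · rw [norm_smul, norm_inv, norm_norm, inv_mul_cancel₀ h3.ne']
      · rw [smul_smul, mul_inv_cancel₀ h3.ne']; simp
    · rintro ⟨t, w, ⟨⟨h0, h1⟩, h2⟩, rfl⟩
      have hw : w ≠ 0 := by rintro rfl; simp at h2
      constructor
      · rw [add_sub_cancel_left, norm_smul, h2, Real.norm_eq_abs, abs_of_pos h0]; simpa
      · simp [h0.ne', hw]
  rw [h1]
  refine (isPreconnected_Ioo.prod (isPreconnected_sphere plane_rank _ _)).image _ ?_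
  fun_prop

/-- Inside a disc, any radius can be turned into any other by a homeomorphism. -/
theorem exists_homeomorph_rotate (u : Plane) (r : ℝ) {q q' : Plane} (hq : q ∈ ball u r \ {u})
    (hq' : q' ∈ ball u r \ {u}) :
    ∃ h : Plane ≃ₜ Plane, (∀ x ∉ ball u r, h x = x) ∧
      h '' segment ℝ u q = segment ℝ u q' ∧ h u = u ∧ h q = q' := by
  refine (isPreconnected_ball_diff_center u r).induction₂
    (fun q q' => ∃ h : Plane ≃ₜ Plane, (∀ x ∉ ball u r, h x = x) ∧
      h '' segment ℝ u q = segment ℝ u q' ∧ h u = u ∧ h q = q') ?_ ?_ ?_ hq hq'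
  · rintro q ⟨hq, hqu⟩
    rw [mem_ball, dist_eq_norm] at hq
    have h0 : 0 < ‖q - u‖ := norm_pos_iff.2 (sub_ne_zero.2 hqu)
    -- The linear part `ℓ` takes the value `t` at `u + t • (q - u)`. The second term of the minimum
    -- vanishes on the boundary circle, and `c` is chosen so that it never cuts off `ℓ` on the
    -- radius to `q`. Adding `φ • (q' - q)` then maps this radius affinely onto the radius to `q'`.
    set ℓ : Plane → ℝ := fun x => (‖q - u‖ ^ 2)⁻¹ * inner ℝ (q - u) (x - u) with hℓ
    set c : ℝ := (r - ‖q - u‖)⁻¹ with hc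
    have hc0 : 0 < c := inv_pos.2 (by linarith)
    set φ : Plane → ℝ := fun x => max 0 (min (ℓ x) (c * (r - ‖x - u‖))) with hφ
    set K := max (‖q - u‖⁻¹) c with hK
    have hlip : ∀ x y, |φ x - φ y| ≤ K * ‖x - y‖ := by
      intro x y
      have h1 := abs_max_sub_max_le_max 0 (min (ℓ x) (c * (r - ‖x - u‖))) 0
        (min (ℓ y) (c * (r - ‖y - u‖)))
      have h2 := abs_min_sub_min_le_max (ℓ x) (c * (r - ‖x - u‖)) (ℓ y) (c * (r - ‖y - u‖))
      refine h1.trans (max_le (by simp; positivity) (h2.trans (max_le ?_ ?_)))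
      · simp only [hℓ]
        rw [← mul_sub, ← inner_sub_right, sub_sub_sub_cancel_right, abs_mul,
          abs_of_pos (by positivity)]
        calc _ ≤ (‖q - u‖ ^ 2)⁻¹ * (‖q - u‖ * ‖x - y‖) := by
              gcongr; exact abs_real_inner_le_norm _ _
          _ = ‖q - u‖⁻¹ * ‖x - y‖ := by field_simp
          _ ≤ _ := by gcongr; exact le_max_left _ _
      · rw [← mul_sub, sub_sub_sub_cancel_left, abs_mul, abs_of_pos hc0]
        have h2 := abs_norm_sub_norm_le (y - u) (x - u)
        rw [sub_sub_sub_cancel_right, norm_sub_rev y x] at h2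
        gcongr
        exact le_max_right _ _
    have hray : ∀ t ∈ Icc (0 : ℝ) 1, φ (u + t • (q - u)) = t := by
      rintro t ⟨ht0, ht1⟩
      have e1 : ℓ (u + t • (q - u)) = t := by
        simp only [hℓ, add_sub_cancel_left, inner_smul_right, real_inner_self_eq_norm_sq]
        field_simp
      have e2 : t ≤ c * (r - ‖u + t • (q - u) - u‖) := by
        rw [add_sub_cancel_left, norm_smul, Real.norm_eq_abs, abs_of_nonneg ht0, hc, inv_mul_eq_div,
          le_div_iff₀ (by linarith)]
        nlinarith
      simp only [hφ]
      rw [e1, min_eq_left e2, max_eq_right ht0]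
    have hcont : Tendsto (fun q' => K * ‖q' - q‖) (𝓝[ball u r \ {u}] q) (𝓝 0) := by
      refine tendsto_nhdsWithin_of_tendsto_nhds ?_
      have : Continuous (fun q' : Plane => K * ‖q' - q‖) := by fun_prop
      simpa using this.tendsto q
    filter_upwards [hcont.eventually (gt_mem_nhds one_pos)] with q' hq'
    obtain ⟨h, hh⟩ := exists_homeomorph_add_smul φ K hlip _ hq'
    have hht : ∀ t ∈ Icc (0 : ℝ) 1, h (u + t • (q - u)) = u + t • (q' - u) := by
      intro t ht
      rw [hh, hray t ht]
      simp only [smul_sub]; abel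
    refine ⟨h, fun x hx => ?_, ?_, ?_, ?_⟩
    · rw [mem_ball, dist_eq_norm, not_lt] at hx
      have : φ x = 0 := by
        refine max_eq_left ((min_le_right _ _).trans ?_)
        exact mul_nonpos_of_nonneg_of_nonpos hc0.le (by linarith)
      rw [hh, this]; simp
    · rw [segment_eq_image', segment_eq_image', image_image]
      exact image_congr hht
    · simpa using hht 0 (by simp)
    · simpa using hht 1 (by simp)
  · rintro a b c - - - ⟨h, h1, h2, h3, h4⟩ ⟨h', h1', h2', h3', h4'⟩
    refine ⟨h.trans h', fun x hx => ?_, ?_, ?_, ?_⟩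
    · rw [Homeomorph.trans_apply, h1 x hx, h1' x hx]
    · rw [image_homeomorph_trans, h2, h2']
    · rw [Homeomorph.trans_apply, h3, h3']
    · rw [Homeomorph.trans_apply, h4, h4']
  · rintro a b - - ⟨h, h1, h2, h3, h4⟩
    refine ⟨h.symm, fun x hx => ?_, ?_, ?_, ?_⟩
    · rw [Homeomorph.symm_apply_eq, h1 x hx]
    · rw [← h2, ← image_comp]; simp
    · rw [Homeomorph.symm_apply_eq, h3]
    · rw [Homeomorph.symm_apply_eq, h4]

/-! ### Contracting simple polygonal lines -/

/-- The polygonal line through `p 0, …, p n`. -/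
def polySet (p : ℕ → Plane) (n : ℕ) : Set Plane :=
  {x | ∃ i < n, x ∈ segment ℝ (p i) (p (i + 1))}

/-- The polygonal line through `p 0, …, p n` is simple. -/
def IsSimplePoly (p : ℕ → Plane) (n : ℕ) : Prop :=
  (∀ i < n, p i ≠ p (i + 1)) ∧ ∀ i j, i < j → j < n → ∀ x ∈ segment ℝ (p i) (p (i + 1)),
    x ∈ segment ℝ (p j) (p (j + 1)) → j = i + 1 ∧ x = p j

theorem polySet_succ_left (p : ℕ → Plane) (n : ℕ) :
    polySet p (n + 1) = segment ℝ (p 0) (p 1) ∪ polySet (fun k => p (k + 1)) n := by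
  ext x
  simp only [polySet, mem_ofPred_eq, mem_union]
  constructor
  · rintro ⟨i, hi, hx⟩
    rcases i with _ | i
    · exact Or.inl hx
    · exact Or.inr ⟨i, by omega, hx⟩
  · rintro (hx | ⟨i, hi, hx⟩)
    · exact ⟨0, by omega, hx⟩
    · exact ⟨i + 1, by omega, hx⟩

theorem polySet_succ_right (p : ℕ → Plane) (n : ℕ) :
    polySet p (n + 1) = polySet p n ∪ segment ℝ (p n) (p (n + 1)) := by
  ext x
  simp only [polySet, mem_ofPred_eq, mem_union]
  constructor
  · rintro ⟨i, hi, hx⟩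
    rcases Nat.lt_succ_iff_lt_or_eq.1 hi with h | rfl
    · exact Or.inl ⟨i, h, hx⟩
    · exact Or.inr hx
  · rintro (⟨i, hi, hx⟩ | hx)
    · exact ⟨i, by omega, hx⟩
    · exact ⟨n, by omega, hx⟩

theorem isCompact_segment (a b : Plane) : IsCompact (segment ℝ a b) := by
  rw [segment_eq_image']
  exact isCompact_Icc.image (by fun_prop)

theorem isCompact_polySet (p : ℕ → Plane) (n : ℕ) : IsCompact (polySet p n) := by
  induction n with
  | zero => simp [polySet]
  | succ n ih => rw [polySet_succ_right]; exact ih.union (isCompact_segment _ _)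

theorem IsSimplePoly.tail {p : ℕ → Plane} {n : ℕ} (h : IsSimplePoly p (n + 1)) :
    IsSimplePoly (fun k => p (k + 1)) n :=
  ⟨fun i hi => h.1 (i + 1) (by omega), fun i j hij hj x hx hx' => by
    obtain ⟨h1, h2⟩ := h.2 (i + 1) (j + 1) (by omega) (by omega) x hx hx'
    exact ⟨by omega, h2⟩⟩

theorem IsSimplePoly.init {p : ℕ → Plane} {n : ℕ} (h : IsSimplePoly p (n + 1)) :
    IsSimplePoly p n :=
  ⟨fun i hi => h.1 i (by omega), fun i j hij hj => h.2 i j hij (by omega)⟩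

/-- Cramer's rule. -/
theorem exists_functional (D₁ D₂ : Plane) (h : D₁ 0 * D₂ 1 - D₁ 1 * D₂ 0 ≠ 0) (a b : ℝ) :
    ∃ ℓ : Plane →L[ℝ] ℝ, ℓ D₁ = a ∧ ℓ D₂ = b := by
  refine ⟨((a * D₂ 1 - b * D₁ 1) / (D₁ 0 * D₂ 1 - D₁ 1 * D₂ 0)) •
      (EuclideanSpace.proj (0 : Fin 2) : Plane →L[ℝ] ℝ) +
    ((b * D₁ 0 - a * D₂ 0) / (D₁ 0 * D₂ 1 - D₁ 1 * D₂ 0)) •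
      (EuclideanSpace.proj (1 : Fin 2) : Plane →L[ℝ] ℝ), ?_, ?_⟩ <;>
  · rw [add_apply, smul_apply, smul_apply]
    simp only [EuclideanSpace.coe_proj, smul_eq_mul]
    rw [div_mul_eq_mul_div, div_mul_eq_mul_div, ← add_div, div_eq_iff h]
    ring

theorem exists_mem_ball_add_smul (u d : Plane) {r : ℝ} (hr : 0 < r) :
    ∃ τ ∈ Ioo (0 : ℝ) 1, u + τ • d ∈ ball u r := by
  have hc : Tendsto (fun τ : ℝ => u + τ • d) (𝓝[>] 0) (𝓝 u) := by
    refine tendsto_nhdsWithin_of_tendsto_nhds ?_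
    have : Continuous (fun τ : ℝ => u + τ • d) := by fun_prop
    simpa using this.tendsto 0
  have h1 : ∀ᶠ τ in 𝓝[>] (0 : ℝ), τ ∈ Ioo (0 : ℝ) 1 := Ioo_mem_nhdsGT one_pos
  exact (h1.and (hc.eventually (ball_mem_nhds u hr))).exists

/-- A simple bend can be straightened by a homeomorphism of the plane that is affine on both of
its sides. -/
theorem exists_homeomorph_straighten {u b q : Plane} (hub : u ≠ b) (hbq : b ≠ q)
    (hint : ∀ x ∈ segment ℝ u b, x ∈ segment ℝ b q → x = b) :
    ∃ ψ : Plane ≃ₜ Plane, (∀ t ∈ Icc (0 : ℝ) 1, ψ (u + t • (b - u)) = ψ u + t • (ψ b - ψ u)) ∧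
      (∀ t ∈ Icc (0 : ℝ) 1, ψ (b + t • (q - b)) = ψ b + t • (ψ q - ψ b)) ∧
      ∃ s ∈ Ioo (0 : ℝ) 1, ψ b = ψ u + s • (ψ q - ψ u) := by
  by_cases hdet : (u - b) 0 * (q - b) 1 - (u - b) 1 * (q - b) 0 = 0
  -- Collinear sides: if `k` were positive, they would overlap beyond `b`. So `b` already lies
  -- strictly between `u` and `q`, and nothing has to be moved.
  · obtain ⟨k, hk⟩ : ∃ k : ℝ, q - b = k • (u - b) := by
      by_cases h0 : (u - b) 0 = 0
      · have h1 : (u - b) 1 ≠ 0 := by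
          intro h1
          exact hub (sub_eq_zero.1 (by ext i; fin_cases i <;> simpa using ‹_›))
        refine ⟨(q - b) 1 / (u - b) 1, ?_⟩
        rw [h0, zero_mul, zero_sub, neg_eq_zero, mul_eq_zero] at hdet
        have h2 := hdet.resolve_left h1
        ext i; fin_cases i
        · simp only [PiLp.smul_apply, smul_eq_mul]
          change (q - b) 0 = (q - b) 1 / (u - b) 1 * (u - b) 0
          rw [h2, h0, mul_zero]
        · simp only [PiLp.smul_apply, smul_eq_mul]
          change (q - b) 1 = (q - b) 1 / (u - b) 1 * (u - b) 1
          field_simp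
      · refine ⟨(q - b) 0 / (u - b) 0, ?_⟩
        ext i; fin_cases i
        · simp only [PiLp.smul_apply, smul_eq_mul]
          change (q - b) 0 = (q - b) 0 / (u - b) 0 * (u - b) 0
          field_simp
        · simp only [PiLp.smul_apply, smul_eq_mul]
          change (q - b) 1 = (q - b) 0 / (u - b) 0 * (u - b) 1
          field_simp
          linarith
    have hk0 : k < 0 := by
      by_contra hk0
      rw [not_lt] at hk0
      have hkp : 0 < k := by
        refine lt_of_le_of_ne hk0 ?_
        rintro rfl
        rw [zero_smul, sub_eq_zero] at hk
        exact hbq hk.symm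
      have hm : 0 < min 1 k := lt_min one_pos hkp
      have h1 := hint (b + min 1 k • (u - b)) (by
        rw [segment_symm, segment_eq_image']
        exact ⟨min 1 k, ⟨hm.le, min_le_left _ _⟩, rfl⟩) (by
        rw [segment_eq_image']
        refine ⟨min 1 k / k, ⟨by positivity, (div_le_one hkp).2 (min_le_right _ _)⟩, ?_⟩
        simp only [hk, smul_smul, div_mul_cancel₀ _ hkp.ne'])
      rw [add_eq_left, smul_eq_zero, sub_eq_zero] at h1
      exact h1.elim hm.ne' hub
    refine ⟨Homeomorph.refl _, fun t _ => rfl, fun t _ => rfl, 1 / (1 - k),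
      ⟨by apply div_pos one_pos; linarith, by rw [div_lt_one] <;> linarith⟩, ?_⟩
    have h1 : q - u = (k - 1) • (u - b) := by
      rw [sub_smul, ← hk, one_smul]; abel
    change b = u + (1 / (1 - k)) • (q - u)
    have h2 : 1 / (1 - k) * (k - 1) = -1 := by
      have : 1 - k ≠ 0 := by linarith
      field_simp; ring
    rw [h1, smul_smul, h2]; simp
  -- A folding shear along `d`, the vector from `b` to the midpoint of `u` and `q`. It moves `u` and
  -- `q` by `-d` and fixes `b`, which thus becomes their midpoint. Since `ℓ d = 0`, the shear with
  -- opposite sign is its inverse.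
  · obtain ⟨ℓ, h1, h2⟩ := exists_functional _ _ hdet (-1) 1
    set d : Plane := (1 / 2 : ℝ) • ((u - b) + (q - b)) with hd
    have hd0 : ℓ d = 0 := by rw [hd, map_smul, map_add, h1, h2]; simp
    let ψ : Plane ≃ₜ Plane :=
      { toFun := fun x => x - |ℓ (x - b)| • d
        invFun := fun x => x + |ℓ (x - b)| • d
        left_inv := fun x => by
          have : ℓ (x - |ℓ (x - b)| • d - b) = ℓ (x - b) := by
            simp only [map_sub, map_smul, hd0, smul_zero, sub_zero]
          simp only [this]; abel
        right_inv := fun x => by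
          have : ℓ (x + |ℓ (x - b)| • d - b) = ℓ (x - b) := by
            simp only [map_sub, map_add, map_smul, hd0, smul_zero, add_zero]
          simp only [this]; abel
        continuous_toFun := by fun_prop
        continuous_invFun := by fun_prop }
    have hψ : ∀ x, ψ x = x - |ℓ (x - b)| • d := fun x => rfl
    have hψb : ψ b = b := by simp [hψ]
    have hψu : ψ u = u - d := by rw [hψ, h1]; simp
    have hψq : ψ q = q - d := by rw [hψ, h2]; simp
    refine ⟨ψ, fun t ht => ?_, fun t ht => ?_, 1 / 2, ⟨by norm_num, by norm_num⟩, ?_⟩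
    · have e : ℓ (u + t • (b - u) - b) = -(1 - t) := by
        have : u + t • (b - u) - b = (1 - t) • (u - b) := by
          simp only [smul_sub, sub_smul, one_smul]; abel
        rw [this, map_smul, h1]; simp
      rw [hψb, hψu, hψ, e, abs_neg, abs_of_nonneg (by linarith [ht.2])]
      simp only [smul_sub, sub_smul, one_smul]; abel
    · have e : ℓ (b + t • (q - b) - b) = t := by
        rw [add_sub_cancel_left, map_smul, h2]; simp
      rw [hψb, hψq, hψ, e, abs_of_nonneg ht.1]
      simp only [smul_sub]; abel
    · rw [hψb, hψu, hψq, hd]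
      module

theorem segment_union_segment_of_eq {u b q : Plane} {s : ℝ} (hs : s ∈ Ioo (0 : ℝ) 1)
    (hb : b = u + s • (q - u)) : segment ℝ u b ∪ segment ℝ b q = segment ℝ u q := by
  have hbm : b ∈ segment ℝ u q := by
    rw [segment_eq_image', hb]; exact ⟨s, Ioo_subset_Icc_self hs, rfl⟩
  apply Subset.antisymm
  · exact union_subset ((convex_segment u q).segment_subset (left_mem_segment ..) hbm)
      ((convex_segment u q).segment_subset hbm (right_mem_segment ..))
  · intro x hx
    rw [segment_eq_image'] at hx
    obtain ⟨t, ht, rfl⟩ := hx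
    rcases le_total t s with h | h
    · left
      rw [segment_eq_image', hb]
      refine ⟨t / s, ⟨div_nonneg ht.1 hs.1.le, (div_le_one hs.1).2 h⟩, ?_⟩
      simp only [add_sub_cancel_left, smul_smul, div_mul_cancel₀ _ hs.1.ne']
    · right
      rw [segment_symm, segment_eq_image', hb]
      have h1 : 0 < 1 - s := by linarith [hs.2]
      refine ⟨(1 - t) / (1 - s), ⟨div_nonneg (by linarith [ht.2]) h1.le,
        (div_le_one h1).2 (by linarith)⟩, ?_⟩
      have e : u + s • (q - u) - q = (1 - s) • (u - q) := by
        simp only [smul_sub, sub_smul, one_smul]; abel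
      simp only [e, smul_smul, div_mul_cancel₀ _ h1.ne']
      simp only [smul_sub, sub_smul, one_smul]; abel

/-- A bend can be shrunk into a short piece of its first side. -/
theorem exists_homeomorph_shrink_bend {u b q : Plane} (hub : u ≠ b) (hbq : b ≠ q)
    (hint : ∀ x ∈ segment ℝ u b, x ∈ segment ℝ b q → x = b) {W : Set Plane} (hW : IsOpen W)
    (hu : u ∉ W) (hsub : ∀ x ∈ segment ℝ u b ∪ segment ℝ b q, x ≠ u → x ∈ W) {r : ℝ} (hr : 0 < r) :
    ∃ h : Plane ≃ₜ Plane, (∀ x ∉ W, h x = x) ∧ ∃ q' ∈ ball u r, q' ≠ u ∧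
      h '' (segment ℝ u b ∪ segment ℝ b q) = segment ℝ u q' ∧ h q = q' := by
  obtain ⟨ψ, h1, h2, s, hs, hb⟩ := exists_homeomorph_straighten hub hbq hint
  have i1 : ψ '' segment ℝ u b = segment ℝ (ψ u) (ψ b) := by
    rw [segment_eq_image', segment_eq_image', image_image]; exact image_congr h1
  have i2 : ψ '' segment ℝ b q = segment ℝ (ψ b) (ψ q) := by
    rw [segment_eq_image', segment_eq_image', image_image]; exact image_congr h2
  have i3 : ψ '' (segment ℝ u b ∪ segment ℝ b q) = segment ℝ (ψ u) (ψ q) := by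
    rw [image_union, i1, i2, segment_union_segment_of_eq hs hb]
  obtain ⟨τ, hτ, hτr⟩ : ∃ τ ∈ Ioo (0 : ℝ) 1, u + τ • (b - u) ∈ ball u r :=
    exists_mem_ball_add_smul _ _ hr
  have hne : b - u ≠ 0 := sub_ne_zero.2 hub.symm
  have hψu : ∀ x, x ∈ ψ.symm ⁻¹' W ↔ ψ.symm x ∈ W := fun x => Iff.rfl
  -- Shrinking takes place in the straightened picture. There `b` has parameter `s`, so `τ * s` is
  -- the parameter of the point at fraction `τ` of the first side.
  obtain ⟨g, g1, g2, g3⟩ := exists_homeomorph_shrink_segment (W := ψ.symm ⁻¹' W) (u := ψ u)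
    (v := ψ q) (hW.preimage ψ.symm.continuous)
    (fun t ht => by
      have h3 : ψ u + t • (ψ q - ψ u) ∈ ψ '' (segment ℝ u b ∪ segment ℝ b q) := by
        rw [i3, segment_eq_image']; exact ⟨t, Ioc_subset_Icc_self ht, rfl⟩
      obtain ⟨x, hx, hxe⟩ := h3
      rw [← hxe, hψu, ψ.symm_apply_apply]
      refine hsub x hx ?_
      rintro rfl
      rw [left_eq_add, smul_eq_zero] at hxe
      rcases hxe with hxe | hxe
      · exact ht.1.ne' hxe
      · rw [hxe, smul_zero, add_zero] at hb
        exact hub (ψ.injective hb).symm)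
    (by rwa [hψu, ψ.symm_apply_apply]) (t := τ * s)
    ⟨mul_pos hτ.1 hs.1, by nlinarith [hτ.1, hτ.2, hs.1, hs.2]⟩
  have e : ψ u + (τ * s) • (ψ q - ψ u) = ψ (u + τ • (b - u)) := by
    rw [h1 τ (Ioo_subset_Icc_self hτ), hb]
    simp only [add_sub_cancel_left, smul_smul]
  have i4 : ψ '' segment ℝ u (u + τ • (b - u)) = segment ℝ (ψ u) (ψ (u + τ • (b - u))) := by
    rw [segment_eq_image', segment_eq_image', image_image]
    refine image_congr fun θ hθ => ?_
    rw [h1 τ (Ioo_subset_Icc_self hτ)]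
    simp only [add_sub_cancel_left, smul_smul]
    exact h1 _ ⟨mul_nonneg hθ.1 hτ.1.le, by nlinarith [hθ.1, hθ.2, hτ.1, hτ.2]⟩
  refine ⟨(ψ.trans g).trans ψ.symm, fun x hx => ?_, u + τ • (b - u), hτr, ?_, ?_, ?_⟩
  · simp only [Homeomorph.trans_apply]
    rw [g1 _ (by rwa [hψu, ψ.symm_apply_apply]), ψ.symm_apply_apply]
  · simp [hτ.1.ne', hne]
  · rw [image_homeomorph_trans, image_homeomorph_trans, i3, g2, e, ← i4, ← image_comp]
    simp
  · simp only [Homeomorph.trans_apply]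
    rw [g3, e, ψ.symm_apply_apply]

/-- A simple polygonal line can be shrunk to a short segment at its first end point. -/
theorem exists_homeomorph_shrink_polySet (n : ℕ) : ∀ (p : ℕ → Plane), IsSimplePoly p (n + 1) →
    ∀ W : Set Plane, IsOpen W → p 0 ∉ W → (∀ x ∈ polySet p (n + 1), x ≠ p 0 → x ∈ W) →
    ∀ r > 0, ∃ h : Plane ≃ₜ Plane, (∀ x ∉ W, h x = x) ∧ ∃ q ∈ ball (p 0) r, q ≠ p 0 ∧
      h '' polySet p (n + 1) = segment ℝ (p 0) q ∧ h (p (n + 1)) = q := by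
  induction n with
  | zero =>
    intro p hp W hW h0 hsub r hr
    have e : polySet p (0 + 1) = segment ℝ (p 0) (p 1) := by
      rw [polySet_succ_left]; simp [polySet]
    have hne : p 0 ≠ p 1 := hp.1 0 (by omega)
    obtain ⟨τ, hτ, hτr⟩ : ∃ τ ∈ Ioo (0 : ℝ) 1, p 0 + τ • (p 1 - p 0) ∈ ball (p 0) r :=
      exists_mem_ball_add_smul _ _ hr
    have hne' : p 1 - p 0 ≠ 0 := sub_ne_zero.2 hne.symm
    obtain ⟨h, h1, h2, h3⟩ := exists_homeomorph_shrink_segment hW (u := p 0) (v := p 1)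
      (fun t ht => hsub _ (by
        rw [e, segment_eq_image']; exact ⟨t, Ioc_subset_Icc_self ht, rfl⟩)
        (by simp [ht.1.ne', hne'])) h0 (Ioo_subset_Ioc_self hτ)
    exact ⟨h, h1, _, hτr, by simp [hτ.1.ne', hne'], by rw [e, h2], h3⟩
  | succ n ih =>
    intro p hp W hW h0 hsub r hr
    have e := polySet_succ_left p (n + 1)
    have hne : p 0 ≠ p 1 := hp.1 0 (by omega)
    have hb : p 1 ∈ W := hsub _ (by rw [e]; exact Or.inl (right_mem_segment ..)) hne.symm
    have hinter : ∀ x ∈ segment ℝ (p 0) (p 1), x ∈ polySet (fun k => p (k + 1)) (n + 1) →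
        x = p 1 := by
      rintro x hx ⟨j, hj, hx'⟩
      obtain ⟨h1, h2⟩ := hp.2 0 (j + 1) (by omega) (by omega) x hx hx'
      rwa [h1] at h2
    -- The tail from `p 1` on is first contracted to a short segment at `p 1`, with support off the
    -- first side, which therefore stays fixed. A bend remains, and it still lies in `W` because the
    -- short segment lies in a ball contained in `W`.
    obtain ⟨r', hr', hball⟩ := Metric.isOpen_iff.1 hW _ hb
    obtain ⟨h, h1, q, hq, hqb, h2, h3⟩ := ih _ hp.tail (W \ segment ℝ (p 0) (p 1))
      (hW.sdiff (isCompact_segment _ _).isClosed)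
      (fun hx => hx.2 (right_mem_segment ..))
      (fun x hx hxb => by
        refine ⟨hsub x (by rw [e]; exact Or.inr hx) ?_, fun hx' => hxb (hinter x hx' hx)⟩
        rintro rfl
        exact hxb (hinter _ (left_mem_segment ..) hx)) r' hr'
    simp only [zero_add] at hq hqb h2
    have hid : ∀ x ∈ segment ℝ (p 0) (p 1), h x = x := fun x hx => h1 x (fun hx' => hx'.2 hx)
    have hid' : h '' segment ℝ (p 0) (p 1) = segment ℝ (p 0) (p 1) := by
      rw [image_congr hid]; simp
    obtain ⟨g, g1, q', hq', hqu, g2, g3⟩ := exists_homeomorph_shrink_bend hne hqb.symm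
      (fun x hx hx' => by
        rw [← h2] at hx'
        obtain ⟨y, hy, rfl⟩ := hx'
        have : y ∈ segment ℝ (p 0) (p 1) := by
          rw [← hid'] at hx
          obtain ⟨z, hz, hz'⟩ := hx
          rwa [← h.injective hz']
        rw [hid y this]
        exact hinter y this hy) hW h0
      (fun x hx hxu => by
        rcases hx with hx | hx
        · exact hsub x (by rw [e]; exact Or.inl hx) hxu
        · exact hball ((convex_ball _ _).segment_subset (mem_ball_self hr') hq hx)) hr
    refine ⟨h.trans g, fun x hx => ?_, q', hq', hqu, ?_, ?_⟩
    · rw [Homeomorph.trans_apply, h1 x (fun h' => hx h'.1), g1 x hx]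
    · rw [image_homeomorph_trans, e, image_union, hid', h2, g2]
    · rw [Homeomorph.trans_apply, h3, g3]

/-! ### Disjoint arcs and matchings -/

theorem eventually_disjoint_thickening {K L : Set Plane} (hK : IsCompact K) (hL : IsCompact L)
    (h : Disjoint K L) : ∀ᶠ ε in 𝓝[>] (0 : ℝ), Disjoint (thickening ε K) (thickening ε L) := by
  obtain ⟨δ, hδ, hd⟩ := h.exists_thickenings hK hL.isClosed
  filter_upwards [Ioo_mem_nhdsGT hδ] with ε hε
  exact hd.mono (thickening_mono hε.2.le _) (thickening_mono hε.2.le _)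

theorem homeomorph_mapsTo_of_support {X : Type*} [TopologicalSpace X] {h : X ≃ₜ X} {W : Set X}
    (hh : ∀ x ∉ W, h x = x) {x : X} (hx : x ∈ W) : h x ∈ W := by
  by_contra hn
  exact hn (by rwa [h.injective (hh _ hn)])

/-- Homeomorphisms with disjoint supports can be combined. -/
theorem exists_homeomorph_combine {X J : Type*} [TopologicalSpace X] [Finite J] (W : J → Set X)
    (hW : ∀ i j, i ≠ j → Disjoint (W i) (W j)) (h : J → X ≃ₜ X) (hh : ∀ j, ∀ x ∉ W j, h j x = x) :
    ∃ g : X ≃ₜ X, (∀ x, (∀ i, x ∉ W i) → g x = x) ∧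
      ∀ j x, (∀ i, i ≠ j → x ∉ W i) → g x = h j x := by
  classical
  have := Fintype.ofFinite J
  suffices H : ∀ S : Finset J, ∃ g : X ≃ₜ X, (∀ x, (∀ i ∈ S, x ∉ W i) → g x = x) ∧
      ∀ j ∈ S, ∀ x ∈ W j, g x = h j x by
    obtain ⟨g, h1, h2⟩ := H Finset.univ
    refine ⟨g, fun x hx => h1 x (fun i _ => hx i), fun j x hx => ?_⟩
    by_cases hj : x ∈ W j
    · exact h2 j (Finset.mem_univ _) x hj
    · rw [hh j x hj]
      refine h1 x fun i _ => ?_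
      by_cases hij : i = j
      · rwa [hij]
      · exact hx i hij
  intro S
  induction S using Finset.induction_on with
  | empty => exact ⟨Homeomorph.refl _, by simp, by simp⟩
  | insert a S ha ih =>
    obtain ⟨g, h1, h2⟩ := ih
    refine ⟨g.trans (h a), fun x hx => ?_, fun j hj x hx => ?_⟩
    · rw [Homeomorph.trans_apply, h1 x (fun i hi => hx i (Finset.mem_insert_of_mem hi)),
        hh a x (hx a (Finset.mem_insert_self _ _))]
    · rw [Homeomorph.trans_apply]
      rcases Finset.mem_insert.1 hj with rfl | hjS
      · rw [h1 x fun i hi hxi => disjoint_left.1 (hW j i (by rintro rfl; exact ha hi)) hx hxi]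
      · have hja : j ≠ a := by rintro rfl; exact ha hjS
        rw [h2 j hjS x hx, hh a _]
        exact disjoint_left.1 (hW j a hja) (homeomorph_mapsTo_of_support (hh j) hx)

/-- A simple polygonal line joins `a` to `b` and covers `S`. -/
def IsPolyArc (a b : Plane) (S : Set Plane) : Prop :=
  ∃ (p : ℕ → Plane) (n : ℕ), 0 < n ∧ IsSimplePoly p n ∧ p 0 = a ∧ p n = b ∧ polySet p n = S

section Matching

variable {V J : Type*} [Finite V] [Finite J]

/-- Disjoint polygonal arcs can be shrunk simultaneously to short segments. -/
theorem exists_homeomorph_shrink_family (x : V → Plane) (s t : J → V)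
    (hst : ∀ i j, s i ≠ t j) (α : J → Set Plane)
    (hα : ∀ j, IsPolyArc (x (s j)) (x (t j)) (α j))
    (hd : ∀ i j, i ≠ j → Disjoint (α i) (α j)) (hv : ∀ j w, x w ∈ α j → w = s j ∨ w = t j)
    {r : ℝ} (hr : 0 < r) :
    ∃ (g : Plane ≃ₜ Plane) (q : J → Plane), (∀ j, q j ∈ ball (x (s j)) r \ {x (s j)}) ∧
      (∀ j, g '' α j = segment ℝ (x (s j)) (q j)) ∧ (∀ j, g (x (t j)) = q j) ∧
      ∀ v, (∀ j, v ≠ t j) → g (x v) = x v := by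
  have hcomp : ∀ j, IsCompact (α j) := fun j => by
    obtain ⟨p, n, -, -, -, -, h⟩ := hα j
    rw [← h]; exact isCompact_polySet _ _
  obtain ⟨ε, hε, hεpos⟩ : ∃ ε : ℝ, (∀ i j, i ≠ j → Disjoint (thickening ε (α i)) (thickening ε (α j)))
      ∧ 0 < ε := by
    refine ((eventually_all.2 fun i => eventually_all.2 fun j => ?_).and
      (self_mem_nhdsWithin : ∀ᶠ ε in 𝓝[>] (0 : ℝ), ε ∈ Ioi (0 : ℝ))).exists
    by_cases hij : i = j
    · simp [hij]
    · filter_upwards [eventually_disjoint_thickening (hcomp i) (hcomp j) (hd i j hij)] with ε h _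
      exact h
  -- Removing all vertices except the moving end `t j` keeps them fixed. It also puts the end `s j`,
  -- towards which the arc contracts, outside the support.
  set W : J → Set Plane := fun j => thickening ε (α j) \ (x '' {w | w ≠ t j}) with hW
  have hWo : ∀ j, IsOpen (W j) := fun j => isOpen_thickening.sdiff (toFinite _).isClosed
  have hWd : ∀ i j, i ≠ j → Disjoint (W i) (W j) := fun i j hij =>
    (hε i j hij).mono sdiff_subset sdiff_subset
  have hshrink : ∀ j, ∃ h : Plane ≃ₜ Plane, (∀ z ∉ W j, h z = z) ∧
      ∃ q ∈ ball (x (s j)) r, q ≠ x (s j) ∧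
      h '' α j = segment ℝ (x (s j)) q ∧ h (x (t j)) = q := by
    intro j
    obtain ⟨p, n, hn, hp, h0, h1, h2⟩ := hα j
    obtain ⟨m, rfl⟩ := Nat.exists_eq_succ_of_ne_zero hn.ne'
    rw [← h0, ← h1, ← h2]
    refine exists_homeomorph_shrink_polySet m p hp (W j) (hWo j) ?_ ?_ r hr
    · rw [h0]
      exact fun h => h.2 ⟨s j, hst j j, rfl⟩
    · intro z hz hz0
      rw [h2] at hz
      refine ⟨self_subset_thickening hεpos _ hz, ?_⟩
      rintro ⟨w, hw, rfl⟩
      rcases hv j w hz with rfl | rfl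
      · exact hz0 h0.symm
      · exact hw rfl
  choose h hh q hq hqn himg hend using hshrink
  obtain ⟨g, hg1, hg2⟩ := exists_homeomorph_combine W hWd h hh
  have hgα : ∀ j, ∀ z ∈ α j, g z = h j z := fun j z hz =>
    hg2 j z fun i hij hzi => disjoint_left.1 (hε i j hij) hzi.1 (self_subset_thickening hεpos _ hz)
  refine ⟨g, q, fun j => ⟨hq j, hqn j⟩, fun j => ?_, fun j => ?_, fun v hvt => ?_⟩
  · rw [← himg j]; exact image_congr (hgα j)
  · rw [← hend j]
    obtain ⟨p, n, hn, hp, h0, h1, h2⟩ := hα j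
    obtain ⟨m, rfl⟩ := Nat.exists_eq_succ_of_ne_zero hn.ne'
    refine hgα j _ ?_
    rw [← h1, ← h2]
    exact ⟨m, by omega, right_mem_segment ..⟩
  · exact hg1 _ fun i hi => hi.2 ⟨v, hvt i, rfl⟩

/-- Two systems of disjoint polygonal arcs that realize the same matching, together with further
isolated vertices, are equivalent under a homeomorphism of the plane. -/
theorem exists_homeomorph_matching (x y : V → Plane) (hx : Function.Injective x)
    (hy : Function.Injective y) (s t : J → V) (hst : ∀ i j, s i ≠ t j)
    (hs : Function.Injective s) (α β : J → Set Plane)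
    (hα : ∀ j, IsPolyArc (x (s j)) (x (t j)) (α j))
    (hβ : ∀ j, IsPolyArc (y (s j)) (y (t j)) (β j))
    (hαd : ∀ i j, i ≠ j → Disjoint (α i) (α j)) (hβd : ∀ i j, i ≠ j → Disjoint (β i) (β j))
    (hαv : ∀ j w, x w ∈ α j → w = s j ∨ w = t j) (hβv : ∀ j w, y w ∈ β j → w = s j ∨ w = t j) :
    ∃ F : Plane ≃ₜ Plane, (∀ v, F (y v) = x v) ∧ ∀ j, F '' β j = α j := by
  obtain ⟨K, hK⟩ := exists_homeomorph_move y x hy hx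
  obtain ⟨r, hr0, hrd, hrK⟩ : ∃ r : ℝ, 0 < r ∧
      (∀ v w, v ≠ w → Disjoint (ball (x v) r) (ball (x w) r)) ∧
      ∀ v, ∀ p ∈ ball (y v) r, K p = p + (x v - y v) := by
    have h1 : ∀ᶠ r in 𝓝[>] (0 : ℝ), ∀ v w, v ≠ w → Disjoint (ball (x v) r) (ball (x w) r) := by
      refine eventually_all.2 fun v => eventually_all.2 fun w => ?_
      by_cases hvw : v = w
      · simp [hvw]
      · have := eventually_disjoint_thickening (isCompact_singleton (x := x v))
          (isCompact_singleton (x := x w)) (by simpa using fun h => hvw (hx h))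
        filter_upwards [this] with r hr _
        simpa using hr
    have h2 : ∀ᶠ r in 𝓝[>] (0 : ℝ), ∀ v, ∀ p ∈ ball (y v) r, K p = p + (x v - y v) := by
      refine eventually_all.2 fun v => ?_
      obtain ⟨δ, hδ, hball⟩ := Metric.eventually_nhds_iff_ball.1 (hK v)
      filter_upwards [Ioo_mem_nhdsGT hδ] with r hr p hp
      exact hball p (ball_subset_ball hr.2.le hp)
    obtain ⟨r, hr⟩ := (h1.and (h2.and
      (self_mem_nhdsWithin : ∀ᶠ ε in 𝓝[>] (0 : ℝ), ε ∈ Ioi (0 : ℝ)))).exists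
    exact ⟨r, hr.2.2, hr.1, hr.2.1⟩
  -- Both systems contract to radii of the small discs, one around the points `x`, the other around
  -- the points `y`. There `K` is a translation, so it carries radii to radii; it remains to turn
  -- radii within disjoint discs and to undo the contraction of `α`.
  obtain ⟨g, q, hq, hg1, hg2, hg3⟩ := exists_homeomorph_shrink_family x s t hst α hα hαd hαv hr0
  obtain ⟨k, q', hq', hk1, hk2, hk3⟩ :=
    exists_homeomorph_shrink_family y s t hst β hβ hβd hβv hr0
  have hKy : ∀ v, K (y v) = x v := fun v => by
    rw [hrK v _ (mem_ball_self hr0)]; abel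
  have hrot : ∀ j, ∃ h : Plane ≃ₜ Plane, (∀ z ∉ ball (x (s j)) r, h z = z) ∧
      h '' segment ℝ (x (s j)) (q' j + (x (s j) - y (s j))) = segment ℝ (x (s j)) (q j) ∧
      h (x (s j)) = x (s j) ∧ h (q' j + (x (s j) - y (s j))) = q j := by
    intro j
    refine exists_homeomorph_rotate _ r ⟨?_, ?_⟩ (hq j)
    · have := (hq' j).1
      rw [mem_ball, dist_eq_norm] at this ⊢
      rwa [show q' j + (x (s j) - y (s j)) - x (s j) = q' j - y (s j) by abel]
    · intro h
      refine (hq' j).2 ?_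
      rw [mem_singleton_iff] at h ⊢
      have : q' j = q' j + (x (s j) - y (s j)) - x (s j) + y (s j) := by abel
      rw [this, h]; abel
  choose h hh1 hh2 hh3 hh4 using hrot
  obtain ⟨L, hL1, hL2⟩ := exists_homeomorph_combine (fun j => ball (x (s j)) r)
    (fun i j hij => hrd _ _ (fun e => hij (hs e))) h hh1
  have hLs : ∀ j, ∀ z ∈ ball (x (s j)) r, L z = h j z := fun j z hz =>
    hL2 j z fun i hij hzi => disjoint_left.1 (hrd _ _ (fun e => hij (hs e))) hzi hz
  have hq'' : ∀ j, q' j + (x (s j) - y (s j)) ∈ ball (x (s j)) r := fun j => by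
    have := (hq' j).1
    rw [mem_ball, dist_eq_norm] at this ⊢
    rwa [show q' j + (x (s j) - y (s j)) - x (s j) = q' j - y (s j) by abel]
  refine ⟨((k.trans K).trans L).trans g.symm, fun v => ?_, fun j => ?_⟩
  · simp only [Homeomorph.trans_apply]
    rw [Homeomorph.symm_apply_eq]
    by_cases hvt : ∃ j, v = t j
    · obtain ⟨j, rfl⟩ := hvt
      rw [hk2, hrK _ _ (hq' j).1, hLs j _ (hq'' j), hh4, hg2]
    · push Not at hvt
      rw [hk3 v hvt, hKy, hg3 v hvt]
      by_cases hvs : ∃ j, v = s j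
      · obtain ⟨j, rfl⟩ := hvs
        rw [hLs j _ (mem_ball_self hr0), hh3]
      · push Not at hvs
        exact hL1 _ fun i hi => disjoint_left.1 (hrd v (s i) (hvs i)) (mem_ball_self hr0) hi
  · rw [image_homeomorph_trans, image_homeomorph_trans, image_homeomorph_trans, hk1]
    have e1 : K '' segment ℝ (y (s j)) (q' j)
        = segment ℝ (x (s j)) (q' j + (x (s j) - y (s j))) := by
      rw [segment_eq_image', segment_eq_image', image_image]
      refine image_congr fun θ hθ => ?_
      rw [hrK (s j) _]
      · module
      · refine (convex_ball _ _).segment_subset (mem_ball_self hr0) (hq' j).1 ?_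
        rw [segment_eq_image']
        exact ⟨θ, hθ, rfl⟩
    have e2 : L '' segment ℝ (x (s j)) (q' j + (x (s j) - y (s j)))
        = segment ℝ (x (s j)) (q j) := by
      rw [← hh2 j]
      refine image_congr fun z hz => hLs j z ?_
      exact (convex_ball _ _).segment_subset (mem_ball_self hr0) (hq'' j) hz
    rw [e1, e2, ← hg1 j, ← image_comp]
    simp

end Matching

/-! ### Points in general position -/

/-- Twice the signed area of a triangle; it vanishes if and only if the points are collinear. -/
def area (a b c : Plane) : ℝ := (b 0 - a 0) * (c 1 - a 1) - (b 1 - a 1) * (c 0 - a 0)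

theorem area_rotate (a b c : Plane) : area a b c = area b c a := by unfold area; ring

theorem area_add_smul (a b c : Plane) (t : ℝ) : area a b (a + t • (c - a)) = t * area a b c := by
  simp only [area, PiLp.add_apply, PiLp.smul_apply, PiLp.sub_apply, smul_eq_mul]; ring

theorem area_self_right (a b : Plane) : area a b b = 0 := by unfold area; ring

theorem area_eq_zero_of_mem_segment {a b x : Plane} (h : x ∈ segment ℝ a b) : area a b x = 0 := by
  rw [segment_eq_image'] at h
  obtain ⟨t, -, rfl⟩ := h
  simp only [area_add_smul, area_self_right, mul_zero]

theorem continuous_area (a b : Plane) : Continuous (area a b) := by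
  unfold area; fun_prop

theorem plane_ext_iff {a b : Plane} : a = b ↔ a 0 = b 0 ∧ a 1 = b 1 :=
  ⟨fun h => h ▸ ⟨rfl, rfl⟩, fun h => by ext i; fin_cases i; exacts [h.1, h.2]⟩

theorem dense_area_ne_zero {a b : Plane} (hab : a ≠ b) : Dense {x | area a b x ≠ 0} := by
  have hpos : (b 0 - a 0) ^ 2 + (b 1 - a 1) ^ 2 ≠ 0 := by
    intro h
    refine hab (plane_ext_iff.2 ⟨?_, ?_⟩) <;> nlinarith [sq_nonneg (b 0 - a 0), sq_nonneg (b 1 - a 1)]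
  intro x
  by_cases hx : area a b x = 0
  -- A normal vector of the line: moving along it changes the area at the rate of the squared length
  -- of `b - a`.
  · let n : Plane := !₂[-(b 1 - a 1), b 0 - a 0]
    have hc : Tendsto (fun t : ℝ => x + t • n) (𝓝[≠] 0) (𝓝 x) := by
      refine tendsto_nhdsWithin_of_tendsto_nhds ?_
      have : Continuous (fun t : ℝ => x + t • n) := by fun_prop
      simpa using this.tendsto 0
    refine mem_closure_of_tendsto hc ?_
    filter_upwards [self_mem_nhdsWithin] with t ht
    have : area a b (x + t • n) = area a b x + t * ((b 0 - a 0) ^ 2 + (b 1 - a 1) ^ 2) := by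
      simp only [area, n, PiLp.add_apply, PiLp.smul_apply, smul_eq_mul,
        Matrix.cons_val_zero, Matrix.cons_val_one]
      ring
    change area a b (x + t • n) ≠ 0
    rw [this, hx, zero_add]
    exact mul_ne_zero ht hpos
  · exact subset_closure hx

theorem exists_generic_point (S : Finset Plane) {B : Set Plane} (hB : IsOpen B) (hBn : B.Nonempty) :
    ∃ d ∈ B, d ∉ S ∧ ∀ a ∈ S, ∀ b ∈ S, a ≠ b → area a b d ≠ 0 := by
  have h1 : Dense (⋂ q ∈ {q : Plane × Plane | q.1 ∈ S ∧ q.2 ∈ S ∧ q.1 ≠ q.2},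
      {x | area q.1 q.2 x ≠ 0}) := by
    refine dense_biInter_of_isOpen (fun q _ => ?_) ?_ (fun q hq => dense_area_ne_zero hq.2.2)
    · exact isOpen_ne_fun (continuous_area _ _) continuous_const
    · refine ((S.finite_toSet.prod S.finite_toSet).subset ?_).countable
      rintro ⟨a, b⟩ ⟨ha, hb, -⟩
      exact ⟨ha, hb⟩
  have h2 : IsOpen (B \ S) := hB.sdiff S.finite_toSet.isClosed
  have h3 : (B \ S).Nonempty := by
    have : (B \ (S : Set Plane)).Infinite := by
      refine Set.Infinite.sdiff ?_ S.finite_toSet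
      obtain ⟨x, hx⟩ := hBn
      exact infinite_of_mem_nhds x (hB.mem_nhds hx)
    exact this.nonempty
  obtain ⟨d, hd, hd'⟩ := h1.inter_open_nonempty _ h2 h3
  refine ⟨d, hd.1, hd.2, fun a ha b hb hab => ?_⟩
  simp only [mem_iInter] at hd'
  exact hd' (a, b) ⟨ha, hb, hab⟩

/-- The points of `D` are in general position with respect to each other and to `A`. -/
def InGeneralPosition (A D : Set Plane) : Prop :=
  Disjoint A D ∧ ∀ a ∈ A ∪ D, ∀ b ∈ A ∪ D, ∀ c ∈ D, a ≠ b → b ≠ c → a ≠ c → area a b c ≠ 0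

theorem exists_dense_inGeneralPosition {A : Set Plane} (hA : A.Finite) :
    ∃ D : Set Plane, Dense D ∧ InGeneralPosition A D := by
  classical
  obtain ⟨b, hbc, hbn, hb⟩ := TopologicalSpace.exists_countable_basis Plane
  have hne : b.Nonempty := by
    by_contra hne
    rw [not_nonempty_iff_eq_empty] at hne
    have := hb.exists_subset_of_mem_open (mem_univ (0 : Plane)) isOpen_univ
    simp [hne] at this
  obtain ⟨B, rfl⟩ := hbc.exists_eq_range hne
  choose f hfB hfS hfa using fun (S : Finset Plane) (n : ℕ) =>
    exists_generic_point S (hb.isOpen (mem_range_self n)) (nonempty_iff_ne_empty.2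
      (fun h => hbn (h ▸ mem_range_self n)))
  -- Greedy choice: starting from `A`, one point is added in each basic open set, off all lines
  -- through two points present so far.
  let S : ℕ → Finset Plane := fun n => Nat.rec hA.toFinset (fun n S => insert (f S n) S) n
  have hS0 : S 0 = hA.toFinset := rfl
  have hS1 : ∀ n, S (n + 1) = insert (f (S n) n) (S n) := fun n => rfl
  have hmono : Monotone S := monotone_nat_of_le_succ fun n => by
    rw [hS1]; exact Finset.subset_insert _ _
  have hAS : ∀ n, ∀ a ∈ A, a ∈ S n := fun n a ha =>
    hmono (Nat.zero_le n) (by simpa [hS0] using ha)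
  -- Of three points, the one chosen last avoids the line through the other two; cyclic symmetry of
  -- the area brings it to the third place.
  have key : ∀ n, ∀ a ∈ S n, ∀ b ∈ S n, ∀ c ∈ S n, c ∉ A → a ≠ b → b ≠ c → a ≠ c →
      area a b c ≠ 0 := by
    intro n
    induction n with
    | zero => intro a _ b _ c hc hcA; exact absurd (by simpa [hS0] using hc) hcA
    | succ n ih =>
      intro a ha b hb c hc hcA hab hbc hac
      rw [hS1, Finset.mem_insert] at ha hb hc
      rcases hc with rfl | hc
      · exact hfa _ _ a (ha.resolve_left hac) b (hb.resolve_left hbc) hab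
      · rcases ha with rfl | ha
        · rw [area_rotate]
          exact hfa _ _ b (hb.resolve_left hab.symm) c hc hbc
        · rcases hb with rfl | hb
          · rw [area_rotate, area_rotate]
            exact hfa _ _ c hc a ha hac.symm
          · exact ih a ha b hb c hc hcA hab hbc hac
  refine ⟨{x | ∃ n, x ∈ S n} \ A, ?_, disjoint_sdiff_right, ?_⟩
  · rw [hb.dense_iff]
    rintro _ ⟨n, rfl⟩ -
    refine ⟨f (S n) n, hfB _ _, ⟨n + 1, ?_⟩, fun h => hfS (S n) n (hAS n _ h)⟩
    rw [hS1]; exact Finset.mem_insert_self _ _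
  · have hmem : ∀ a ∈ A ∪ ({x | ∃ n, x ∈ S n} \ A), ∃ n, a ∈ S n := by
      rintro a (ha | ha)
      · exact ⟨0, hAS 0 a ha⟩
      · exact ha.1
    intro a ha b hb c hc hab hbc hac
    obtain ⟨k, hk⟩ := hmem a ha
    obtain ⟨l, hl⟩ := hmem b hb
    obtain ⟨m, hm⟩ := hmem c (Or.inr hc)
    exact key (max k (max l m)) a (hmono (by omega) hk) b (hmono (by omega) hl) c
      (hmono (by omega) hm) hc.2 hab hbc hac

/-! ### Polygonal routes in open sets -/

/-- Near `c`, the set `U` is a union of radii. -/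
def RadialAt (U : Set Plane) (c : Plane) : Prop :=
  ∃ ρ > 0, ∀ x ∈ U ∩ ball c ρ, ∀ t ∈ Ioc (0 : ℝ) 1, c + t • (x - c) ∈ U

theorem openSegment_eq_image_Ioo (c x : Plane) :
    openSegment ℝ c x = (fun t : ℝ => c + t • (x - c)) '' Ioo 0 1 :=
  openSegment_eq_image' ℝ c x

theorem RadialAt.of_mem {U : Set Plane} (hU : IsOpen U) {c : Plane} (hc : c ∈ U) : RadialAt U c := by
  obtain ⟨ρ, hρ, hb⟩ := Metric.isOpen_iff.1 hU c hc
  refine ⟨ρ, hρ, fun x hx t ht => hb ?_⟩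
  have : c + t • (x - c) ∈ segment ℝ c x := by
    rw [segment_eq_image']; exact ⟨t, Ioc_subset_Icc_self ht, rfl⟩
  exact (convex_ball _ _).segment_subset (mem_ball_self hρ) hx.2 this

/-- The part of the segment away from `c` is compact in `U`, hence stable under perturbation. The
part near `c` follows from a single point of it in `U`, by radiality; `c` itself need not lie in
`U`. -/
theorem RadialAt.eventually_openSegment_subset {U : Set Plane} (hU : IsOpen U) {c x : Plane}
    (hc : RadialAt U c) (hx : x ∈ U) (hs : openSegment ℝ c x ⊆ U) :
    ∀ᶠ x' in 𝓝 x, openSegment ℝ c x' ⊆ U := by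
  obtain ⟨ρ, hρ, hrad⟩ := hc
  obtain ⟨t₀, ht₀, ht₀b⟩ := exists_mem_ball_add_smul c (x - c) hρ
  have hy : c + t₀ • (x - c) ∈ U := hs (by rw [openSegment_eq_image_Ioo]; exact ⟨t₀, ht₀, rfl⟩)
  have hK : IsCompact ((fun t : ℝ => c + t • (x - c)) '' Icc t₀ 1) :=
    isCompact_Icc.image (by fun_prop)
  have hKU : (fun t : ℝ => c + t • (x - c)) '' Icc t₀ 1 ⊆ U := by
    rintro _ ⟨t, ht, rfl⟩
    rcases ht.2.lt_or_eq with h | rfl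
    · exact hs (by rw [openSegment_eq_image_Ioo]; exact ⟨t, ⟨ht₀.1.trans_le ht.1, h⟩, rfl⟩)
    · simpa using hx
  obtain ⟨ε, hε, hth⟩ := hK.exists_thickening_subset_open hU hKU
  have hcont : Continuous (fun x' : Plane => c + t₀ • (x' - c)) := by fun_prop
  filter_upwards [ball_mem_nhds x hε, hcont.continuousAt.eventually_mem (hU.mem_nhds hy),
    hcont.continuousAt.eventually_mem (isOpen_ball.mem_nhds ht₀b)] with x' h1 h2 h3
  rw [openSegment_eq_image_Ioo]
  rintro _ ⟨t, ht, rfl⟩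
  rcases le_or_gt t t₀ with h | h
  · have := hrad _ ⟨h2, h3⟩ (t / t₀) ⟨div_pos ht.1 ht₀.1, (div_le_one ht₀.1).2 h⟩
    rwa [add_sub_cancel_left, smul_smul, div_mul_cancel₀ _ ht₀.1.ne'] at this
  · refine hth (mem_thickening_iff.2 ⟨c + t • (x - c), ⟨t, ⟨h.le, ht.2.le⟩, rfl⟩, ?_⟩)
    rw [dist_add_left, dist_eq_norm, ← smul_sub, sub_sub_sub_cancel_right, norm_smul,
      Real.norm_eq_abs, abs_of_pos ht.1]
    rw [mem_ball, dist_eq_norm] at h1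
    calc t * ‖x' - x‖ ≤ 1 * ‖x' - x‖ := by gcongr; exact ht.2.le
      _ < ε := by rwa [one_mul]

theorem RadialAt.exists_openSegment_subset {U : Set Plane} {c : Plane}
    (hc : RadialAt U c) (hcl : c ∈ closure U) :
    ∃ y ∈ U, openSegment ℝ c y ⊆ U := by
  obtain ⟨ρ, hρ, hrad⟩ := hc
  obtain ⟨y, hy, hyd⟩ := Metric.mem_closure_iff.1 hcl ρ hρ
  refine ⟨y, hy, ?_⟩
  rw [openSegment_eq_image_Ioo]
  rintro _ ⟨t, ht, rfl⟩
  exact hrad y ⟨hy, by rwa [mem_ball, dist_comm]⟩ t (Ioo_subset_Ioc_self ht)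

/-- A polygonal line from `u` whose further nodes lie in `D ∩ U` and whose sides lie in `U`. -/
def IsRoute (U D : Set Plane) (p : ℕ → Plane) (n : ℕ) : Prop :=
  (∀ i, 0 < i → i < n → p i ∈ D ∩ U) ∧ ∀ i < n, openSegment ℝ (p i) (p (i + 1)) ⊆ U

theorem IsRoute.extend {U D : Set Plane} {p : ℕ → Plane} {n : ℕ} (hp : IsRoute U D p n)
    (hn : 0 < n) (hpn : p n ∈ D ∩ U) {y : Plane} (hy : openSegment ℝ (p n) y ⊆ U) :
    IsRoute U D (fun k => if k ≤ n then p k else y) (n + 1) := by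
  refine ⟨fun i h0 hi => ?_, fun i hi => ?_⟩ <;> beta_reduce
  · rw [if_pos (by omega)]
    rcases (Nat.lt_succ_iff.1 hi).lt_or_eq with h | rfl
    · exact hp.1 i h0 h
    · exact hpn
  · rcases (Nat.lt_succ_iff.1 hi).lt_or_eq with h | rfl
    · rw [if_pos h.le, if_pos (by omega)]; exact hp.2 i h
    · rw [if_pos le_rfl, if_neg (by omega)]; exact hy

/-- The usual argument that connected open sets are polygonally connected, with nodes restricted to
`D` and with ends that may lie on the boundary of `U`, where radiality gives access. -/
theorem exists_isRoute {U D : Set Plane} (hU : IsOpen U) (hUc : IsPreconnected U) (hD : Dense D)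
    {u v : Plane} (hu : RadialAt U u) (hv : RadialAt U v) (hu' : u ∈ closure U)
    (hv' : v ∈ closure U) :
    ∃ p n, 2 ≤ n ∧ p 0 = u ∧ p n = v ∧ IsRoute U D p n := by
  let Q : Plane → Prop := fun x => x ∈ D ∩ U ∧
    ∃ p n, 0 < n ∧ p 0 = u ∧ p n = x ∧ IsRoute U D p n
  have hext : ∀ x y, Q x → openSegment ℝ x y ⊆ U →
      ∃ p n, 2 ≤ n ∧ p 0 = u ∧ p n = y ∧ IsRoute U D p n := by
    rintro x y ⟨hxU, p, n, hn, h0, rfl, hp⟩ hy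
    exact ⟨_, n + 1, by omega, by simp [h0], by simp, hp.extend hn hxU hy⟩
  -- Reachability makes sense only for points of `D`; in the form "all points of `D` near `y` are
  -- reachable" it extends to all of `U`. There it is locally constant, because any two points of a
  -- ball in `U` are joined inside it.
  let P : Plane → Prop := fun y => ∀ᶠ d in 𝓝 y, d ∈ D → Q d
  have hdense : ∀ z (C : Plane → Prop), (∀ᶠ d in 𝓝 z, C d) → ∃ d ∈ D, C d := by
    intro z C hC
    obtain ⟨d, hd, hd'⟩ := hD.inter_nhds_nonempty hC
    exact ⟨d, hd, hd'⟩
  have hball : ∀ x ε, ball x ε ⊆ U → ∀ w ∈ ball x ε, ∀ d ∈ ball x ε, Q d → P w := by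
    intro x ε hb w hw d hd hQ
    filter_upwards [isOpen_ball.mem_nhds hw] with d' hd' hd'D
    obtain ⟨p, n, hn, h⟩ := hext d d' hQ
      (((openSegment_subset_segment _ _ _).trans ((convex_ball _ _).segment_subset hd hd')).trans hb)
    exact ⟨⟨hd'D, hb hd'⟩, p, n, by omega, h⟩
  have hloc : ∀ x ε, ball x ε ⊆ U → ∀ z ∈ ball x ε, ∀ w ∈ ball x ε, P z → P w := by
    intro x ε hb z hz w hw hz'
    obtain ⟨d, hd, hQ, hdb⟩ := hdense z _ (hz'.and (isOpen_ball.mem_nhds hz))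
    exact hball x ε hb w hw d hdb (hQ hd)
  have hall : ∀ z ∈ U, ∀ w ∈ U, P z → P w := by
    intro z hz w hw
    refine hUc.induction₂' (fun z w => P z → P w) (fun x hx => ?_)
      (fun x y z _ _ _ h1 h2 h => h2 (h1 h)) hz hw
    obtain ⟨ε, hε, hb⟩ := Metric.isOpen_iff.1 hU x hx
    filter_upwards [nhdsWithin_le_nhds (ball_mem_nhds x hε)] with y hy
    exact ⟨hloc x ε hb x (mem_ball_self hε) y hy, hloc x ε hb y hy x (mem_ball_self hε)⟩
  obtain ⟨a, haU, ha⟩ := hu.exists_openSegment_subset hu'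
  obtain ⟨b, hbU, hb⟩ := hv.exists_openSegment_subset hv'
  have hPa : P a := by
    filter_upwards [hu.eventually_openSegment_subset hU haU ha, hU.mem_nhds haU] with d hd hdU hdD
    refine ⟨⟨hdD, hdU⟩, fun k => if k = 0 then u else d, 1, one_pos, by simp, by simp, ?_, ?_⟩
    · intro i h0 h1; omega
    · intro i hi
      obtain rfl : i = 0 := by omega
      simpa using hd
  obtain ⟨d, hdD, hQ, hd⟩ := hdense b _ ((hall a haU b hbU hPa).and
    (hv.eventually_openSegment_subset hU hbU hb))
  exact hext d v (hQ hdD) (by rw [openSegment_symm]; exact hd)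

theorem eq_of_mem_segment_of_area_ne_zero {a b c x : Plane} (h : area a b c ≠ 0)
    (h1 : x ∈ segment ℝ a b) (h2 : x ∈ segment ℝ b c) : x = b := by
  rw [segment_symm, segment_eq_image'] at h1
  rw [segment_eq_image'] at h2
  obtain ⟨s, -, rfl⟩ := h1
  obtain ⟨t, -, ht⟩ := h2
  have e0 : b 0 + t * (c 0 - b 0) = b 0 + s * (a 0 - b 0) := by
    have := congrArg (fun z : Plane => z 0) ht
    simpa using this
  have e1 : b 1 + t * (c 1 - b 1) = b 1 + s * (a 1 - b 1) := by
    have := congrArg (fun z : Plane => z 1) ht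
    simpa using this
  have hs : s * area a b c = 0 := by
    unfold area
    linear_combination (c 1 - b 1) * e0 - (c 0 - b 0) * e1
  rcases mul_eq_zero.1 hs with rfl | h'
  · simp
  · exact absurd h' h

theorem openSegment_subset_of_mem {U : Set Plane} {a b x : Plane} (hxU : x ∈ U)
    (hx : x ∈ segment ℝ a b) (h : openSegment ℝ a b ⊆ U) : openSegment ℝ a x ⊆ U := by
  rw [segment_eq_image'] at hx
  obtain ⟨s, hs, rfl⟩ := hx
  rcases hs.1.eq_or_lt with rfl | hs0
  · simpa using hxU
  · refine Subset.trans ?_ h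
    rw [openSegment_eq_image_Ioo, openSegment_eq_image_Ioo]
    rintro _ ⟨t, ht, rfl⟩
    refine ⟨t * s, ⟨mul_pos ht.1 hs0, by nlinarith [ht.1, ht.2, hs.2]⟩, ?_⟩
    simp only [add_sub_cancel_left, smul_smul]

/-- A shortest route between two points is simple. -/
theorem exists_simple_route {A U D : Set Plane} (hU : IsOpen U) (hUc : IsPreconnected U)
    (hD : Dense D) (hAD : InGeneralPosition A D) {u v : Plane} (huA : u ∈ A) (hvA : v ∈ A)
    (huv : u ≠ v) (huU : u ∉ U) (hvU : v ∉ U) (hu : RadialAt U u) (hv : RadialAt U v)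
    (hu' : u ∈ closure U) (hv' : v ∈ closure U) :
    ∃ p n, 2 ≤ n ∧ p 0 = u ∧ p n = v ∧ IsRoute U D p n ∧ IsSimplePoly p n := by
  classical
  have hex : ∃ n, ∃ p, 2 ≤ n ∧ p 0 = u ∧ p n = v ∧ IsRoute U D p n := by
    obtain ⟨p, n, h⟩ := exists_isRoute hU hUc hD hu hv hu' hv'
    exact ⟨n, p, h⟩
  obtain ⟨p, hn2, h0, hnv, hp⟩ := Nat.find_spec hex
  have hmin : ∀ m < Nat.find hex, ∀ q : ℕ → Plane, 2 ≤ m → q 0 = u → q m = v → ¬ IsRoute U D q m :=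
    fun m hm q h2 h3 h4 h5 => Nat.find_min hex hm ⟨q, h2, h3, h4, h5⟩
  set n := Nat.find hex
  -- A repeated inner node would allow the loop between its occurrences to be cut out. The ends are
  -- not repeated, since they lie outside `U`.
  have hinj : ∀ i j, i < j → j ≤ n → p i ≠ p j := by
    intro i j hij hj he
    rcases Nat.eq_zero_or_pos i with rfl | hi
    · rcases hj.lt_or_eq with hj | rfl
      · exact huU (h0 ▸ he ▸ (hp.1 j hij hj).2)
      · exact huv (by rw [← h0, ← hnv, he])
    rcases hj.lt_or_eq with hj | rfl
    · refine hmin (n - (j - i)) (by omega) (fun k => if k ≤ i then p k else p (k + (j - i)))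
        (by omega) (by simp [h0]) ?_ ⟨fun k hk0 hk => ?_, fun k hk => ?_⟩
      · rw [if_neg (by omega), Nat.sub_add_cancel (by omega), hnv]
      · beta_reduce
        split_ifs
        · exact hp.1 k hk0 (by omega)
        · exact hp.1 _ (by omega) (by omega)
      · beta_reduce
        rcases lt_trichotomy k i with h | rfl | h
        · rw [if_pos h.le, if_pos (by omega)]; exact hp.2 k (by omega)
        · rw [if_pos le_rfl, if_neg (by omega), he, show k + 1 + (j - k) = j + 1 by omega]
          exact hp.2 j hj
        · rw [if_neg (by omega), if_neg (by omega),
            show k + 1 + (j - i) = k + (j - i) + 1 by omega]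
          exact hp.2 _ (by omega)
    · exact hvU (hnv ▸ he ▸ (hp.1 i hi hij).2)
  have hpA : ∀ i ≤ n, p i ∈ A ∪ D := by
    intro i hi
    rcases Nat.eq_zero_or_pos i with rfl | hi0
    · exact Or.inl (h0 ▸ huA)
    rcases hi.lt_or_eq with hi | rfl
    · exact Or.inr (hp.1 i hi0 hi).1
    · exact Or.inl (hnv ▸ hvA)
  refine ⟨p, n, hn2, h0, hnv, hp, fun i hi => hinj i (i + 1) (by omega) (by omega), ?_⟩
  intro i j hij hj x hxi hxj
  rcases Nat.lt_or_ge (i + 1) j with hlt | hge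
  · exfalso
    have hxU : x ∈ U := by
      rcases eq_or_ne x (p (i + 1)) with rfl | hx1
      · exact (hp.1 (i + 1) (by omega) (by omega)).2
      rcases eq_or_ne x (p i) with rfl | hx0
      · rcases Nat.eq_zero_or_pos i with rfl | hi0
        · refine absurd (hp.2 j hj ?_) (h0 ▸ huU)
          exact mem_openSegment_of_ne_left_right (hinj _ _ hij hj.le).symm
            (hinj _ _ (by omega) hj).symm hxj
        · exact (hp.1 i hi0 (by omega)).2
      · exact hp.2 i (by omega) (mem_openSegment_of_ne_left_right hx0.symm hx1.symm hxi)
    have hnode : ∀ k ≤ n, RadialAt U (p k) := by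
      intro k hk
      rcases Nat.eq_zero_or_pos k with rfl | hk0
      · rwa [h0]
      rcases hk.lt_or_eq with hk | rfl
      · exact RadialAt.of_mem hU (hp.1 k hk0 hk).2
      · rwa [hnv]
    have hs1 : openSegment ℝ (p i) x ⊆ U := openSegment_subset_of_mem hxU hxi (hp.2 i (by omega))
    have hs2 : openSegment ℝ (p (j + 1)) x ⊆ U :=
      openSegment_subset_of_mem hxU (segment_symm ℝ (p j) _ ▸ hxj)
        (openSegment_symm ℝ (p j) _ ▸ hp.2 j (by omega))
    have hev : ∀ᶠ z in 𝓝 x, z ∈ U ∧ openSegment ℝ (p i) z ⊆ U ∧ openSegment ℝ (p (j + 1)) z ⊆ U := by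
      filter_upwards [hU.mem_nhds hxU,
        (hnode i (by omega)).eventually_openSegment_subset hU hxU hs1,
        (hnode (j + 1) (by omega)).eventually_openSegment_subset hU hxU hs2] with z h1 h2 h3
      exact ⟨h1, h2, h3⟩
    -- If sides `i` and `j` meet in `x`, the nodes `i + 1, …, j` could be replaced by `x` alone. As
    -- `x` need not lie in `D`, a nearby point of `D` takes its place. At least one node is saved,
    -- against minimality.
    obtain ⟨x', hx'D, hx'U, hx'1, hx'2⟩ := hD.inter_nhds_nonempty hev
    refine hmin (n - (j - 1 - i)) (by omega)
      (fun k => if k ≤ i then p k else if k = i + 1 then x' else p (k + (j - 1 - i)))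
      (by omega) (by simp [h0]) ?_ ⟨fun k hk0 hk => ?_, fun k hk => ?_⟩
    · rw [if_neg (by omega), if_neg (by omega), Nat.sub_add_cancel (by omega), hnv]
    · beta_reduce
      split_ifs
      · exact hp.1 k hk0 (by omega)
      · exact ⟨hx'D, hx'U⟩
      · exact hp.1 _ (by omega) (by omega)
    · beta_reduce
      rcases lt_trichotomy k i with h | rfl | h
      · rw [if_pos h.le, if_pos (by omega)]; exact hp.2 k (by omega)
      · rw [if_pos le_rfl, if_neg (by omega), if_pos rfl]; exact hx'1
      · rcases (Nat.succ_le_of_lt h).eq_or_lt with h | h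
        · obtain rfl : k = i + 1 := h.symm
          rw [if_neg (by omega), if_pos rfl, if_neg (by omega), if_neg (by omega),
            openSegment_symm, show i + 1 + 1 + (j - 1 - i) = j + 1 by omega]
          exact hx'2
        · rw [if_neg (by omega), if_neg (by omega), if_neg (by omega), if_neg (by omega),
            show k + 1 + (j - 1 - i) = k + (j - 1 - i) + 1 by omega]
          exact hp.2 _ (by omega)
  -- Consecutive sides are not collinear, because their common node lies in `D`.
  · obtain rfl : j = i + 1 := by omega
    refine ⟨rfl, eq_of_mem_segment_of_area_ne_zero ?_ hxi hxj⟩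
    rw [area_rotate, area_rotate]
    exact hAD.2 _ (hpA _ (by omega)) _ (hpA _ (by omega)) _ (hp.1 (i + 1) (by omega) (by omega)).1
      (hinj _ _ (by omega) (by omega)).symm (hinj _ _ (by omega) (by omega))
      (hinj _ _ (by omega) (by omega)).symm

/-! ### Sectors and tubes -/

/-- The truncated open sector with apex `c` around the radius from `c` to `P`. -/
def sector (c P : Plane) (ε : ℝ) : Set Plane :=
  {y | ∃ t ∈ Ioc (0 : ℝ) 1, ∃ z ∈ ball P ε, c + t • (z - c) = y}

theorem isOpen_sector (c P : Plane) (ε : ℝ) : IsOpen (sector c P ε) := by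
  have : sector c P ε = ⋃ t ∈ Ioc (0 : ℝ) 1, (fun y => c + t⁻¹ • (y - c)) ⁻¹' ball P ε := by
    ext y
    simp only [sector, mem_ofPred_eq, mem_iUnion, mem_preimage, exists_prop]
    refine exists_congr fun t => and_congr_right fun ht => ⟨?_, fun h => ?_⟩
    · rintro ⟨z, hz, rfl⟩
      rwa [add_sub_cancel_left, smul_smul, inv_mul_cancel₀ ht.1.ne', one_smul, add_sub_cancel]
    · exact ⟨_, h, by rw [add_sub_cancel_left, smul_smul, mul_inv_cancel₀ ht.1.ne', one_smul,
        add_sub_cancel]⟩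
  rw [this]
  exact isOpen_biUnion fun t _ => isOpen_ball.preimage (by fun_prop)

theorem isPreconnected_sector (c P : Plane) (ε : ℝ) : IsPreconnected (sector c P ε) := by
  have : sector c P ε =
      (fun q : ℝ × Plane => c + q.1 • (q.2 - c)) '' (Ioc (0 : ℝ) 1 ×ˢ ball P ε) := by
    ext y
    simp only [sector, mem_ofPred_eq, mem_image, mem_prod, Prod.exists]
    constructor
    · rintro ⟨t, ht, z, hz, rfl⟩
      exact ⟨t, z, ⟨ht, hz⟩, rfl⟩
    · rintro ⟨t, z, ⟨ht, hz⟩, rfl⟩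
      exact ⟨t, ht, z, hz, rfl⟩
  rw [this]
  exact (isPreconnected_Ioc.prod (convex_ball P ε).isPreconnected).image _ (by fun_prop)

theorem add_smul_mem_sector {c P y : Plane} {ε : ℝ} (hy : y ∈ sector c P ε) {t : ℝ}
    (ht : t ∈ Ioc (0 : ℝ) 1) : c + t • (y - c) ∈ sector c P ε := by
  obtain ⟨s, hs, z, hz, rfl⟩ := hy
  exact ⟨t * s, ⟨mul_pos ht.1 hs.1, by nlinarith [ht.1, ht.2, hs.1, hs.2]⟩, z, hz, by
    rw [add_sub_cancel_left, smul_smul]⟩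

theorem mem_sector_of_mem_segment {c P y : Plane} {ε : ℝ} (hε : 0 < ε) (hy : y ∈ segment ℝ c P)
    (hyc : y ≠ c) : y ∈ sector c P ε := by
  rw [segment_eq_image'] at hy
  obtain ⟨t, ht, rfl⟩ := hy
  refine ⟨t, ⟨ht.1.lt_of_ne ?_, ht.2⟩, P, mem_ball_self hε, rfl⟩
  rintro rfl
  simp at hyc

theorem sector_subset_thickening (c P : Plane) (ε : ℝ) :
    sector c P ε ⊆ thickening ε (segment ℝ c P) := by
  rintro _ ⟨t, ht, z, hz, rfl⟩
  refine mem_thickening_iff.2 ⟨c + t • (P - c), ?_, ?_⟩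
  · rw [segment_eq_image']; exact ⟨t, Ioc_subset_Icc_self ht, rfl⟩
  · rw [dist_add_left, dist_eq_norm, ← smul_sub, sub_sub_sub_cancel_right, norm_smul,
      Real.norm_eq_abs, abs_of_pos ht.1]
    rw [mem_ball, dist_eq_norm] at hz
    calc t * ‖z - P‖ ≤ 1 * ‖z - P‖ := by gcongr; exact ht.2
      _ < ε := by rwa [one_mul]

theorem dist_lt_of_mem_sector {c P y : Plane} {ε : ℝ} (hy : y ∈ sector c P ε) :
    dist y c < dist P c + ε := by
  obtain ⟨t, ht, z, hz, rfl⟩ := hy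
  rw [dist_eq_norm, add_sub_cancel_left, norm_smul, Real.norm_eq_abs, abs_of_pos ht.1]
  rw [mem_ball] at hz
  have h1 := dist_triangle z P c
  have h2 : t * ‖z - c‖ ≤ 1 * ‖z - c‖ := by gcongr; exact ht.2
  rw [← dist_eq_norm] at h2
  rw [← dist_eq_norm]
  linarith

theorem center_notMem_sector {c P : Plane} {ε : ℝ} (h : ε ≤ dist P c) : c ∉ sector c P ε := by
  rintro ⟨t, ht, z, hz, he⟩
  rw [add_eq_left, smul_eq_zero, sub_eq_zero] at he
  rcases he with he | rfl
  · exact ht.1.ne' he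
  · rw [mem_ball, dist_comm] at hz; linarith

/-- A common point puts `z` and `z'` on one ray from `c`, so their distance is the difference of
their distances from `c`. This is less than `2 * ε`, because `P` and `P'` are equally far from `c`;
hence `P` and `P'` would be closer than `4 * ε`. -/
theorem disjoint_sector {c P P' : Plane} {ε : ℝ} (h : dist P c = dist P' c)
    (hε : 4 * ε < dist P P') : Disjoint (sector c P ε) (sector c P' ε) := by
  rw [disjoint_left]
  rintro _ ⟨t, ht, z, hz, rfl⟩ ⟨t', ht', z', hz', he⟩
  rw [add_right_inj] at he
  have h1 : z' - c = (t / t') • (z - c) := by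
    rw [div_eq_inv_mul, mul_smul, ← he, smul_smul, inv_mul_cancel₀ ht'.1.ne', one_smul]
  have hl : 0 < t / t' := div_pos ht.1 ht'.1
  have h2 : dist z z' = |dist z c - dist z' c| := by
    rw [dist_eq_norm z c, dist_eq_norm z' c, h1, norm_smul, Real.norm_eq_abs, abs_of_pos hl,
      dist_eq_norm, show z - z' = (1 - t / t') • (z - c) by
        rw [sub_smul, ← h1]; simp, norm_smul, Real.norm_eq_abs,
      show ‖z - c‖ - t / t' * ‖z - c‖ = (1 - t / t') * ‖z - c‖ by ring, abs_mul, abs_norm]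
  rw [mem_ball] at hz hz'
  have h3 : |dist z c - dist z' c| < 2 * ε := by
    have a1 := dist_triangle z P c
    have a2 := dist_triangle P z c
    have a3 := dist_triangle z' P' c
    have a4 := dist_triangle P' z' c
    rw [dist_comm P z] at a2
    rw [dist_comm P' z'] at a4
    rw [abs_lt]; constructor <;> linarith
  have h4 := dist_triangle4 P z z' P'
  rw [dist_comm P z] at h4
  linarith

theorem isPreconnected_thickening {K : Set Plane} (hK : IsPreconnected K) {ε : ℝ} (hε : 0 < ε) :
    IsPreconnected (thickening ε K) := by
  rcases K.eq_empty_or_nonempty with rfl | ⟨k, hk⟩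
  · simp [isPreconnected_empty]
  refine isPreconnected_of_forall k fun y hy => ?_
  obtain ⟨z, hz, hyz⟩ := mem_thickening_iff.1 hy
  refine ⟨K ∪ ball z ε, union_subset (self_subset_thickening hε K) ?_, Or.inl hk, Or.inr hyz,
    hK.union z hz (mem_ball_self hε) (convex_ball z ε).isPreconnected⟩
  intro w hw
  exact mem_thickening_iff.2 ⟨z, hz, hw⟩

section Tubes

variable {V ι : Type*}

/-- The ends of an edge. -/
def edgeEnd (s t : ι → V) (i : ι) (b : Bool) : V := if b then t i else s i

theorem edgeEnd_injective {s t : ι → V} {i : ι} (h : s i ≠ t i) :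
    Function.Injective (edgeEnd s t i) := by
  intro b b' hb
  cases b <;> cases b'
  · rfl
  · exact absurd hb h
  · exact absurd hb.symm h
  · rfl

/-- Disjoint compact connected sets between small circles around the vertices, extended radially to
the vertices, have disjoint tubular neighbourhoods. -/
theorem exists_tubes [Finite ι] (x : V → Plane) (s t : ι → V) (hst : ∀ i, s i ≠ t i) {r : ℝ} (hr : 0 < r)
    (hsep : ∀ v w, v ≠ w → 4 * r < dist (x v) (x w)) (K : ι → Set Plane) (P : ι → Bool → Plane)
    (hKc : ∀ i, IsCompact (K i)) (hKp : ∀ i, IsPreconnected (K i)) (hPK : ∀ i b, P i b ∈ K i)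
    (hPr : ∀ i b, dist (P i b) (x (edgeEnd s t i b)) = r)
    (hKr : ∀ i, ∀ z ∈ K i, ∀ v, r ≤ dist z (x v))
    (hKd : ∀ i j, i ≠ j → Disjoint (K i) (K j)) :
    ∃ U : ι → Set Plane, (∀ i, IsOpen (U i)) ∧ (∀ i, IsPreconnected (U i)) ∧
      (∀ i j, i ≠ j → Disjoint (U i) (U j)) ∧ (∀ i v, x v ∉ U i) ∧
      (∀ i b, RadialAt (U i) (x (edgeEnd s t i b))) ∧
      (∀ i b, x (edgeEnd s t i b) ∈ closure (U i)) ∧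
      ∀ i, K i ⊆ U i ∧ ∀ b, ∀ z ∈ segment ℝ (x (edgeEnd s t i b)) (P i b),
        z ≠ x (edgeEnd s t i b) → z ∈ U i := by
  -- A radius has distance `r` from its centre only at its outer end, and that end belongs to `K j`.
  have hKs : ∀ i j b, i ≠ j → Disjoint (K i) (segment ℝ (x (edgeEnd s t j b)) (P j b)) := by
    intro i j b hij
    rw [disjoint_left]
    intro z hz hz'
    have h1 := hKr i z hz (edgeEnd s t j b)
    rw [segment_eq_image'] at hz'
    obtain ⟨τ, hτ, rfl⟩ := hz'
    rw [dist_eq_norm, add_sub_cancel_left, norm_smul, ← dist_eq_norm, hPr, Real.norm_eq_abs,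
      abs_of_nonneg hτ.1] at h1
    have h2 : τ = 1 := le_antisymm hτ.2 (by nlinarith)
    simp only [h2, one_smul, add_sub_cancel] at hz
    exact disjoint_left.1 (hKd i j hij) hz (hPK j b)
  obtain ⟨ε, hε, hεr, h1, h2, h3⟩ : ∃ ε : ℝ, 0 < ε ∧ ε < r / 2 ∧
      (∀ i j, i ≠ j → Disjoint (thickening ε (K i)) (thickening ε (K j))) ∧
      (∀ i j b, i ≠ j → Disjoint (thickening ε (K i))
        (thickening ε (segment ℝ (x (edgeEnd s t j b)) (P j b)))) ∧
      (∀ i j b b', i ≠ j → 4 * ε < dist (P i b) (P j b')) := by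
    have e1 : ∀ᶠ ε in 𝓝[>] (0 : ℝ), ∀ i j, i ≠ j →
        Disjoint (thickening ε (K i)) (thickening ε (K j)) := by
      refine eventually_all.2 fun i => eventually_all.2 fun j => ?_
      by_cases hij : i = j
      · simp [hij]
      · filter_upwards [eventually_disjoint_thickening (hKc i) (hKc j) (hKd i j hij)] with ε h _
        exact h
    have e2 : ∀ᶠ ε in 𝓝[>] (0 : ℝ), ∀ i j b, i ≠ j → Disjoint (thickening ε (K i))
        (thickening ε (segment ℝ (x (edgeEnd s t j b)) (P j b))) := by
      refine eventually_all.2 fun i => eventually_all.2 fun j => eventually_all.2 fun b => ?_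
      by_cases hij : i = j
      · simp [hij]
      · filter_upwards [eventually_disjoint_thickening (hKc i) (isCompact_segment _ _)
          (hKs i j b hij)] with ε h _
        exact h
    have e3 : ∀ᶠ ε in 𝓝[>] (0 : ℝ), ∀ i j b b', i ≠ j → 4 * ε < dist (P i b) (P j b') := by
      refine eventually_all.2 fun i => eventually_all.2 fun j => eventually_all.2 fun b =>
        eventually_all.2 fun b' => ?_
      by_cases hij : i = j
      · simp [hij]
      · have hne : P i b ≠ P j b' := fun h =>
          disjoint_left.1 (hKd i j hij) (hPK i b) (h ▸ hPK j b')
        filter_upwards [Ioo_mem_nhdsGT (div_pos (dist_pos.2 hne) (by norm_num : (0 : ℝ) < 4))]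
          with ε h _
        linarith [h.2]
    have e4 : ∀ᶠ ε in 𝓝[>] (0 : ℝ), ε ∈ Ioo (0 : ℝ) (r / 2) := Ioo_mem_nhdsGT (by positivity)
    obtain ⟨ε, h⟩ := (e1.and (e2.and (e3.and e4))).exists
    exact ⟨ε, h.2.2.2.1, h.2.2.2.2, h.1, h.2.1, h.2.2.1⟩
  set c : ι → Bool → Plane := fun i b => x (edgeEnd s t i b) with hc
  -- A sector reaches less than `r + ε` from its own vertex, while vertices are more than `4 * r`
  -- apart.
  have hfar : ∀ i b, ∀ y ∈ sector (c i b) (P i b) ε, ∀ v, dist y (x v) < 2 * r →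
      v = edgeEnd s t i b := by
    intro i b y hy v hv
    by_contra hne
    have a1 := hsep _ _ hne
    have a2 := dist_lt_of_mem_sector hy
    rw [hPr] at a2
    have a3 := dist_triangle_left (x v) (x (edgeEnd s t i b)) y
    linarith
  have hPsec : ∀ i b, P i b ∈ sector (c i b) (P i b) ε := fun i b =>
    ⟨1, by simp, P i b, mem_ball_self hε, by simp⟩
  -- The tube is the thickened middle part together with the two sectors. Within `r / 2` of an end
  -- vertex only the sector at that vertex is present, which gives radiality.
  refine ⟨fun i => thickening ε (K i) ∪ ⋃ b, sector (c i b) (P i b) ε, fun i => ?_, fun i => ?_,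
    fun i j hij => ?_, fun i v => ?_, fun i b => ?_, fun i b => ?_, fun i => ⟨?_, ?_⟩⟩
  · exact isOpen_thickening.union (isOpen_iUnion fun b => isOpen_sector _ _ _)
  · have hT := isPreconnected_thickening (hKp i) hε
    have hPT : ∀ b, P i b ∈ thickening ε (K i) := fun b => self_subset_thickening hε _ (hPK i b)
    refine isPreconnected_of_forall (P i true) fun y hy => ?_
    rcases hy with hy | hy
    · exact ⟨_, subset_union_left, hPT true, hy, hT⟩
    · obtain ⟨b, hb⟩ := mem_iUnion.1 hy
      exact ⟨thickening ε (K i) ∪ sector (c i b) (P i b) ε,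
        union_subset_union_right _ (subset_iUnion (fun b => sector (c i b) (P i b) ε) b),
        Or.inl (hPT true), Or.inr hb,
        hT.union (P i b) (hPT b) (hPsec i b) (isPreconnected_sector _ _ _)⟩
  · simp only [disjoint_union_left, disjoint_union_right, disjoint_iUnion_left,
      disjoint_iUnion_right]
    refine ⟨⟨h1 i j hij, fun b => ?_⟩, fun b => ⟨?_, fun b' => ?_⟩⟩
    · exact ((h2 j i b hij.symm).mono_right (sector_subset_thickening _ _ _)).symm
    · exact (h2 i j b hij).mono_right (sector_subset_thickening _ _ _)
    · by_cases he : edgeEnd s t i b' = edgeEnd s t j b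
      · have : c i b' = c j b := congrArg x he
        rw [this]
        refine disjoint_sector ?_ (h3 i j b' b hij)
        rw [hPr, ← this, hPr]
      · rw [disjoint_left]
        intro y hy hy'
        refine he (hfar j b y hy' _ ?_)
        have := dist_lt_of_mem_sector hy
        rw [hPr] at this
        linarith
  · rintro (h | h)
    · obtain ⟨z, hz, hd⟩ := mem_thickening_iff.1 h
      have := hKr i z hz v
      rw [dist_comm] at this
      linarith
    · obtain ⟨b, hb⟩ := mem_iUnion.1 h
      have := hfar i b _ hb v (by rw [dist_self]; linarith)
      rw [this] at hb
      exact center_notMem_sector (by rw [hPr]; linarith) hb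
  · refine ⟨r / 2, by positivity, ?_⟩
    rintro y ⟨hy | hy, hyb⟩ τ hτ
    · obtain ⟨z, hz, hd⟩ := mem_thickening_iff.1 hy
      have a1 := hKr i z hz (edgeEnd s t i b)
      rw [mem_ball] at hyb
      have a2 := dist_triangle_left z (x (edgeEnd s t i b)) y
      linarith
    · obtain ⟨b', hb'⟩ := mem_iUnion.1 hy
      rw [mem_ball] at hyb
      have hbb : b = b' := by
        have := hfar i b' y hb' _ (by linarith)
        exact edgeEnd_injective (hst i) this
      subst hbb
      exact Or.inr (mem_iUnion.2 ⟨b, add_smul_mem_sector hb' hτ⟩)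
  · rw [Metric.mem_closure_iff]
    intro δ hδ
    obtain ⟨τ, hτ, hτb⟩ := exists_mem_ball_add_smul (c i b) (P i b - c i b) hδ
    refine ⟨_, Or.inr (mem_iUnion.2 ⟨b, add_smul_mem_sector (hPsec i b)
      (Ioo_subset_Ioc_self hτ)⟩), ?_⟩
    rwa [mem_ball, dist_comm] at hτb
  · exact (self_subset_thickening hε _).trans subset_union_left
  · intro b z hz hzc
    exact Or.inr (mem_iUnion.2 ⟨b, mem_sector_of_mem_segment hε hz hzc⟩)

end Tubes

/-! ### Simple arcs and polygonal arcs -/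

theorem IsSimpleArc.trans {a b c : Plane} {S T : Set Plane} (hS : IsSimpleArc a b S)
    (hT : IsSimpleArc b c T) (h : ∀ z ∈ S, z ∈ T → z = b) : IsSimpleArc a c (S ∪ T) := by
  obtain ⟨γ, hγ, rfl⟩ := hS
  obtain ⟨δ, hδ, rfl⟩ := hT
  refine ⟨γ.trans δ, ?_, Path.trans_range γ δ⟩
  have hmix : ∀ s t, γ s = δ t → s = 1 ∧ t = 0 := by
    intro s t hst
    have hb := h (γ s) ⟨s, rfl⟩ ⟨t, hst.symm⟩
    exact ⟨hγ (hb.trans γ.target.symm), hδ ((hst.symm.trans hb).trans δ.source.symm)⟩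
  intro s t hst
  rw [Path.trans_apply, Path.trans_apply] at hst
  split_ifs at hst with h1 h2 h2
  · have := congrArg Subtype.val (hγ hst)
    simp only at this
    exact Subtype.ext (by linarith)
  · have h3 := hmix _ _ hst
    have := congrArg Subtype.val h3.2
    simp only [Icc.coe_zero] at this
    exfalso; linarith
  · have h3 := hmix _ _ hst.symm
    have := congrArg Subtype.val h3.2
    simp only [Icc.coe_zero] at this
    exfalso; linarith
  · have := congrArg Subtype.val (hδ hst)
    simp only at this
    exact Subtype.ext (by linarith)

theorem IsSimpleArc.symm {a b : Plane} {S : Set Plane} (h : IsSimpleArc a b S) :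
    IsSimpleArc b a S := by
  obtain ⟨γ, hγ, rfl⟩ := h
  exact ⟨γ.symm, hγ.comp unitInterval.symm_involutive.injective, Path.symm_range γ⟩

theorem IsSimpleArc.image {a b : Plane} {S : Set Plane} (h : IsSimpleArc a b S) (F : Plane ≃ₜ Plane) :
    IsSimpleArc (F a) (F b) (F '' S) := by
  obtain ⟨γ, hγ, rfl⟩ := h
  refine ⟨γ.map F.continuous, F.injective.comp hγ, ?_⟩
  rw [Path.map_coe, range_comp]

theorem isSimpleArc_segment {a b : Plane} (hab : a ≠ b) : IsSimpleArc a b (segment ℝ a b) := by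
  refine ⟨⟨⟨fun t => a + (t : ℝ) • (b - a), by fun_prop⟩, by simp, by simp⟩, ?_, ?_⟩
  · intro s t hst
    have h1 : a + (s : ℝ) • (b - a) = a + (t : ℝ) • (b - a) := hst
    rw [add_right_inj] at h1
    exact Subtype.ext (smul_left_injective ℝ (sub_ne_zero.2 hab.symm) h1)
  · rw [segment_eq_image']
    ext z
    constructor
    · rintro ⟨t, rfl⟩
      exact ⟨t, t.2, rfl⟩
    · rintro ⟨t, ht, rfl⟩
      exact ⟨⟨t, ht⟩, rfl⟩

theorem IsSimplePoly.isSimpleArc (n : ℕ) : ∀ {p : ℕ → Plane}, IsSimplePoly p (n + 1) →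
    IsSimpleArc (p 0) (p (n + 1)) (polySet p (n + 1)) := by
  induction n with
  | zero =>
    intro p hp
    have : polySet p (0 + 1) = segment ℝ (p 0) (p 1) := by
      rw [polySet_succ_left]; simp [polySet]
    rw [this]
    exact isSimpleArc_segment (hp.1 0 (by omega))
  | succ n ih =>
    intro p hp
    rw [polySet_succ_right]
    refine (ih hp.init).trans (isSimpleArc_segment (hp.1 _ (by omega))) ?_
    rintro z ⟨i, hi, hz⟩ hz'
    exact (hp.2 i (n + 1) hi (by omega) z hz hz').2

theorem IsPolyArc.isSimpleArc {a b : Plane} {S : Set Plane} (h : IsPolyArc a b S) :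
    IsSimpleArc a b S := by
  obtain ⟨p, n, hn, hp, rfl, rfl, rfl⟩ := h
  obtain ⟨m, rfl⟩ := Nat.exists_eq_succ_of_ne_zero hn.ne'
  exact hp.isSimpleArc

theorem IsPolyArc.symm {a b : Plane} {S : Set Plane} (h : IsPolyArc a b S) : IsPolyArc b a S := by
  obtain ⟨p, n, hn, hp, rfl, rfl, rfl⟩ := h
  have hseg : ∀ i < n, segment ℝ (p (n - i)) (p (n - (i + 1))) =
      segment ℝ (p (n - (i + 1))) (p (n - (i + 1) + 1)) := fun i hi => by
    rw [segment_symm, show n - (i + 1) + 1 = n - i by omega]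
  refine ⟨fun k => p (n - k), n, hn, ⟨fun i hi => ?_, fun i j hij hj z hz hz' => ?_⟩, by simp,
    by simp, ?_⟩
  · have := hp.1 (n - (i + 1)) (by omega)
    rw [show n - (i + 1) + 1 = n - i by omega] at this
    exact this.symm
  · beta_reduce at hz hz' ⊢
    rw [hseg i (by omega)] at hz
    rw [hseg j hj] at hz'
    obtain ⟨h1, h2⟩ := hp.2 (n - (j + 1)) (n - (i + 1)) (by omega) (by omega) z hz' hz
    have h3 : j = i + 1 := by omega
    exact ⟨h3, by rw [h2, h3]⟩
  · ext z
    constructor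
    · rintro ⟨i, hi, hz⟩
      beta_reduce at hz
      rw [hseg i hi] at hz
      exact ⟨_, by omega, hz⟩
    · rintro ⟨i, hi, hz⟩
      refine ⟨n - (i + 1), by omega, ?_⟩
      beta_reduce
      rw [hseg _ (by omega), show n - (n - (i + 1) + 1) = i by omega]
      exact hz

/-- A polygonal arc is straight near its first end point. -/
theorem IsPolyArc.eventually_segment_subset {a b : Plane} {S : Set Plane} (h : IsPolyArc a b S) :
    ∀ᶠ r in 𝓝[>] (0 : ℝ), ∀ w ∈ S, dist w a = r → segment ℝ a w ⊆ S := by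
  obtain ⟨p, n, hn, hp, rfl, rfl, rfl⟩ := h
  obtain ⟨m, rfl⟩ := Nat.exists_eq_succ_of_ne_zero hn.ne'
  have hcl : IsClosed (polySet (fun k => p (k + 1)) m) := (isCompact_polySet _ _).isClosed
  have h0 : p 0 ∉ polySet (fun k => p (k + 1)) m := by
    rintro ⟨i, hi, h⟩
    obtain ⟨h1, h2⟩ := hp.2 0 (i + 1) (by omega) (by omega) (p 0) (left_mem_segment ..) h
    rw [h1] at h2
    exact hp.1 0 (by omega) h2
  -- All sides after the first keep a positive distance from the first node.
  obtain ⟨δ, hδ, hball⟩ := Metric.isOpen_iff.1 hcl.isOpen_compl _ h0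
  filter_upwards [Ioo_mem_nhdsGT hδ] with r hr w hw hwr
  rw [polySet_succ_left] at hw ⊢
  rcases hw with hw | hw
  · exact ((convex_segment _ _).segment_subset (left_mem_segment ..) hw).trans subset_union_left
  · exact absurd hw (hball (by rw [mem_ball, hwr]; exact hr.2))

/-- The part of an arc between the last exit from a disc around its source and the first entrance
into a disc around its target. -/
theorem exists_middle {a b : Plane} (γ : Path a b) {r : ℝ} (hr : 0 < r)
    (hab : 4 * r < dist a b) :
    ∃ t₀ t₁ : unitInterval, t₀ ≤ t₁ ∧ dist (γ t₀) a = r ∧ dist (γ t₁) b = r ∧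
      ∀ t ∈ Icc t₀ t₁, r ≤ dist (γ t) a ∧ r ≤ dist (γ t) b := by
  have hca : Continuous fun t => dist (γ t) a := by fun_prop
  have hcb : Continuous fun t => dist (γ t) b := by fun_prop
  obtain ⟨t₀, ht₀, hmax⟩ := (isClosed_le hca continuous_const :
    IsClosed {t | dist (γ t) a ≤ r}).isCompact.exists_isGreatest ⟨0, by simp [hr.le]⟩
  have h0 : dist (γ t₀) a = r := by
    obtain ⟨t, ht, hte⟩ := intermediate_value_Icc (f := fun t => dist (γ t) a) t₀.2.2
      (b := (1 : unitInterval)) hca.continuousOn (a := t₀) (show r ∈ Icc _ _ from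
        ⟨ht₀, by rw [γ.target, dist_comm]; linarith⟩)
    have h2 := hmax (show t ∈ {t | dist (γ t) a ≤ r} from hte.le)
    rw [← le_antisymm h2 ht.1]; exact hte
  obtain ⟨t₁, ⟨ht₁, ht₀₁⟩, hmin⟩ := ((isClosed_le hcb continuous_const :
    IsClosed {t | dist (γ t) b ≤ r}).inter isClosed_Ici).isCompact.exists_isLeast
      ⟨1, by simp [hr.le], (show t₀ ≤ 1 from t₀.2.2)⟩
  have h1 : dist (γ t₁) b = r := by
    have h2 : r ≤ dist (γ t₀) b := by
      have := dist_triangle_left a b (γ t₀)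
      linarith
    obtain ⟨t, ht, hte⟩ := intermediate_value_Icc' (f := fun t => dist (γ t) b) ht₀₁
      hcb.continuousOn (show r ∈ Icc _ _ from ⟨ht₁, h2⟩)
    have h2 := hmin (show t ∈ {t | dist (γ t) b ≤ r} ∩ Ici t₀ from ⟨hte.le, ht.1⟩)
    rw [← le_antisymm ht.2 h2]; exact hte
  refine ⟨t₀, t₁, ht₀₁, h0, h1, fun t ht => ⟨?_, ?_⟩⟩
  · by_contra! hlt
    have := hmax (show t ∈ {t | dist (γ t) a ≤ r} from hlt.le)
    rw [le_antisymm this ht.1] at hlt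
    linarith
  · by_contra! hlt
    have := hmin (show t ∈ {t | dist (γ t) b ≤ r} ∩ Ici t₀ from ⟨hlt.le, ht.1⟩)
    rw [le_antisymm ht.2 this] at hlt
    linarith

/-- An injective path is a closed embedding, so the parameters of a segment contained in its range
form an interval. -/
theorem subset_segment_of_segment_subset {a b : Plane} (γ : Path a b) (hγ : Function.Injective γ)
    {w : Plane} {t t₀ t₁ : unitInterval} (hs : segment ℝ w (γ t₁) ⊆ range γ) (hw : γ t₀ = w)
    (ht : t ∈ uIcc t₀ t₁) : γ t ∈ segment ℝ w (γ t₁) := by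
  have hpre := (convex_segment (𝕜 := ℝ) w (γ t₁)).isPreconnected.preimage_of_isClosedMap hγ
    (Continuous.isClosedMap γ.continuous) hs
  have := hpre.ordConnected.uIcc_subset (x := t₀) (y := t₁)
    (by rw [mem_preimage, hw]; exact left_mem_segment ..) (right_mem_segment ..)
  exact this ht

/-! ### Tubes around the edges of a plane drawing -/

section Redraw

variable {V ι : Type*}

/-- The curves `C i` form a plane drawing of a multigraph with vertices at the points `x v`. -/
structure IsPlaneSystem (x : V → Plane) (s t : ι → V) (C : ι → Set Plane) : Prop where
  arc : ∀ i, IsSimpleArc (x (s i)) (x (t i)) (C i)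
  vert : ∀ i w, x w ∈ C i → w = s i ∨ w = t i
  inter : ∀ i j, i ≠ j → ∀ z ∈ C i, z ∈ C j → z ∈ range x

theorem IsSimpleArc.isCompact {a b : Plane} {S : Set Plane} (h : IsSimpleArc a b S) :
    IsCompact S := by
  obtain ⟨γ, -, rfl⟩ := h
  exact isCompact_range γ.continuous

/-- Every plane drawing has disjoint tubes around its edges. Edges that are polygonal lie in their
own tubes. -/
theorem IsPlaneSystem.exists_tubes [Finite V] [Finite ι] {x : V → Plane}
    (hx : Function.Injective x) {s t : ι → V} (hst : ∀ i, s i ≠ t i) {C : ι → Set Plane}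
    (hC : IsPlaneSystem x s t C) (F : Set ι)
    (hF : ∀ i ∈ F, IsPolyArc (x (s i)) (x (t i)) (C i)) :
    ∃ U : ι → Set Plane, (∀ i, IsOpen (U i)) ∧ (∀ i, IsPreconnected (U i)) ∧
      (∀ i j, i ≠ j → Disjoint (U i) (U j)) ∧ (∀ i v, x v ∉ U i) ∧
      (∀ i b, RadialAt (U i) (x (edgeEnd s t i b))) ∧
      (∀ i b, x (edgeEnd s t i b) ∈ closure (U i)) ∧
      ∀ i ∈ F, C i ⊆ U i ∪ {x (s i), x (t i)} := by
  obtain ⟨r, hr, h1, h2, h3, h4⟩ : ∃ r : ℝ, 0 < r ∧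
      (∀ v w, v ≠ w → 4 * r < dist (x v) (x w)) ∧
      (∀ i v, v ≠ s i → v ≠ t i → ∀ z ∈ C i, r ≤ dist z (x v)) ∧
      (∀ i, i ∈ F → ∀ w ∈ C i, dist w (x (s i)) = r → segment ℝ (x (s i)) w ⊆ C i) ∧
      (∀ i, i ∈ F → ∀ w ∈ C i, dist w (x (t i)) = r → segment ℝ (x (t i)) w ⊆ C i) := by
    have e1 : ∀ᶠ r in 𝓝[>] (0 : ℝ), ∀ v w, v ≠ w → 4 * r < dist (x v) (x w) := by
      refine eventually_all.2 fun v => eventually_all.2 fun w => ?_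
      by_cases hvw : v = w
      · simp [hvw]
      · filter_upwards [Ioo_mem_nhdsGT (div_pos (dist_pos.2 (fun h => hvw (hx h)))
          (by norm_num : (0 : ℝ) < 4))] with ε h _
        linarith [h.2]
    have e2 : ∀ᶠ r in 𝓝[>] (0 : ℝ), ∀ i v, v ≠ s i → v ≠ t i →
        ∀ z ∈ C i, r ≤ dist z (x v) := by
      refine eventually_all.2 fun i => eventually_all.2 fun v => ?_
      by_cases hv : v = s i ∨ v = t i
      · filter_upwards with r hs ht
        exact absurd hv (by simp [hs, ht])
      · obtain ⟨δ, hδ, hball⟩ := Metric.isOpen_iff.1 (hC.arc i).isCompact.isClosed.isOpen_compl (x v)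
          (fun h => hv (hC.vert i v h))
        filter_upwards [Ioo_mem_nhdsGT hδ] with r hr _ _ z hz
        by_contra! hlt
        exact hball (mem_ball.2 (hlt.trans hr.2)) hz
    have e3 : ∀ᶠ r in 𝓝[>] (0 : ℝ),
        ∀ i, i ∈ F → ∀ w ∈ C i, dist w (x (s i)) = r → segment ℝ (x (s i)) w ⊆ C i := by
      refine eventually_all.2 fun i => ?_
      by_cases hi : i ∈ F
      · filter_upwards [(hF i hi).eventually_segment_subset] with r h _
        exact h
      · simp [hi]
    have e4 : ∀ᶠ r in 𝓝[>] (0 : ℝ),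
        ∀ i, i ∈ F → ∀ w ∈ C i, dist w (x (t i)) = r → segment ℝ (x (t i)) w ⊆ C i := by
      refine eventually_all.2 fun i => ?_
      by_cases hi : i ∈ F
      · filter_upwards [(hF i hi).symm.eventually_segment_subset] with r h _
        exact h
      · simp [hi]
    have e5 : ∀ᶠ r in 𝓝[>] (0 : ℝ), r ∈ Ioi (0 : ℝ) := self_mem_nhdsWithin
    obtain ⟨r, g1, g2, g3, g4, g5⟩ := (e1.and (e2.and (e3.and (e4.and e5)))).exists
    exact ⟨r, g5, g1, g2, g3, g4⟩
  choose γ hγ hγC using hC.arc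
  choose t₀ t₁ h01 hd0 hd1 hmid using fun i => exists_middle (γ i) hr (h1 _ _ (hst i))
  have hγmem : ∀ i τ, γ i τ ∈ C i := fun i τ => hγC i ▸ mem_range_self τ
  have hKr : ∀ i, ∀ z ∈ γ i '' Icc (t₀ i) (t₁ i), ∀ v, r ≤ dist z (x v) := by
    rintro i _ ⟨τ, hτ, rfl⟩ v
    by_cases hvs : v = s i
    · rw [hvs]; exact (hmid i τ hτ).1
    by_cases hvt : v = t i
    · rw [hvt]; exact (hmid i τ hτ).2
    exact h2 i v hvs hvt _ (hγmem i τ)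
  -- Only the middle part of each curve is kept; its possibly wild ends inside the discs are
  -- replaced by radii. For edges in `F` these radii are the actual ends of the curve, by the choice
  -- of `r`.
  obtain ⟨U, u1, u2, u3, u4, u5, u6, u7⟩ := _root_.exists_tubes x s t hst hr h1
    (fun i => γ i '' Icc (t₀ i) (t₁ i)) (fun i b => γ i (if b then t₁ i else t₀ i))
    (fun i => isCompact_Icc.image (γ i).continuous)
    (fun i => isPreconnected_Icc.image _ (γ i).continuous.continuousOn)
    (fun i b => by
      cases b
      · exact ⟨t₀ i, left_mem_Icc.2 (h01 i), rfl⟩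
      · exact ⟨t₁ i, right_mem_Icc.2 (h01 i), rfl⟩)
    (fun i b => by
      cases b
      · exact hd0 i
      · exact hd1 i) hKr
    (fun i j hij => by
      rw [disjoint_left]
      rintro _ ⟨τ, hτ, rfl⟩ ⟨τ', hτ', he⟩
      obtain ⟨v, hv⟩ := hC.inter i j hij _ (hγmem i τ) (he ▸ hγmem j τ')
      have := hKr i _ ⟨τ, hτ, rfl⟩ v
      rw [hv, dist_self] at this
      linarith)
  refine ⟨U, u1, u2, u3, u4, u5, u6, fun i hi => ?_⟩
  intro z hz
  by_cases hzs : z = x (s i)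
  · right; simp [hzs]
  by_cases hzt : z = x (t i)
  · right; simp [hzt]
  left
  rw [← hγC i] at hz
  obtain ⟨τ, rfl⟩ := hz
  rcases le_total τ (t₀ i) with h | h
  · refine (u7 i).2 false _ ?_ hzs
    refine subset_segment_of_segment_subset (γ i) (hγ i) (t₀ := 0) (t₁ := t₀ i) ?_ ?_ ?_
    · rw [hγC i]; exact h3 i hi _ (hγmem i _) (hd0 i)
    · exact (γ i).source
    · exact mem_uIcc.2 (Or.inl ⟨τ.2.1, h⟩)
  rcases le_total τ (t₁ i) with h' | h'
  · exact (u7 i).1 ⟨τ, ⟨h, h'⟩, rfl⟩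
  · refine (u7 i).2 true _ ?_ hzt
    refine subset_segment_of_segment_subset (γ i) (hγ i) (t₀ := 1) (t₁ := t₁ i) ?_ ?_ ?_
    · rw [hγC i]; exact h4 i hi _ (hγmem i _) (hd1 i)
    · exact (γ i).target
    · exact mem_uIcc.2 (Or.inr ⟨h', τ.2.2⟩)

end Redraw

/-! ### Generic polygonal lines and their crossings -/

/-- The inner nodes of a polygonal line avoid all lines spanned by `A`, and the polygonal line
avoids `A` except for its end points. -/
def IsGenericPoly (A : Set Plane) (p : ℕ → Plane) (n : ℕ) : Prop :=
  2 ≤ n ∧ (∀ k, 0 < k → k < n → ∀ a ∈ A, ∀ b ∈ A, a ≠ b → area a b (p k) ≠ 0) ∧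
    ∀ k < n, ∀ a ∈ A, a ∈ segment ℝ (p k) (p (k + 1)) → a = p 0 ∨ a = p n

theorem IsRoute.polySet_subset {U D : Set Plane} {p : ℕ → Plane} {n : ℕ} (hp : IsRoute U D p n) :
    polySet p n ⊆ U ∪ {p 0, p n} := by
  have hnode : ∀ i ≤ n, p i ∈ U ∪ {p 0, p n} := by
    intro i hi
    rcases Nat.eq_zero_or_pos i with rfl | h0
    · simp
    rcases hi.lt_or_eq with h | rfl
    · exact Or.inl (hp.1 i h0 h).2
    · simp
  rintro z ⟨i, hi, hz⟩
  rcases eq_or_ne z (p i) with rfl | h1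
  · exact hnode i hi.le
  rcases eq_or_ne z (p (i + 1)) with rfl | h2
  · exact hnode (i + 1) hi
  exact Or.inl (hp.2 i hi (mem_openSegment_of_ne_left_right h1.symm h2.symm hz))

theorem IsRoute.isGenericPoly {A U D : Set Plane} (hAD : InGeneralPosition A D) {p : ℕ → Plane}
    {n : ℕ} (hn : 2 ≤ n) (hp : IsRoute U D p n) (hs : IsSimplePoly p n) (h0 : p 0 ∈ A)
    (h1 : p n ∈ A) : IsGenericPoly A p n := by
  have hnA : ∀ k, 0 < k → k < n → p k ∉ A := fun k hk hk' h =>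
    disjoint_left.1 hAD.1 h (hp.1 k hk hk').1
  refine ⟨hn, fun k hk hk' a ha b hb hab => ?_, fun k hk a ha haz => ?_⟩
  · have hkD := (hp.1 k hk hk').1
    refine hAD.2 a (Or.inl ha) b (Or.inl hb) _ hkD hab ?_ ?_
    · rintro rfl; exact hnA k hk hk' hb
    · rintro rfl; exact hnA k hk hk' ha
  · have hkA : p k ∈ A ∪ D := by
      rcases Nat.eq_zero_or_pos k with rfl | hk0
      · exact Or.inl h0
      · exact Or.inr (hp.1 k hk0 hk).1
    have hkA' : p (k + 1) ∈ A ∪ D := by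
      rcases (Nat.succ_le_of_lt hk).lt_or_eq with hk' | hk'
      · exact Or.inr (hp.1 (k + 1) (by omega) hk').1
      · exact Or.inl (by rw [show k + 1 = n from hk']; exact h1)
    by_cases e1 : a = p k
    · rcases Nat.eq_zero_or_pos k with rfl | hk0
      · exact Or.inl e1
      · exact absurd (e1 ▸ ha) (hnA k hk0 hk)
    by_cases e2 : a = p (k + 1)
    · rcases (Nat.succ_le_of_lt hk).lt_or_eq with hk' | hk'
      · exact absurd (e2 ▸ ha) (hnA (k + 1) (by omega) hk')
      · exact Or.inr (by rw [e2, show k + 1 = n from hk'])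
    -- A point of `A` inside a side would be collinear with its two nodes. One of these lies in `D`,
    -- since `2 ≤ n`, so general position excludes this.
    exfalso
    have harea := area_eq_zero_of_mem_segment haz
    rcases Nat.eq_zero_or_pos k with rfl | hk0
    · rw [area_rotate, area_rotate] at harea
      exact hAD.2 a (Or.inl ha) (p 0) hkA (p (0 + 1)) (hp.1 (0 + 1) (by omega) (by omega)).1
        e1 (hs.1 0 hk) e2 harea
    · rw [area_rotate] at harea
      exact hAD.2 (p (k + 1)) hkA' a (Or.inl ha) (p k) (hp.1 k hk0 hk).1
        (Ne.symm e2) e1 (hs.1 k hk).symm harea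

/-- A plane drawing can be redrawn with polygonal edges in general position with respect to a
finite set, without changing a given set of polygonal edges. -/
theorem IsPlaneSystem.redraw {V ι : Type*} [Finite V] [Finite ι] {x : V → Plane}
    (hx : Function.Injective x) {s t : ι → V} (hst : ∀ i, s i ≠ t i) {C : ι → Set Plane}
    (hC : IsPlaneSystem x s t C) (F : Set ι)
    (hF : ∀ i ∈ F, IsPolyArc (x (s i)) (x (t i)) (C i)) {A : Set Plane} (hA : A.Finite)
    (hxA : range x ⊆ A) :
    ∃ (p : ι → ℕ → Plane) (n : ι → ℕ),
      (∀ i, 0 < n i ∧ IsSimplePoly (p i) (n i) ∧ p i 0 = x (s i) ∧ p i (n i) = x (t i)) ∧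
      IsPlaneSystem x s t (fun i => polySet (p i) (n i)) ∧
      (∀ i ∈ F, polySet (p i) (n i) = C i) ∧ ∀ i ∉ F, IsGenericPoly A (p i) (n i) := by
  obtain ⟨U, u1, u2, u3, u4, u5, u6, u7⟩ := hC.exists_tubes hx hst F hF
  obtain ⟨D, hD, hAD⟩ := exists_dense_inGeneralPosition hA
  -- Every new edge stays in its own tube, so disjointness of the tubes keeps the drawing plane,
  -- whatever routes are chosen.
  have key : ∀ i, ∃ (p : ℕ → Plane) (n : ℕ), (0 < n ∧ IsSimplePoly p n ∧ p 0 = x (s i) ∧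
      p n = x (t i)) ∧ polySet p n ⊆ U i ∪ {x (s i), x (t i)} ∧ (i ∈ F → polySet p n = C i) ∧
      (i ∉ F → IsGenericPoly A p n) := by
    intro i
    by_cases hi : i ∈ F
    · obtain ⟨p, n, hn, hp, h0, h1, h2⟩ := hF i hi
      exact ⟨p, n, ⟨hn, hp, h0, h1⟩, h2 ▸ u7 i hi, fun _ => h2, fun h => absurd hi h⟩
    · obtain ⟨p, n, hn, h0, h1, hp, hs⟩ := exists_simple_route (u1 i) (u2 i) hD hAD
        (hxA (mem_range_self (s i))) (hxA (mem_range_self (t i))) (fun h => hst i (hx h))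
        (u4 i _) (u4 i _) (u5 i false) (u5 i true) (u6 i false) (u6 i true)
      refine ⟨p, n, ⟨by omega, hs, h0, h1⟩, ?_, fun h => absurd h hi, fun _ => ?_⟩
      · rw [← h0, ← h1]; exact hp.polySet_subset
      · exact hp.isGenericPoly hAD hn hs (h0 ▸ hxA (mem_range_self _))
          (h1 ▸ hxA (mem_range_self _))
  choose p n h1 h2 h3 h4 using key
  refine ⟨p, n, h1, ⟨fun i => ?_, fun i w hw => ?_, fun i j hij z hz hz' => ?_⟩, h3, h4⟩
  · exact IsPolyArc.isSimpleArc ⟨p i, n i, (h1 i).1, (h1 i).2.1, (h1 i).2.2.1, (h1 i).2.2.2, rfl⟩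
  · rcases h2 i hw with h | h | h
    · exact absurd h (u4 i w)
    · exact Or.inl (hx h)
    · exact Or.inr (hx h)
  · rcases h2 i hz with h | h | h
    · rcases h2 j hz' with h' | h' | h'
      · exact absurd h' (disjoint_left.1 (u3 i j hij) h)
      · exact ⟨_, h'.symm⟩
      · exact ⟨_, h'.symm⟩
    · exact ⟨_, h.symm⟩
    · exact ⟨_, h.symm⟩

theorem IsPlaneSystem.image {V ι : Type*} {x : V → Plane} {s t : ι → V} {C : ι → Set Plane}
    (hC : IsPlaneSystem x s t C) (F : Plane ≃ₜ Plane) :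
    IsPlaneSystem (fun v => F (x v)) s t (fun i => F '' C i) := by
  refine ⟨fun i => (hC.arc i).image F, ?_, ?_⟩
  · rintro i w ⟨z, hz, hzw⟩
    exact hC.vert i w (F.injective hzw ▸ hz)
  · rintro i j hij _ ⟨z, hz, rfl⟩ ⟨z', hz', he⟩
    obtain ⟨v, rfl⟩ := hC.inter i j hij z hz (F.injective he ▸ hz')
    exact ⟨v, rfl⟩

/-- Near an inner point of a side, a simple polygonal line coincides with this side. -/
theorem IsSimplePoly.eventually_mem_segment {q : ℕ → Plane} {m k : ℕ} (hk : k < m)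
    (hq : IsSimplePoly q m) {z : Plane} (hz : z ∈ openSegment ℝ (q k) (q (k + 1))) :
    ∀ᶠ y in 𝓝 z, y ∈ polySet q m → y ∈ segment ℝ (q k) (q (k + 1)) := by
  have hev : ∀ᶠ y in 𝓝 z, ∀ i : Fin m, (i : ℕ) ≠ k → y ∉ segment ℝ (q i) (q (i + 1)) := by
    refine eventually_all.2 fun i => ?_
    by_cases hik : (i : ℕ) = k
    · simp [hik]
    · have hzi : z ∉ segment ℝ (q i) (q (i + 1)) := by
        intro hzi
        have hz' := openSegment_subset_segment _ _ _ hz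
        rcases lt_or_gt_of_ne hik with h | h
        · have := (hq.2 i k h hk z hzi hz').2
          rw [this, left_mem_openSegment_iff] at hz
          exact hq.1 k hk hz
        · obtain ⟨h1, h2⟩ := hq.2 k i h i.2 z hz' hzi
          rw [h2, h1, right_mem_openSegment_iff] at hz
          exact hq.1 k hk hz
      filter_upwards [(isCompact_segment _ _).isClosed.isOpen_compl.mem_nhds hzi] with y hy _
      exact hy
  filter_upwards [hev] with y hy
  rintro ⟨i, hi, hyi⟩
  by_contra hyk
  exact hy ⟨i, hi⟩ (by rintro rfl; exact hyk hyi) hyi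

theorem CrossProperlyAt.symm {S T : Set Plane} {z : Plane} (h : CrossProperlyAt S T z) :
    CrossProperlyAt T S z := by
  obtain ⟨φ, hz, h0, h⟩ := h
  let e : Plane ≃ₜ Plane :=
    (LinearIsometryEquiv.piLpCongrLeft 2 ℝ ℝ (Equiv.swap (0 : Fin 2) 1)).toHomeomorph
  have he0 : ∀ v : Plane, e v 0 = v 1 := fun v => by
    simp [e, LinearIsometryEquiv.piLpCongrLeft_apply, Equiv.piCongrLeft']
  have he1 : ∀ v : Plane, e v 1 = v 0 := fun v => by
    simp [e, LinearIsometryEquiv.piLpCongrLeft_apply, Equiv.piCongrLeft']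
  refine ⟨φ.trans e.toOpenPartialHomeomorph, by simpa using hz, ?_, fun q hq => ?_⟩
  · have : e 0 = 0 := plane_ext_iff.2 ⟨by rw [he0]; rfl, by rw [he1]; rfl⟩
    simpa [h0] using this
  · have hq' : q ∈ φ.source := by simpa using hq
    simp only [OpenPartialHomeomorph.coe_trans, Function.comp_apply,
      Homeomorph.toOpenPartialHomeomorph_apply, he0, he1]
    exact ⟨(h q hq').2, (h q hq').1⟩

/-- The area is an affine function along the segment; not vanishing at `c`, it has at most one zero.
-/
theorem eq_of_mem_segment_of_area_eq_zero {a b c d z z' : Plane} (h : area a b c ≠ 0)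
    (hz : z ∈ segment ℝ c d) (hz' : z' ∈ segment ℝ c d) (h0 : area a b z = 0)
    (h0' : area a b z' = 0) : z = z' := by
  rw [segment_eq_image'] at hz hz'
  obtain ⟨σ, -, rfl⟩ := hz
  obtain ⟨τ, -, rfl⟩ := hz'
  have hlin : ∀ σ : ℝ, area a b (c + σ • (d - c))
      = area a b c + σ * (area a b d - area a b c) := by
    intro σ
    simp only [area, PiLp.add_apply, PiLp.smul_apply, PiLp.sub_apply, smul_eq_mul]; ring
  simp only [hlin] at h0 h0'
  have h1 : area a b d - area a b c ≠ 0 := by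
    intro h1
    rw [h1] at h0
    apply h; linarith
  have h2 : (σ - τ) * (area a b d - area a b c) = 0 := by linarith
  rw [sub_eq_zero.1 ((mul_eq_zero.1 h2).resolve_right h1)]

/-- As `2 ≤ n`, every side has an inner node among its two ends. -/
theorem IsGenericPoly.exists_area_ne_zero {A : Set Plane} {p : ℕ → Plane} {n : ℕ}
    (hp : IsGenericPoly A p n) {k : ℕ} (hk : k < n) {a b : Plane} (ha : a ∈ A) (hb : b ∈ A)
    (hab : a ≠ b) : area a b (p k) ≠ 0 ∨ area a b (p (k + 1)) ≠ 0 := by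
  rcases Nat.eq_zero_or_pos k with rfl | hk0
  · exact Or.inr (hp.2.1 _ (by omega) (by have := hp.1; omega) a ha b hb hab)
  · exact Or.inl (hp.2.1 k hk0 hk a ha b hb hab)

theorem IsGenericPoly.finite_inter {A : Set Plane} {p q : ℕ → Plane} {n m : ℕ}
    (hp : IsGenericPoly A p n) (hq : IsSimplePoly q m) (hqA : ∀ l ≤ m, q l ∈ A) :
    (polySet p n ∩ polySet q m).Finite := by
  have : polySet p n ∩ polySet q m ⊆ ⋃ k ∈ Iio n, ⋃ l ∈ Iio m,
      segment ℝ (p k) (p (k + 1)) ∩ segment ℝ (q l) (q (l + 1)) := by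
    rintro z ⟨⟨k, hk, hz⟩, ⟨l, hl, hz'⟩⟩
    simp only [mem_iUnion]
    exact ⟨k, hk, l, hl, hz, hz'⟩
  refine ((finite_Iio n).biUnion fun k hk => (finite_Iio m).biUnion fun l hl => ?_).subset this
  refine Set.Subsingleton.finite fun z hz z' hz' => ?_
  have h1 := area_eq_zero_of_mem_segment hz.2
  have h2 := area_eq_zero_of_mem_segment hz'.2
  rcases hp.exists_area_ne_zero hk (hqA l (le_of_lt hl)) (hqA (l + 1) hl) (hq.1 l hl) with h | h
  · exact eq_of_mem_segment_of_area_eq_zero h hz.1 hz'.1 h1 h2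
  · exact eq_of_mem_segment_of_area_eq_zero h (segment_symm ℝ (p k) _ ▸ hz.1)
      (segment_symm ℝ (p k) _ ▸ hz'.1) h1 h2

/-- The functionals `f` and `g` are coordinates in the basis `d`, `b - a`. Near an inner point, a
segment looks like its line: the parameter `τ + g (y - z)` stays between `0` and `1`. -/
theorem eventually_mem_segment_iff {a b d z : Plane} (hz : z ∈ openSegment ℝ a b)
    {f g : Plane →L[ℝ] ℝ} (hf : f (b - a) = 0) (hg : ∀ w, w = f w • d + g w • (b - a)) :
    ∀ᶠ y in 𝓝 z, y ∈ segment ℝ a b ↔ f (y - z) = 0 := by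
  rw [openSegment_eq_image_Ioo] at hz
  obtain ⟨τ, hτ, rfl⟩ := hz
  set z := a + τ • (b - a)
  have hc : Tendsto (fun y : Plane => τ + g (y - z)) (𝓝 z) (𝓝 τ) := by
    have : Continuous fun y : Plane => τ + g (y - z) := by fun_prop
    simpa using this.tendsto z
  filter_upwards [hc.eventually (isOpen_Ioo.mem_nhds hτ)] with y hy
  constructor
  · intro h
    rw [segment_eq_image'] at h
    obtain ⟨σ, -, rfl⟩ := h
    rw [show a + σ • (b - a) - z = (σ - τ) • (b - a) by simp only [z, sub_smul]; abel, map_smul,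
      hf, smul_zero]
  · intro h
    have h1 := hg (y - z)
    rw [h, zero_smul, zero_add] at h1
    rw [segment_eq_image']
    refine ⟨τ + g (y - z), Ioo_subset_Icc_self hy, ?_⟩
    simp only [add_smul]
    rw [← h1]
    simp only [z]; abel

/-- Two crossing segments with different directions cross properly, also if further points are
added to them away from the crossing. -/
theorem crossProperlyAt_of_segments {a b c d z : Plane} {S T : Set Plane}
    (hz : z ∈ openSegment ℝ a b) (hz' : z ∈ openSegment ℝ c d)
    (hdet : (d - c) 0 * (b - a) 1 - (d - c) 1 * (b - a) 0 ≠ 0)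
    (hS : ∀ᶠ y in 𝓝 z, y ∈ S ↔ y ∈ segment ℝ a b) (hT : ∀ᶠ y in 𝓝 z, y ∈ T ↔ y ∈ segment ℝ c d) :
    CrossProperlyAt S T z := by
  -- The chart consists of the coordinates with respect to the two directions, centred at `z` and
  -- restricted to a ball where both sets coincide with the segments.
  obtain ⟨f, hf1, hf2⟩ := exists_functional _ _ hdet 1 0
  obtain ⟨g, hg1, hg2⟩ := exists_functional _ _ hdet 0 1
  have hdec : ∀ w, w = f w • (d - c) + g w • (b - a) := by
    intro w
    set D := (d - c) 0 * (b - a) 1 - (d - c) 1 * (b - a) 0 with hD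
    have hw : w = ((w 0 * (b - a) 1 - w 1 * (b - a) 0) / D) • (d - c) +
        (((d - c) 0 * w 1 - (d - c) 1 * w 0) / D) • (b - a) := by
      refine plane_ext_iff.2 ⟨?_, ?_⟩
      · simp only [PiLp.add_apply, PiLp.smul_apply, smul_eq_mul]
        rw [div_mul_eq_mul_div, div_mul_eq_mul_div, ← add_div, eq_div_iff hdet, hD]
        ring
      · simp only [PiLp.add_apply, PiLp.smul_apply, smul_eq_mul]
        rw [div_mul_eq_mul_div, div_mul_eq_mul_div, ← add_div, eq_div_iff hdet, hD]
        ring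
    have e1 : f w = (w 0 * (b - a) 1 - w 1 * (b - a) 0) / D := by
      rw [congrArg f hw, map_add, map_smul, map_smul, hf1, hf2]; simp
    have e2 : g w = ((d - c) 0 * w 1 - (d - c) 1 * w 0) / D := by
      rw [congrArg g hw, map_add, map_smul, map_smul, hg1, hg2]; simp
    rw [e1, e2]
    exact hw
  let e : Plane ≃ₜ Plane :=
    { toFun := fun y => !₂[f (y - z), g (y - z)]
      invFun := fun v => z + (v 0 • (d - c) + v 1 • (b - a))
      left_inv := fun y => by
        change z + (f (y - z) • (d - c) + g (y - z) • (b - a)) = y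
        rw [← hdec]; abel
      right_inv := fun v => by
        refine plane_ext_iff.2 ⟨?_, ?_⟩
        · change f (z + (v 0 • (d - c) + v 1 • (b - a)) - z) = v 0
          rw [add_sub_cancel_left, map_add, map_smul, map_smul, hf1, hf2]; simp
        · change g (z + (v 0 • (d - c) + v 1 • (b - a)) - z) = v 1
          rw [add_sub_cancel_left, map_add, map_smul, map_smul, hg1, hg2]; simp
      continuous_toFun := by fun_prop
      continuous_invFun := by fun_prop }
  have he0 : ∀ y, e y 0 = f (y - z) := fun y => rfl
  have he1 : ∀ y, e y 1 = g (y - z) := fun y => rfl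
  have hev : ∀ᶠ y in 𝓝 z, (y ∈ S ↔ e y 0 = 0) ∧ (y ∈ T ↔ e y 1 = 0) := by
    filter_upwards [hS, hT, eventually_mem_segment_iff hz hf2 hdec,
      eventually_mem_segment_iff hz' (f := g) (g := f) (d := b - a) hg1
        (fun w => by rw [add_comm]; exact hdec w)] with y h1 h2 h3 h4
    exact ⟨h1.trans h3, h2.trans h4⟩
  obtain ⟨ε, hε, hball⟩ := Metric.eventually_nhds_iff_ball.1 hev
  refine ⟨e.toOpenPartialHomeomorph.restrOpen (ball z ε) isOpen_ball, ?_, ?_, fun y hy => ?_⟩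
  · simpa using hε
  · refine plane_ext_iff.2 ⟨?_, ?_⟩
    · change f (z - z) = 0; simp
    · change g (z - z) = 0; simp
  · have hy' : y ∈ ball z ε := by simpa using hy
    exact hball y hy'

/-- The point is interior to a side of each line: inner nodes of `p` avoid the lines spanned by `A`,
and `p` avoids the nodes of `q`, which lie in `A`, except at its ends. The two sides are not
parallel, for otherwise the side of `p` would lie on the line of the side of `q`, nodes included. -/
theorem IsGenericPoly.crossProperlyAt {A : Set Plane} {p q : ℕ → Plane} {n m : ℕ}
    (hp : IsGenericPoly A p n) (hps : IsSimplePoly p n) (hq : IsSimplePoly q m)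
    (hqA : ∀ l ≤ m, q l ∈ A) {z : Plane} (hz : z ∈ polySet p n) (hz' : z ∈ polySet q m)
    (h0 : z ≠ p 0) (h1 : z ≠ p n) : CrossProperlyAt (polySet p n) (polySet q m) z := by
  obtain ⟨k, hk, hzk⟩ := hz
  obtain ⟨l, hl, hzl⟩ := hz'
  have hl0 := hqA l hl.le
  have hl1 := hqA (l + 1) hl
  have hne := hq.1 l hl
  have harea := area_eq_zero_of_mem_segment hzl
  have hnode : ∀ i ≤ n, z ≠ p i := by
    rintro i hi rfl
    rcases Nat.eq_zero_or_pos i with rfl | hi0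
    · exact h0 rfl
    rcases hi.lt_or_eq with hi | rfl
    · exact hp.2.1 i hi0 hi _ hl0 _ hl1 hne harea
    · exact h1 rfl
  have hzA : ∀ a ∈ A, z ≠ a := by
    rintro a ha rfl
    rcases hp.2.2 k hk z ha hzk with h | h
    · exact h0 h
    · exact h1 h
  have ho : z ∈ openSegment ℝ (p k) (p (k + 1)) :=
    mem_openSegment_of_ne_left_right (hnode k hk.le).symm (hnode (k + 1) hk).symm hzk
  have ho' : z ∈ openSegment ℝ (q l) (q (l + 1)) :=
    mem_openSegment_of_ne_left_right (hzA _ hl0).symm (hzA _ hl1).symm hzl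
  refine crossProperlyAt_of_segments ho ho' ?_ ?_ ?_
  · intro hdet
    have hlin : area (q l) (q (l + 1)) (p (k + 1)) = area (q l) (q (l + 1)) (p k) := by
      have : area (q l) (q (l + 1)) (p (k + 1)) - area (q l) (q (l + 1)) (p k) =
          (q (l + 1) - q l) 0 * (p (k + 1) - p k) 1 - (q (l + 1) - q l) 1 * (p (k + 1) - p k) 0 := by
        simp only [area, PiLp.sub_apply]; ring
      linarith
    have h3 : area (q l) (q (l + 1)) z = area (q l) (q (l + 1)) (p k) := by
      rw [segment_eq_image'] at hzk
      obtain ⟨σ, -, rfl⟩ := hzk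
      have : area (q l) (q (l + 1)) (p k + σ • (p (k + 1) - p k)) - area (q l) (q (l + 1)) (p k) =
          σ * ((q (l + 1) - q l) 0 * (p (k + 1) - p k) 1 -
            (q (l + 1) - q l) 1 * (p (k + 1) - p k) 0) := by
        simp only [area, PiLp.add_apply, PiLp.smul_apply, PiLp.sub_apply, smul_eq_mul]; ring
      rw [hdet, mul_zero] at this
      linarith
    rcases hp.exists_area_ne_zero hk hl0 hl1 hne with h | h
    · exact h (h3 ▸ harea)
    · exact h (hlin ▸ h3 ▸ harea)
  · filter_upwards [hps.eventually_mem_segment hk ho] with y hy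
    exact ⟨hy, fun h => ⟨k, hk, h⟩⟩
  · filter_upwards [hq.eventually_mem_segment hl ho'] with y hy
    exact ⟨hy, fun h => ⟨l, hl, h⟩⟩

/-! ### Splitting a linear forest into two matchings -/

section Colouring

variable {V : Type*}

/-- Used to see that after deletion of `e` at most one edge is left at each end of `e`. -/
theorem eq_of_mem_of_encard_le_two {H : SimpleGraph V} {v : V}
    (hdeg : (H.neighborSet v).encard ≤ 2) {e f g : Sym2 V} (he : e ∈ H.edgeSet)
    (hf : f ∈ H.edgeSet) (hg : g ∈ H.edgeSet) (hve : v ∈ e) (hvf : v ∈ f) (hvg : v ∈ g)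
    (hef : e ≠ f) (heg : e ≠ g) : f = g := by
  obtain ⟨a, rfl⟩ := hve
  obtain ⟨b, rfl⟩ := hvf
  obtain ⟨c, rfl⟩ := hvg
  by_contra hfg
  have hsub : ({a, b, c} : Set V) ⊆ H.neighborSet v := by
    rintro w (rfl | rfl | rfl)
    · exact he
    · exact hf
    · exact hg
  have h3 : ({a, b, c} : Set V).encard = 3 := by
    rw [encard_eq_three]
    exact ⟨a, b, c, fun h => hef (h ▸ rfl), fun h => heg (h ▸ rfl), fun h => hfg (h ▸ rfl), rfl⟩
  have := (encard_le_encard hsub).trans hdeg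
  rw [h3] at this
  exact absurd this (by decide)

/-- The edges of a finite forest of paths can be coloured properly with two colours. -/
theorem SimpleGraph.IsAcyclic.exists_edge_colouring [Finite V] (H : SimpleGraph V) :
    H.IsAcyclic → (∀ v, (H.neighborSet v).encard ≤ 2) →
      ∃ c : Sym2 V → Bool, ∀ e ∈ H.edgeSet, ∀ f ∈ H.edgeSet, e ≠ f → ∀ v ∈ e, v ∈ f → c e ≠ c f := by
  classical
  induction H using WellFoundedLT.induction with
  | ind H ih =>
  intro hac hdeg
  by_cases hE : H.edgeSet = ∅
  · exact ⟨fun _ => true, by simp [hE]⟩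
  obtain ⟨e, he⟩ := nonempty_iff_ne_empty.2 hE
  induction e using Sym2.ind with
  | _ u v =>
  set H' := H.deleteEdges {s(u, v)} with hH'
  have hmem : ∀ f, f ∈ H'.edgeSet ↔ f ∈ H.edgeSet ∧ f ≠ s(u, v) := by
    intro f; simp [hH', SimpleGraph.edgeSet_deleteEdges]
  have hle : H' ≤ H := SimpleGraph.deleteEdges_le _
  have hlt : H' < H := by
    refine lt_of_le_of_ne hle fun h => ?_
    have := (hmem s(u, v)).1 (h ▸ he)
    exact this.2 rfl
  obtain ⟨c, hc⟩ := ih H' hlt (hac.anti hle)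
    (fun w => (encard_le_encard fun z hz => hle hz).trans (hdeg w))
  have hbr : ¬ H'.Reachable u v := by
    have := SimpleGraph.isAcyclic_iff_forall_isBridge.1 hac he
    exact (SimpleGraph.isBridge_iff.1 this)
  -- At most one edge remains at each end of the deleted edge, so one of the two colours is free
  -- there.
  have hfree : ∀ w ∈ s(u, v), ∃ k : Bool, ∀ f ∈ H'.edgeSet, w ∈ f → c f ≠ k := by
    intro w hw
    by_cases hex : ∃ f ∈ H'.edgeSet, w ∈ f
    · obtain ⟨f, hf, hwf⟩ := hex
      refine ⟨!c f, fun g hg hwg => ?_⟩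
      have : f = g := eq_of_mem_of_encard_le_two (hdeg w) he ((hmem f).1 hf).1 ((hmem g).1 hg).1 hw hwf
        hwg ((hmem f).1 hf).2.symm ((hmem g).1 hg).2.symm
      rw [this]; cases c g <;> simp
    · push Not at hex
      exact ⟨true, fun f hf hwf => absurd hwf (hex f hf)⟩
  obtain ⟨ku, hku⟩ := hfree u (Sym2.mem_mk_left u v)
  obtain ⟨kv, hkv⟩ := hfree v (Sym2.mem_mk_right u v)
  have hall : ∀ f ∈ H'.edgeSet, ∀ w ∈ f, ∀ w' ∈ f, H'.Reachable u w → H'.Reachable u w' := by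
    intro f hf w hw w' hw' hr
    induction f using Sym2.ind with
    | _ a b =>
    have hab : H'.Adj a b := hf
    rcases Sym2.mem_iff.1 hw with rfl | rfl <;> rcases Sym2.mem_iff.1 hw' with rfl | rfl
    · exact hr
    · exact hr.trans hab.reachable
    · exact hr.trans hab.symm.reachable
    · exact hr
  let K : Sym2 V → Prop := fun f => ∃ w ∈ f, H'.Reachable u w
  have hK : ∀ f ∈ H'.edgeSet, ∀ w ∈ f, K f ↔ H'.Reachable u w := fun f hf w hw =>
    ⟨fun ⟨w', hw', hr⟩ => hall f hf w' hw' w hw hr, fun hr => ⟨w, hw, hr⟩⟩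
  -- If the free colours `ku` and `kv` differ, the two colours are exchanged on the component of
  -- `u`, which makes `kv` free at `u`. The deleted edge is a bridge, so the edges at `v` keep their
  -- colours and `kv` stays free there.
  let c' : Sym2 V → Bool := fun f => if f = s(u, v) then kv else
    if K f then (c f ^^ (ku ^^ kv)) else c f
  have hce : ∀ f ∈ H'.edgeSet, ∀ w ∈ s(u, v), w ∈ f → c' f ≠ c' s(u, v) := by
    intro f hf w hw hwf
    have e1 : c' s(u, v) = kv := if_pos rfl
    have e2 : c' f = if K f then (c f ^^ (ku ^^ kv)) else c f := if_neg ((hmem f).1 hf).2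
    rw [e1, e2]
    rcases Sym2.mem_iff.1 hw with rfl | rfl
    · rw [if_pos ((hK f hf w hwf).2 (SimpleGraph.Reachable.refl _))]
      have := hku f hf hwf
      revert this
      cases c f <;> cases ku <;> cases kv <;> simp
    · rw [if_neg fun h => hbr ((hK f hf w hwf).1 h)]
      exact hkv f hf hwf
  refine ⟨c', fun f hf g hg hfg w hwf hwg => ?_⟩
  by_cases hfe : f = s(u, v)
  · subst hfe
    exact (hce g ((hmem g).2 ⟨hg, hfg.symm⟩) w hwf hwg).symm
  by_cases hge : g = s(u, v)
  · subst hge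
    exact hce f ((hmem f).2 ⟨hf, hfg⟩) w hwg hwf
  have hf' := (hmem f).2 ⟨hf, hfe⟩
  have hg' := (hmem g).2 ⟨hg, hge⟩
  have hcc := hc f hf' g hg' hfg w hwf hwg
  have e1 : c' f = if K f then (c f ^^ (ku ^^ kv)) else c f := if_neg hfe
  have e2 : c' g = if K g then (c g ^^ (ku ^^ kv)) else c g := if_neg hge
  have e3 : K f ↔ K g := (hK f hf' w hwf).trans (hK g hg' w hwg).symm
  rw [e1, e2]
  by_cases hKf : K f
  · rw [if_pos hKf, if_pos (e3.1 hKf)]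
    simpa using hcc
  · rw [if_neg hKf, if_neg fun h => hKf (e3.2 h)]
    exact hcc

end Colouring

/-! ### From plane classes to quasiplanar drawings -/

section Assembly

variable {V : Type*}

/-- The first vertex of an edge, in a chosen orientation. -/
noncomputable def edgeSrc (e : Sym2 V) : V := (Quot.out e).1

/-- The second vertex of an edge, in a chosen orientation. -/
noncomputable def edgeTgt (e : Sym2 V) : V := (Quot.out e).2

theorem mk_edgeSrc_edgeTgt (e : Sym2 V) : s(edgeSrc e, edgeTgt e) = e := Quot.out_eq e

theorem edgeSrc_mem (e : Sym2 V) : edgeSrc e ∈ e := by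
  have := Sym2.mem_mk_left (edgeSrc e) (edgeTgt e)
  rwa [mk_edgeSrc_edgeTgt] at this

theorem edgeTgt_mem (e : Sym2 V) : edgeTgt e ∈ e := by
  have := Sym2.mem_mk_right (edgeSrc e) (edgeTgt e)
  rwa [mk_edgeSrc_edgeTgt] at this

theorem mem_iff_edgeSrc_edgeTgt {e : Sym2 V} {w : V} : w ∈ e ↔ w = edgeSrc e ∨ w = edgeTgt e := by
  conv_lhs => rw [← mk_edgeSrc_edgeTgt e]
  exact Sym2.mem_iff

theorem edgeSrc_ne_edgeTgt {G : SimpleGraph V} {e : Sym2 V} (he : e ∈ G.edgeSet) :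
    edgeSrc e ≠ edgeTgt e := by
  rw [← mk_edgeSrc_edgeTgt e] at he
  exact SimpleGraph.Adj.ne he

/-- The polygonal lines `p e`, for `e ∈ 𝒜`, form a plane drawing. -/
structure IsPolySystem (𝒜 : Set (Sym2 V)) (x : V → Plane) (p : Sym2 V → ℕ → Plane)
    (n : Sym2 V → ℕ) : Prop where
  simple : ∀ e ∈ 𝒜, 0 < n e ∧ IsSimplePoly (p e) (n e) ∧ p e 0 = x (edgeSrc e) ∧
    p e (n e) = x (edgeTgt e)
  vert : ∀ e ∈ 𝒜, ∀ w, x w ∈ polySet (p e) (n e) → w ∈ e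
  inter : ∀ e ∈ 𝒜, ∀ f ∈ 𝒜, e ≠ f → ∀ z ∈ polySet (p e) (n e), z ∈ polySet (p f) (n f) →
    z ∈ range x

theorem IsPolySystem.congr {𝒜 : Set (Sym2 V)} {x : V → Plane} {p q : Sym2 V → ℕ → Plane}
    {n m : Sym2 V → ℕ} (h : IsPolySystem 𝒜 x p n) (hpq : ∀ e ∈ 𝒜, q e = p e ∧ m e = n e) :
    IsPolySystem 𝒜 x q m := by
  refine ⟨fun e he => ?_, fun e he => ?_, fun e he f hf => ?_⟩
  · rw [(hpq e he).1, (hpq e he).2]; exact h.simple e he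
  · rw [(hpq e he).1, (hpq e he).2]; exact h.vert e he
  · rw [(hpq e he).1, (hpq e he).2, (hpq f hf).1, (hpq f hf).2]; exact h.inter e he f hf

theorem IsPolySystem.isPolyArc {𝒜 : Set (Sym2 V)} {x : V → Plane} {p : Sym2 V → ℕ → Plane}
    {n : Sym2 V → ℕ} (h : IsPolySystem 𝒜 x p n) {e : Sym2 V} (he : e ∈ 𝒜) :
    IsPolyArc (x (edgeSrc e)) (x (edgeTgt e)) (polySet (p e) (n e)) :=
  ⟨p e, n e, (h.simple e he).1, (h.simple e he).2.1, (h.simple e he).2.2.1, (h.simple e he).2.2.2,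
    rfl⟩

theorem IsPolySystem.of_subtype {𝒜 : Set (Sym2 V)} {x : V → Plane} {p : 𝒜 → ℕ → Plane}
    {n : 𝒜 → ℕ} {q : Sym2 V → ℕ → Plane} {m : Sym2 V → ℕ}
    (h : IsPlaneSystem x (fun e : 𝒜 => edgeSrc e.1) (fun e : 𝒜 => edgeTgt e.1)
      (fun e => polySet (p e) (n e)))
    (h' : ∀ e : 𝒜, 0 < n e ∧ IsSimplePoly (p e) (n e) ∧ p e 0 = x (edgeSrc e.1) ∧
      p e (n e) = x (edgeTgt e.1)) (hq : ∀ e : 𝒜, q e = p e ∧ m e = n e) :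
    IsPolySystem 𝒜 x q m := by
  refine ⟨fun e he => ?_, fun e he w => ?_, fun e he f hf hef z => ?_⟩
  · rw [(hq ⟨e, he⟩).1, (hq ⟨e, he⟩).2]; exact h' ⟨e, he⟩
  · rw [(hq ⟨e, he⟩).1, (hq ⟨e, he⟩).2]
    exact fun hw => mem_iff_edgeSrc_edgeTgt.2 (h.vert ⟨e, he⟩ w hw)
  · rw [(hq ⟨e, he⟩).1, (hq ⟨e, he⟩).2, (hq ⟨f, hf⟩).1, (hq ⟨f, hf⟩).2]
    exact h.inter ⟨e, he⟩ ⟨f, hf⟩ (fun h => hef (congrArg Subtype.val h)) z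

theorem exists_extend_subtype {𝒜 : Set (Sym2 V)} (p : 𝒜 → ℕ → Plane) (n : 𝒜 → ℕ) :
    ∃ (q : Sym2 V → ℕ → Plane) (m : Sym2 V → ℕ), ∀ e : 𝒜, q e = p e ∧ m e = n e := by
  classical
  exact ⟨fun e => if h : e ∈ 𝒜 then p ⟨e, h⟩ else fun _ => 0,
    fun e => if h : e ∈ 𝒜 then n ⟨e, h⟩ else 0, fun e => ⟨dif_pos e.2, dif_pos e.2⟩⟩

/-- Planar graphs have polygonal plane drawings. -/
theorem IsPlanarGraph.exists_isPolySystem [Finite V] {G : SimpleGraph V} (hG : IsPlanarGraph G)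
    {𝒜 : Set (Sym2 V)} (h𝒜 : 𝒜 ⊆ G.edgeSet) :
    ∃ (x : V → Plane) (p : Sym2 V → ℕ → Plane) (n : Sym2 V → ℕ), Function.Injective x ∧
      IsPolySystem 𝒜 x p n := by
  obtain ⟨Γ, hΓ⟩ := hG
  have hsys : IsPlaneSystem Γ.pos (fun e : 𝒜 => edgeSrc e.1) (fun e : 𝒜 => edgeTgt e.1)
      (fun e => Γ.curve ⟨e.1, h𝒜 e.2⟩) := by
    refine ⟨fun e => ?_, fun e w hw => ?_, fun e f hef z hz hz' => ?_⟩
    · have hadj : G.Adj (edgeSrc e.1) (edgeTgt e.1) := by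
        rw [← SimpleGraph.mem_edgeSet, mk_edgeSrc_edgeTgt]; exact h𝒜 e.2
      have := Γ.curve_isSimpleArc _ _ hadj
      simpa only [mk_edgeSrc_edgeTgt] using this
    · exact mem_iff_edgeSrc_edgeTgt.1 (Γ.mem_of_pos_mem_curve _ w hw)
    · by_contra hzr
      exact hΓ ⟨e.1, h𝒜 e.2⟩ ⟨f.1, h𝒜 f.2⟩
        ⟨fun h => hef (Subtype.ext (Subtype.mk.inj h)), z, ⟨hz, hz'⟩, hzr⟩
  obtain ⟨p, n, h1, h2, -⟩ := hsys.redraw Γ.pos_injective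
    (fun e => edgeSrc_ne_edgeTgt (h𝒜 e.2)) ∅ (by simp) (finite_range Γ.pos) Subset.rfl
  obtain ⟨q, m, hq⟩ := exists_extend_subtype p n
  exact ⟨Γ.pos, q, m, Γ.pos_injective, IsPolySystem.of_subtype h2 h1 hq⟩

/-- A planar graph has a polygonal plane drawing with prescribed vertices and with prescribed
polygonal curves for the edges of a matching. -/
theorem IsPlanarGraph.exists_isPolySystem_of_matching [Finite V] {G : SimpleGraph V}
    (hG : IsPlanarGraph G) {𝒜 ℬ M : Set (Sym2 V)} (h𝒜 : 𝒜 ⊆ G.edgeSet) (hM𝒜 : M ⊆ 𝒜) (hMℬ : M ⊆ ℬ)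
    (hM : ∀ e ∈ M, ∀ f ∈ M, e ≠ f → ∀ v ∈ e, v ∉ f) {x : V → Plane} (hx : Function.Injective x)
    {p₀ : Sym2 V → ℕ → Plane} {n₀ : Sym2 V → ℕ} (hℬ : IsPolySystem ℬ x p₀ n₀)
    {A : Set Plane} (hA : A.Finite) (hxA : range x ⊆ A) :
    ∃ (p : Sym2 V → ℕ → Plane) (n : Sym2 V → ℕ), IsPolySystem 𝒜 x p n ∧
      (∀ e ∈ M, p e = p₀ e ∧ n e = n₀ e) ∧ ∀ e ∈ 𝒜, e ∉ M → IsGenericPoly A (p e) (n e) := by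
  classical
  obtain ⟨y, q, m, hy, hq⟩ := hG.exists_isPolySystem h𝒜
  have hdisj : ∀ (ℰ : Set (Sym2 V)), M ⊆ ℰ → ∀ (y : V → Plane) q m, IsPolySystem ℰ y q m →
      ∀ e f : M, e ≠ f → Disjoint (polySet (q e) (m e)) (polySet (q f) (m f)) := by
    intro ℰ hMℰ y q m hq e f hef
    rw [disjoint_left]
    intro z hz hz'
    have hef' : (e : Sym2 V) ≠ f := fun h => hef (Subtype.ext h)
    obtain ⟨v, rfl⟩ := hq.inter e (hMℰ e.2) f (hMℰ f.2) hef' z hz hz'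
    exact hM e e.2 f f.2 hef' v (hq.vert e (hMℰ e.2) v hz) (hq.vert f (hMℰ f.2) v hz')
  -- The homeomorphism puts vertices and matching edges in place but may bend all other edges;
  -- `IsPlaneSystem.redraw` makes these polygonal again.
  obtain ⟨F, hF, hFc⟩ := exists_homeomorph_matching (J := M) x y hx hy (fun e => edgeSrc e.1)
    (fun e => edgeTgt e.1)
    (fun e f h => by
      by_cases hef : (e : Sym2 V) = f
      · rw [← hef] at h
        exact edgeSrc_ne_edgeTgt (h𝒜 (hM𝒜 e.2)) h
      · exact hM e e.2 f f.2 hef _ (edgeSrc_mem _) (h ▸ edgeTgt_mem _))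
    (fun e f h => by
      by_contra hef
      have h' : edgeSrc e.1 = edgeSrc f.1 := h
      exact hM e e.2 f f.2 (fun h => hef (Subtype.ext h)) _ (edgeSrc_mem _) (h' ▸ edgeSrc_mem _))
    (fun e => polySet (p₀ e) (n₀ e)) (fun e => polySet (q e) (m e))
    (fun e => hℬ.isPolyArc (hMℬ e.2)) (fun e => hq.isPolyArc (hM𝒜 e.2))
    (hdisj ℬ hMℬ x p₀ n₀ hℬ) (hdisj 𝒜 hM𝒜 y q m hq)
    (fun e w hw => mem_iff_edgeSrc_edgeTgt.1 (hℬ.vert e (hMℬ e.2) w hw))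
    (fun e w hw => mem_iff_edgeSrc_edgeTgt.1 (hq.vert e (hM𝒜 e.2) w hw))
  have hsys : IsPlaneSystem y (fun e : 𝒜 => edgeSrc e.1) (fun e : 𝒜 => edgeTgt e.1)
      (fun e => polySet (q e) (m e)) :=
    ⟨fun e => (hq.isPolyArc e.2).isSimpleArc,
      fun e w hw => mem_iff_edgeSrc_edgeTgt.1 (hq.vert e e.2 w hw),
      fun e f hef => hq.inter e e.2 f f.2 fun h => hef (Subtype.ext h)⟩
  have hsys' := hsys.image F
  simp only [hF] at hsys'
  obtain ⟨p, n, h1, h2, h3, h4⟩ := hsys'.redraw hx (fun e => edgeSrc_ne_edgeTgt (h𝒜 e.2))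
    {e | (e : Sym2 V) ∈ M}
    (fun e he => by
      have := hFc ⟨e, he⟩
      beta_reduce at this ⊢
      rw [this]
      exact hℬ.isPolyArc (hMℬ he)) hA hxA
  obtain ⟨p', n', hp'⟩ := exists_extend_subtype p n
  have h5 : IsPolySystem 𝒜 x p' n' := IsPolySystem.of_subtype h2 h1 hp'
  have h6 : ∀ e ∈ M, polySet (p' e) (n' e) = polySet (p₀ e) (n₀ e) := by
    intro e he
    have e1 := hp' ⟨e, hM𝒜 he⟩
    rw [e1.1, e1.2, h3 ⟨e, hM𝒜 he⟩ he]
    exact hFc ⟨e, he⟩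
  -- On `M` the node sequences themselves, and not only the point sets, are made equal to the
  -- prescribed ones; this does not change the curves.
  have h7 : ∀ e, polySet ((if e ∈ M then p₀ else p') e) ((if e ∈ M then n₀ else n') e)
      = polySet (p' e) (n' e) := by
    intro e
    split_ifs with he
    · exact (h6 e he).symm
    · rfl
  refine ⟨fun e => (if e ∈ M then p₀ else p') e, fun e => (if e ∈ M then n₀ else n') e,
    ⟨fun e he => ?_, fun e he => ?_, fun e he f hf => ?_⟩, fun e he => ?_, fun e he heM => ?_⟩
  · split_ifs with h
    · exact hℬ.simple e (hMℬ h)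
    · exact h5.simple e he
  · rw [h7]; exact h5.vert e he
  · rw [h7, h7]; exact h5.inter e he f hf
  · simp [he]
  · beta_reduce
    rw [if_neg heM, if_neg heM, (hp' ⟨e, he⟩).1, (hp' ⟨e, he⟩).2]
    exact h4 ⟨e, he⟩ heM

/-- A drawing whose edges are covered by two classes without crossings inside each class is
quasiplanar. -/
theorem exists_quasiplanar_drawing {G : SimpleGraph V} {x : V → Plane} (hx : Function.Injective x)
    (c : Sym2 V → Set Plane)
    (harc : ∀ e ∈ G.edgeSet, IsSimpleArc (x (edgeSrc e)) (x (edgeTgt e)) (c e))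
    (hvert : ∀ e ∈ G.edgeSet, ∀ w, x w ∈ c e → w ∈ e)
    (hfin : ∀ e ∈ G.edgeSet, ∀ f ∈ G.edgeSet, e ≠ f → (c e ∩ c f).Finite)
    (hcross : ∀ e ∈ G.edgeSet, ∀ f ∈ G.edgeSet, e ≠ f → ∀ z ∈ c e ∩ c f, z ∉ range x →
      CrossProperlyAt (c e) (c f) z)
    {𝒜 ℬ : Set (Sym2 V)} (hcov : G.edgeSet ⊆ 𝒜 ∪ ℬ)
    (h𝒜 : ∀ e ∈ 𝒜, ∀ f ∈ 𝒜, e ≠ f → ∀ z ∈ c e, z ∈ c f → z ∈ range x)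
    (hℬ : ∀ e ∈ ℬ, ∀ f ∈ ℬ, e ≠ f → ∀ z ∈ c e, z ∈ c f → z ∈ range x) :
    ∃ Γ : GraphDrawing G, Γ.IsQuasiplanar ∧ (∀ v, Γ.pos v = x v) ∧ ∀ e, Γ.curve e = c e := by
  let Γ : GraphDrawing G :=
    { pos := x
      curve := fun e => c e
      pos_injective := hx
      curve_isSimpleArc := fun u v h => by
        have h1 := harc s(u, v) h
        have h2 := mk_edgeSrc_edgeTgt s(u, v)
        rcases Sym2.eq_iff.1 h2 with ⟨h3, h4⟩ | ⟨h3, h4⟩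
        · rwa [h3, h4] at h1
        · rw [h3, h4] at h1
          exact h1.symm
      mem_of_pos_mem_curve := fun e w hw => hvert e e.2 w hw
      finite_inter := fun e f hef => hfin e e.2 f f.2 fun h => hef (Subtype.ext h)
      crossProperlyAt := fun e f hef => hcross e e.2 f f.2 fun h => hef (Subtype.ext h) }
  have hno : ∀ e f : G.edgeSet, (e : Sym2 V) ∈ 𝒜 ∧ (f : Sym2 V) ∈ 𝒜 ∨
      (e : Sym2 V) ∈ ℬ ∧ (f : Sym2 V) ∈ ℬ → ¬ Γ.Cross e f := by
    rintro e f h ⟨hef, z, ⟨hz, hz'⟩, hzr⟩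
    have hef' : (e : Sym2 V) ≠ f := fun h => hef (Subtype.ext h)
    rcases h with ⟨he, hf⟩ | ⟨he, hf⟩
    · exact hzr (h𝒜 e he f hf hef' z hz hz')
    · exact hzr (hℬ e he f hf hef' z hz hz')
  refine ⟨Γ, fun e f g h => ?_, fun v => rfl, fun e => rfl⟩
  -- Pigeonhole: two of the three edges belong to the same class, hence do not cross.
  have h1 := mt (hno e f) (not_not.2 h.1)
  have h2 := mt (hno e g) (not_not.2 h.2.1)
  have h3 := mt (hno f g) (not_not.2 h.2.2)
  have he := hcov e.2
  have hf := hcov f.2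
  have hg := hcov g.2
  simp only [mem_union] at he hf hg
  tauto

end Assembly

/-! ### The three classes and their common drawing -/

theorem corollary4 {V : Type*} [Finite V] (G₁ G₂ G₃ : SimpleGraph V)
    (h₁ : IsPlanarGraph G₁) (h₂ : IsPlanarGraph G₂) (h₃ : IsPlanarGraph G₃)
    (hacyclic : (G₁ ⊓ G₂ ⊓ G₃).IsAcyclic)
    (hdeg : ∀ v : V, ((G₁ ⊓ G₂ ⊓ G₃).neighborSet v).encard ≤ 2) :
    AdmitsQuaSEFE ![G₁, G₂, G₃] := by
  classical
  obtain ⟨k, hk⟩ := SimpleGraph.IsAcyclic.exists_edge_colouring _ hacyclic hdeg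
  have hH : ∀ e, e ∈ (G₁ ⊓ G₂ ⊓ G₃).edgeSet ↔
      (e ∈ G₁.edgeSet ∧ e ∈ G₂.edgeSet) ∧ e ∈ G₃.edgeSet := by
    intro e; simp [SimpleGraph.edgeSet_inf]
  set M : Bool → Set (Sym2 V) := fun b => {e | e ∈ (G₁ ⊓ G₂ ⊓ G₃).edgeSet ∧ k e = b} with hMdef
  have hMM : ∀ b, ∀ e ∈ M b, ∀ f ∈ M b, e ≠ f → ∀ v ∈ e, v ∉ f := by
    rintro b e ⟨he, he'⟩ f ⟨hf, hf'⟩ hef v hv hv'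
    exact hk e he f hf hef v hv hv' (he'.trans hf'.symm)
  -- Edges in exactly one graph go to its own class. Edges in exactly `G₁` and `G₂` go to `𝒜₁`, in
  -- exactly `G₂` and `G₃` to `𝒜₂`, in exactly `G₁` and `G₃` to `𝒜₃`. Edges of `H` go to `𝒜₂` and,
  -- according to their colour, also to `𝒜₁` or `𝒜₃`.
  set 𝒜₁ : Set (Sym2 V) := {e | e ∈ G₁.edgeSet ∧ (e ∉ G₃.edgeSet ∨ e ∈ M true)} with h𝒜₁
  set 𝒜₂ : Set (Sym2 V) := {e | e ∈ G₂.edgeSet ∧ (e ∉ G₁.edgeSet ∨ e ∈ G₃.edgeSet)} with h𝒜₂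
  set 𝒜₃ : Set (Sym2 V) := {e | e ∈ G₃.edgeSet ∧ (e ∉ G₂.edgeSet ∨ e ∈ M false)} with h𝒜₃
  have hM : ∀ b, ∀ e ∈ M b, e ∈ G₁.edgeSet ∧ e ∈ G₂.edgeSet ∧ e ∈ G₃.edgeSet := by
    rintro b e ⟨he, -⟩
    have := (hH e).1 he
    tauto
  have h12 : ∀ e, e ∈ 𝒜₁ → e ∈ 𝒜₂ → e ∈ M true := by
    rintro e ⟨h1, h2⟩ ⟨h3, h4⟩
    tauto
  have h32 : ∀ e, e ∈ 𝒜₃ → e ∈ 𝒜₂ → e ∈ M false := by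
    rintro e ⟨h1, h2⟩ ⟨h3, h4⟩
    tauto
  have h13 : ∀ e, e ∈ 𝒜₁ → e ∈ 𝒜₃ → False := by
    rintro e ⟨h1, h2⟩ ⟨h3, h4⟩
    rcases h2 with h2 | h2
    · exact h2 h3
    rcases h4 with h4 | h4
    · exact h4 (hM _ e h2).2.1
    · exact absurd (h2.2.symm.trans h4.2) (by simp)
  have hM1 : M true ⊆ 𝒜₁ := fun e he => ⟨(hM _ e he).1, Or.inr he⟩
  have hM2 : ∀ b, M b ⊆ 𝒜₂ := fun b e he => ⟨(hM _ e he).2.1, Or.inr (hM _ e he).2.2⟩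
  have hM3 : M false ⊆ 𝒜₃ := fun e he => ⟨(hM _ e he).2.2, Or.inr he⟩
  have hMk : ∀ e, e ∈ G₁.edgeSet → e ∈ G₂.edgeSet → e ∈ G₃.edgeSet → e ∈ M true ∨ e ∈ M false := by
    intro e e1 e2 e3
    have := (hH e).2 ⟨⟨e1, e2⟩, e3⟩
    cases hke : k e
    · exact Or.inr ⟨this, hke⟩
    · exact Or.inl ⟨this, hke⟩
  obtain ⟨x, p₂, n₂, hx, hp₂⟩ := h₂.exists_isPolySystem (𝒜 := 𝒜₂) (fun e he => he.1)
  -- The nodes already drawn, to which the next class must be generic. For `𝒜₃` the nodes of `𝒜₁`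
  -- are added as well.
  set A₂ : Set Plane := range x ∪ ⋃ e, p₂ e '' Iic (n₂ e) with hA₂
  have hA₂f : A₂.Finite :=
    (finite_range x).union (finite_iUnion fun e => (finite_Iic _).image _)
  obtain ⟨p₁, n₁, hp₁, hp₁M, hp₁g⟩ := h₁.exists_isPolySystem_of_matching (𝒜 := 𝒜₁)
    (fun e he => he.1) hM1 (hM2 true) (hMM true) hx hp₂ hA₂f subset_union_left
  set A₁ : Set Plane := A₂ ∪ ⋃ e, p₁ e '' Iic (n₁ e) with hA₁
  have hA₁f : A₁.Finite := hA₂f.union (finite_iUnion fun e => (finite_Iic _).image _)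
  obtain ⟨p₃, n₃, hp₃, hp₃M, hp₃g⟩ := h₃.exists_isPolySystem_of_matching (𝒜 := 𝒜₃)
    (fun e he => he.1) hM3 (hM2 false) (hMM false) hx hp₂ hA₁f
    (subset_union_left.trans subset_union_left)
  have hnodes₂ : ∀ e, ∀ l ≤ n₂ e, p₂ e l ∈ A₂ := fun e l hl =>
    Or.inr (mem_iUnion.2 ⟨e, l, hl, rfl⟩)
  have hnodes₁ : ∀ e, ∀ l ≤ n₁ e, p₁ e l ∈ A₁ := fun e l hl =>
    Or.inr (mem_iUnion.2 ⟨e, l, hl, rfl⟩)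
  -- One common choice of curves for all graphs. It restricts to the given drawing on each class,
  -- because the classes overlap only in the prescribed matchings.
  let p : Sym2 V → ℕ → Plane := fun e => if e ∈ 𝒜₂ then p₂ e else if e ∈ 𝒜₁ then p₁ e else p₃ e
  let n : Sym2 V → ℕ := fun e => if e ∈ 𝒜₂ then n₂ e else if e ∈ 𝒜₁ then n₁ e else n₃ e
  have e₂ : ∀ e ∈ 𝒜₂, p e = p₂ e ∧ n e = n₂ e := fun e he => ⟨if_pos he, if_pos he⟩
  have e₁ : ∀ e ∈ 𝒜₁, p e = p₁ e ∧ n e = n₁ e := by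
    intro e he
    by_cases h2 : e ∈ 𝒜₂
    · have := hp₁M e (h12 e he h2)
      rw [this.1, this.2]
      exact e₂ e h2
    · exact ⟨(if_neg h2).trans (if_pos he), (if_neg h2).trans (if_pos he)⟩
  have e₃ : ∀ e ∈ 𝒜₃, p e = p₃ e ∧ n e = n₃ e := by
    intro e he
    by_cases h2 : e ∈ 𝒜₂
    · have := hp₃M e (h32 e he h2)
      rw [this.1, this.2]
      exact e₂ e h2
    · exact ⟨(if_neg h2).trans (if_neg fun h => h13 e h he),
        (if_neg h2).trans (if_neg fun h => h13 e h he)⟩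
  have s₁ := hp₁.congr e₁
  have s₂ := hp₂.congr e₂
  have s₃ := hp₃.congr e₃
  set c : Sym2 V → Set Plane := fun e => polySet (p e) (n e) with hc
  let Good : Sym2 V → Sym2 V → Prop := fun e f => (c e ∩ c f).Finite ∧
    ∀ z ∈ c e ∩ c f, z ∉ range x → CrossProperlyAt (c e) (c f) z
  have good_symm : ∀ e f, Good e f → Good f e := fun e f h =>
    ⟨inter_comm (c e) (c f) ▸ h.1, fun z hz hzx => (h.2 z hz.symm hzx).symm⟩
  have good_same : ∀ 𝒜, IsPolySystem 𝒜 x p n → ∀ e ∈ 𝒜, ∀ f ∈ 𝒜, e ≠ f → Good e f := by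
    intro 𝒜 h e he f hf hef
    have hsub : ∀ z ∈ c e ∩ c f, z ∈ range x := fun z hz => h.inter e he f hf hef z hz.1 hz.2
    exact ⟨(finite_range x).subset hsub, fun z hz hzx => absurd (hsub z hz) hzx⟩
  have good_generic : ∀ 𝒜 ℬ, IsPolySystem 𝒜 x p n → IsPolySystem ℬ x p n → ∀ A, ∀ e ∈ 𝒜, ∀ f ∈ ℬ,
      IsGenericPoly A (p e) (n e) → (∀ l ≤ n f, p f l ∈ A) → Good e f := by
    intro 𝒜 ℬ h𝒜 hℬ A e he f hf hg hA
    have h1 := h𝒜.simple e he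
    have h2 := hℬ.simple f hf
    refine ⟨hg.finite_inter h2.2.1 hA, fun z hz hzx => ?_⟩
    refine hg.crossProperlyAt h1.2.1 h2.2.1 hA hz.1 hz.2 ?_ ?_
    · rintro rfl; exact hzx (h1.2.2.1 ▸ mem_range_self _)
    · rintro rfl; exact hzx (h1.2.2.2 ▸ mem_range_self _)
  have good12 : ∀ e ∈ 𝒜₁, ∀ f ∈ 𝒜₂, e ≠ f → Good e f := by
    intro e he f hf hef
    -- A prescribed edge is not generic, but it belongs to `𝒜₂` too and so does not cross `f` at
    -- all.
    by_cases h2 : e ∈ 𝒜₂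
    · exact good_same _ s₂ e h2 f hf hef
    · refine good_generic _ _ s₁ s₂ A₂ e he f hf ?_ ?_
      · rw [(e₁ e he).1, (e₁ e he).2]
        exact hp₁g e he fun h => h2 (hM2 _ h)
      · rw [(e₂ f hf).1, (e₂ f hf).2]
        exact hnodes₂ f
  have good32 : ∀ e ∈ 𝒜₃, ∀ f ∈ 𝒜₂, e ≠ f → Good e f := by
    intro e he f hf hef
    by_cases h2 : e ∈ 𝒜₂
    · exact good_same _ s₂ e h2 f hf hef
    · refine good_generic _ _ s₃ s₂ A₁ e he f hf ?_ ?_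
      · rw [(e₃ e he).1, (e₃ e he).2]
        exact hp₃g e he fun h => h2 (hM2 _ h)
      · rw [(e₂ f hf).1, (e₂ f hf).2]
        exact fun l hl => Or.inl (hnodes₂ f l hl)
  have good31 : ∀ e ∈ 𝒜₃, ∀ f ∈ 𝒜₁, e ≠ f → Good e f := by
    intro e he f hf hef
    by_cases h2 : e ∈ 𝒜₂
    · exact good_symm _ _ (good12 f hf e h2 hef.symm)
    · refine good_generic _ _ s₃ s₁ A₁ e he f hf ?_ ?_
      · rw [(e₃ e he).1, (e₃ e he).2]
        exact hp₃g e he fun h => h2 (hM2 _ h)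
      · rw [(e₁ f hf).1, (e₁ f hf).2]
        exact hnodes₁ f
  have draw : ∀ (G : SimpleGraph V) (𝒜 ℬ : Set (Sym2 V)), IsPolySystem 𝒜 x p n →
      IsPolySystem ℬ x p n → (∀ e ∈ ℬ, ∀ f ∈ 𝒜, e ≠ f → Good e f) → G.edgeSet ⊆ 𝒜 ∪ ℬ →
      ∃ Γ : GraphDrawing G, Γ.IsQuasiplanar ∧ (∀ v, Γ.pos v = x v) ∧ ∀ e, Γ.curve e = c e := by
    intro G 𝒜 ℬ h𝒜 hℬ hg hcov
    have hgood : ∀ e ∈ G.edgeSet, ∀ f ∈ G.edgeSet, e ≠ f → Good e f := by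
      intro e he f hf hef
      rcases hcov he with he | he <;> rcases hcov hf with hf | hf
      · exact good_same _ h𝒜 e he f hf hef
      · exact good_symm _ _ (hg f hf e he hef.symm)
      · exact hg e he f hf hef
      · exact good_same _ hℬ e he f hf hef
    refine exists_quasiplanar_drawing hx c (fun e he => ?_) (fun e he => ?_)
      (fun e he f hf hef => (hgood e he f hf hef).1) (fun e he f hf hef => (hgood e he f hf hef).2)
      hcov h𝒜.inter hℬ.inter
    · rcases hcov he with he | he
      · exact (h𝒜.isPolyArc he).isSimpleArc
      · exact (hℬ.isPolyArc he).isSimpleArc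
    · rcases hcov he with he | he
      · exact h𝒜.vert e he
      · exact hℬ.vert e he
  have hcov1 : G₁.edgeSet ⊆ 𝒜₁ ∪ 𝒜₃ := by
    intro e he
    by_cases h3 : e ∈ G₃.edgeSet
    · by_cases h2 : e ∈ G₂.edgeSet
      · rcases hMk e he h2 h3 with h | h
        · exact Or.inl (hM1 h)
        · exact Or.inr (hM3 h)
      · exact Or.inr ⟨h3, Or.inl h2⟩
    · exact Or.inl ⟨he, Or.inl h3⟩
  have hcov2 : G₂.edgeSet ⊆ 𝒜₂ ∪ 𝒜₁ := by
    intro e he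
    by_cases h1 : e ∈ G₁.edgeSet
    · by_cases h3 : e ∈ G₃.edgeSet
      · exact Or.inl ⟨he, Or.inr h3⟩
      · exact Or.inr ⟨h1, Or.inl h3⟩
    · exact Or.inl ⟨he, Or.inl h1⟩
  have hcov3 : G₃.edgeSet ⊆ 𝒜₂ ∪ 𝒜₃ := by
    intro e he
    by_cases h2 : e ∈ G₂.edgeSet
    · exact Or.inl ⟨h2, Or.inr he⟩
    · exact Or.inr ⟨he, Or.inl h2⟩
  have hall : ∀ i, ∃ Γ : GraphDrawing (![G₁, G₂, G₃] i), Γ.IsQuasiplanar ∧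
      (∀ v, Γ.pos v = x v) ∧ ∀ e, Γ.curve e = c e := by
    intro i
    fin_cases i
    · exact draw G₁ _ _ s₁ s₃ good31 hcov1
    · exact draw G₂ _ _ s₂ s₁ good12 hcov2
    · exact draw G₃ _ _ s₂ s₃ good32 hcov3
  choose Γ hΓ hpos hcurve using hall
  exact ⟨Γ, hΓ, fun i j v => by rw [hpos, hpos], fun i j e hi hj => by rw [hcurve, hcurve]⟩
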